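/- Let $T>0$ and let $\mathbf w:\mathbb R\to\mathbb R$ be $C^\infty$, even, non-negative and $T$-periodic, with $\mathbf w(0)=0$, $\mathbf w''(0)>0$ and $\mathbf w(z)>0$ for $z\notin T\mathbb Z$. For $\epsilon>0$ put $W_\epsilon=\epsilon^{-2}\mathbf w$, let $\lambda_{1,z}=\lambda_{1,z}(\epsilon)$ be the lowest eigenvalue of $H_z=-\frac12\frac{d^2}{dz^2}+W_\epsilon$ acting on $T$-periodic functions, and let $\phi_1$ be a ground state of it (an eigenfunction for $\lambda_{1,z}$) with $\int_{-T/2}^{T/2}|\phi_1|^2\,dz=1$; both exist. For an integer $N\ge1$, $g\ge0$ and $0\le\Omega<\omega_\perp$, let $$E_\Omega^{per,N}=\inf_\Psi\int_{\mathbb R^2\times(-\frac{NT}2,\frac{NT}2)}\Big(\tfrac12|\nabla\Psi-i\,\Omega(-y,x,0)\Psi|^2-\tfrac12\Omega^2r^2|\Psi|^2+\big(\tfrac12\omega_\perp^2r^2+W_\epsilon(z)\big)|\Psi|^2+g|\Psi|^4\Big)\,dx\,dy\,dz,$$ where $r^2=x^2+y^2$ and the infimum is over all $\Psi\in H^1_{loc}(\mathbb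 R^3;\mathbb C)$ that are $NT$-periodic in $z$, whose restriction to $\mathbb R^2\times(-\frac{NT}2,\frac{NT}2)$ lies in $H^1$ with $r\Psi\in L^2$, and which have $\int_{\mathbb R^2\times(-\frac{NT}2,\frac{NT}2)}|\Psi|^2=1$. Put $$I_N=\frac{g\,\omega_\perp}{2\pi N}\int_{-T/2}^{T/2}|\phi_1(z)|^4\,dz .$$ 1. (Universal bounds.) For all $\epsilon>0$, $N\ge 1$, $g\ge0$ and $0\le\Omega<\omega_\perp$, $$\lambda_{1,z}+\omega_\perp\le E_\Omega^{per,N}\le\lambda_{1,z}+\omega_\perp+I_N .$$ 2. There is a constant $c_4>0$, depending only on $\mathbf w$ and $T$, such that for every fixed $N\ge1$ and all $g=g(\epsilon)\ge0$, $\omega_\perp=\omega_\perp(\epsilon)>0$, $$I_N\sim\frac{c_4}{2\pi}\,\frac{g\,\omega_\perp}{N}\,\epsilon^{-1/2}\qquad(\epsilon\to0^+).$$ 3. (Quasi-linear regime.) Fix $N\ge1$ and let $g=g(\epsilon)\ge0$ and $0\le\Omega(\epsilon)<\omega_\perp(\epsilon)$ be arbitrary functions of $\epsilon>0$. If either (QLa)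 $g=o(\epsilon^{1/2})$ or (QLb) $g\,\omega_\perp\,\epsilon^{1/2}=o(1)$ as $\epsilon\to0^+$, then $$E_\Omega^{per,N}=(\lambda_{1,z}+\omega_\perp)\,(1+o(1))\qquad(\epsilon\to0^+).$$ -/

import Mathlib

open Asymptotics Filter Topology MeasureTheory
open scoped ContDiff

noncomputable section

namespace OpticalLattice

/-- The standing assumption on the lattice profile `w`: smooth, even, non-negative, `T`-periodic,
vanishing exactly on `T ℤ`, with a non-degenerate minimum at `0`. -/
structure IsLatticeProfile (T : ℝ) (w : ℝ → ℝ) : Prop where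
  period_pos : 0 < T
  smooth : ContDiff ℝ ∞ w
  even : ∀ z, w (-z) = w z
  nonneg : ∀ z, 0 ≤ w z
  periodic : ∀ z, w (z + T) = w z
  zero : w 0 = 0
  nondegenerate : 0 < iteratedDeriv 2 w 0
  pos : ∀ z, (∀ k : ℤ, z ≠ k * T) → 0 < w z

/-- The optical potential `W_ε(z) = w(z) / ε²`. -/
def latticePotential (w : ℝ → ℝ) (ε z : ℝ) : ℝ := w z / ε ^ 2

/-! ### The longitudinal linear problem -/

/-- `φ` is a non-zero `T`-periodic solution of `-φ''/2 + W_ε φ = μ φ`, i.e. an eigenfunction for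
the eigenvalue `μ` of the `T`-periodic realization of `H_z = -(1/2) d²/dz² + W_ε`. (The potential
being smooth, the eigenfunctions of that operator are classical solutions.) -/
structure IsPeriodicEigenfunction (T : ℝ) (w : ℝ → ℝ) (ε μ : ℝ) (φ : ℝ → ℂ) : Prop where
  contDiff : ContDiff ℝ 2 φ
  periodic : ∀ z, φ (z + T) = φ z
  ne_zero : ∃ z, φ z ≠ 0
  equation : ∀ z, -(1 / 2 : ℂ) * iteratedDeriv 2 φ z + (latticePotential w ε z : ℂ) * φ z
    = (μ : ℂ) * φ z

/-- The eigenvalues of the `T`-periodic realization of `H_z`. -/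
def periodicEigenvalues (T : ℝ) (w : ℝ → ℝ) (ε : ℝ) : Set ℝ :=
  {μ | ∃ φ, IsPeriodicEigenfunction T w ε μ φ}

/-- The lowest eigenvalue `λ_{1,z}` of the `T`-periodic realization of `H_z`. -/
def lambdaOne (T : ℝ) (w : ℝ → ℝ) (ε : ℝ) : ℝ := sInf (periodicEigenvalues T w ε)

/-- `φ` is an `L²(-T/2, T/2)`-normalized ground state of the `T`-periodic realization of `H_z`. -/
structure IsGroundState (T : ℝ) (w : ℝ → ℝ) (ε : ℝ) (φ : ℝ → ℂ) : Prop where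
  eigen : IsPeriodicEigenfunction T w ε (lambdaOne T w ε) φ
  normalized : ∫ z in (-(T / 2))..(T / 2), ‖φ z‖ ^ 2 = 1

/-- The interaction energy `I_N = g ω⊥ / (2 N π) ∫_{-T/2}^{T/2} |φ₁|⁴` of the linear ground state. -/
def interactionEnergy (T : ℝ) (N : ℕ) (g ωperp : ℝ) (φ₁ : ℝ → ℂ) : ℝ :=
  g * ωperp / (2 * N * Real.pi) * ∫ z in (-(T / 2))..(T / 2), ‖φ₁ z‖ ^ 4

/-! ### The nonlinear problem in `ℝ² × (ℝ / N T ℤ)`; points of `ℝ³` are `(x, y, z)` -/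

/-- `u'` is the weak (distributional) derivative of `u` on `ℝ³` in the direction `v`. -/
structure HasWeakDeriv (v : ℝ × ℝ × ℝ) (u u' : ℝ × ℝ × ℝ → ℂ) : Prop where
  locallyIntegrable : LocallyIntegrable u volume
  locallyIntegrable_deriv : LocallyIntegrable u' volume
  integral_eq : ∀ θ : ℝ × ℝ × ℝ → ℝ, ContDiff ℝ ∞ θ → HasCompactSupport θ →
    ∫ p, fderiv ℝ θ p v • u p = -∫ p, θ p • u' p

/-- The slab `ℝ² × (-L/2, L/2)`. -/
def slab (L : ℝ) : Set (ℝ × ℝ × ℝ) := {p | p.2.2 ∈ Set.Ioo (-(L / 2)) (L / 2)}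

/-- `Ψ` belongs to the natural form domain of the `L`-periodic problem and is normalized, and
`(Ψx, Ψy, Ψz)` is its weak gradient: `Ψ` is (almost everywhere) `L`-periodic in `z`, it has a weak
gradient on the whole of `ℝ³`, on the slab `Ψ`, its gradient and `√(x² + y²) Ψ` are square
integrable (so `Ψ` is `H¹_loc` on `ℝ³` by periodicity), and the `L²` norm on the slab is `1`. -/
structure IsNormalizedState (L : ℝ) (Ψ Ψx Ψy Ψz : ℝ × ℝ × ℝ → ℂ) : Prop where
  periodic : ∀ᵐ p : ℝ × ℝ × ℝ, Ψ (p.1, p.2.1, p.2.2 + L) = Ψ p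
  weak_x : HasWeakDeriv (1, 0, 0) Ψ Ψx
  weak_y : HasWeakDeriv (0, 1, 0) Ψ Ψy
  weak_z : HasWeakDeriv (0, 0, 1) Ψ Ψz
  memLp : MemLp Ψ 2 (volume.restrict (slab L))
  memLp_x : MemLp Ψx 2 (volume.restrict (slab L))
  memLp_y : MemLp Ψy 2 (volume.restrict (slab L))
  memLp_z : MemLp Ψz 2 (volume.restrict (slab L))
  memLp_weight :
    MemLp (fun p => (√(p.1 ^ 2 + p.2.1 ^ 2) : ℂ) * Ψ p) 2 (volume.restrict (slab L))
  normalized : ∫ p in slab L, ‖Ψ p‖ ^ 2 = 1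

/-- The energy
`∫ (1/2) |∇Ψ - i Ω × r Ψ|² - (1/2) Ω² r² |Ψ|² + ((1/2) ω⊥² r² + W_ε(z)) |Ψ|² + g |Ψ|⁴`
over the slab `ℝ² × (-L/2, L/2)`, where `Ω × r = Ω (-y, x, 0)` and `r² = x² + y²`. Both integrands
are integrable on the form domain, the second one by the Sobolev embedding `H¹ ⊂ L⁴`. -/
def energy (L : ℝ) (w : ℝ → ℝ) (ε g ωperp Ω : ℝ) (Ψ Ψx Ψy Ψz : ℝ × ℝ × ℝ → ℂ) : ℝ :=
  (∫ p in slab L,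
    ((1 / 2) * (‖Ψx p - Complex.I * (Ω * (-p.2.1) : ℝ) * Ψ p‖ ^ 2
        + ‖Ψy p - Complex.I * (Ω * p.1 : ℝ) * Ψ p‖ ^ 2 + ‖Ψz p‖ ^ 2)
      - (1 / 2) * Ω ^ 2 * (p.1 ^ 2 + p.2.1 ^ 2) * ‖Ψ p‖ ^ 2
      + ((1 / 2) * ωperp ^ 2 * (p.1 ^ 2 + p.2.1 ^ 2) + latticePotential w ε p.2.2) * ‖Ψ p‖ ^ 2))
  + g * ∫ p in slab L, ‖Ψ p‖ ^ 4

/-- The ground state energy `E_Ω^{per,N}`. -/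
def groundEnergy (T : ℝ) (w : ℝ → ℝ) (N : ℕ) (ε g ωperp Ω : ℝ) : ℝ :=
  sInf {e | ∃ Ψ Ψx Ψy Ψz, IsNormalizedState (N * T) Ψ Ψx Ψy Ψz ∧
    e = energy (N * T) w ε g ωperp Ω Ψ Ψx Ψy Ψz}

end OpticalLattice

end

open OpticalLattice

/-!
# Reduced energies of a condensate in an optical lattice

**The longitudinal problem.** Shooting (`exists_neumann_solution`) and reflection give a positive
periodic solution `f` of `-f''/2 + W_ε f = μ f`. With `a = f'/f`, Jacobi's identity writes the
quadratic form of `H_z - μ` as `½ ∫ |ψ' - aψ|²`. It follows that `μ` is the lowest eigenvalue, and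
that every normalized ground state has modulus `f` when `f` is normalized
(`exists_positive_groundState`, `IsGroundState.norm_eq`).

**The universal bounds.** The same idea works in three dimensions. Put `D_x = ∂_x + ω⊥ x`,
`D_y = ∂_y + ω⊥ y`. Pointwise (`energy_density_eq`), the density of the linear energy is
`½|D_xΨ|² + ½|D_yΨ|² - (Ω/ω⊥) ⟨iD_xΨ, D_yΨ⟩ + ½|∂_zΨ - aΨ|²` plus terms whose integrals are known:
the derivatives of `|Ψ|²` are integrated by parts, the vorticity `⟨i∂_xΨ, ∂_yΨ⟩` is a divergence
and has mean zero, and the Riccati equation for `a` produces the eigenvalue. So the linear energy of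
every normalized state is `λ + ω⊥` plus the integral of this quadratic expression
(`IsNormalizedState.energy_eq`), which is non-negative because `Ω < ω⊥`. For the product of the
transverse Gaussian with `f` it vanishes, and only the interaction term is left
(`energy_productState`).

The integrations by parts hold for Sobolev functions that are merely periodic in `z` and square
integrable on the slab. Mollification proves them against compactly supported test functions
(`HasWeakDeriv.integral_fderiv_mul_norm_sq`, `integral_jacobian`); a periodic partition of unity in
`z` and transverse cutoffs carry them over to the slab (`setIntegral_slab_eq`).

**The semiclassical limit.** With `κ = √(w''(0))`, the periodic Gaussian
`exp (-κ (1 - cos kz) / (k² ε))`, `k = 2π/T`, is compared with `f`. One obtains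
`λ = κ/(2ε) + O(1)`, moment bounds at the scale `√ε` and an `O(1)` bound for `‖f' + κ S f / ε‖²`,
where `S = sin (kz) / k` (`exists_semiclassicalBounds`). Hence `√ε f(√ε y)²` is bounded by a multiple
of `1/(1 + y²)` and converges to the normalized Gaussian density `(κ/π)^{1/2} e^{-κy²}`, so that
`√ε ∫ f⁴` tends to the integral `c₄` of the square of that density (`tendsto_integral_pow_four`).
In the quasi-linear regimes the interaction energy, of order `g ω⊥ ε^{-1/2}`, is then small compared
with `ω⊥` or with `1/ε`, hence compared with `λ + ω⊥`.
-/

namespace OpticalLattice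

/-! ### Linear ordinary differential equations with a parameter -/

/-- Integration from `0` divides an exponential bound by its rate; with `a = 2M` this gains the
factor `1/2` in each step of the Picard iteration. -/
theorem norm_integral_le_of_exp_bound {E : Type*} [NormedAddCommGroup E] [NormedSpace ℝ E]
    {f : ℝ → E} {K a : ℝ} (ha : 0 < a) (hf : ∀ s, ‖f s‖ ≤ K * Real.exp (a * |s|)) (t : ℝ) :
    ‖∫ s in (0 : ℝ)..t, f s‖ ≤ K / a * Real.exp (a * |t|) := by
  have hK : 0 ≤ K := by
    have := (norm_nonneg _).trans (hf 0)
    simpa using this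
  have key : ∀ g : ℝ → E, (∀ s, ‖g s‖ ≤ K * Real.exp (a * |s|)) → ∀ t, 0 ≤ t →
      ‖∫ s in (0 : ℝ)..t, g s‖ ≤ K / a * Real.exp (a * |t|) := by
    intro g hg t ht
    have h1 : ‖∫ s in (0 : ℝ)..t, g s‖ ≤ ∫ s in (0 : ℝ)..t, K * Real.exp (a * s) := by
      apply intervalIntegral.norm_integral_le_of_norm_le ht
      · refine Eventually.of_forall fun s hs => ?_
        have := hg s
        rwa [abs_of_pos hs.1] at this
      · exact (by fun_prop : Continuous fun s => K * Real.exp (a * s)).intervalIntegrable _ _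
    have hd : ∀ s ∈ Set.uIcc 0 t, HasDerivAt (fun s => K / a * Real.exp (a * s))
        (K * Real.exp (a * s)) s := by
      intro s _
      have := (((hasDerivAt_id s).const_mul a).exp).const_mul (K / a)
      convert! this using 1
      simp; field_simp
    have h2 := intervalIntegral.integral_eq_sub_of_hasDerivAt hd
      ((by fun_prop : Continuous fun s => K * Real.exp (a * s)).intervalIntegrable _ _)
    rw [h2] at h1
    rw [abs_of_nonneg ht]
    have : 0 ≤ K / a * Real.exp (a * 0) := by positivity
    linarith
  rcases le_total 0 t with ht | ht
  · exact key f hf t ht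
  · have h := key (fun s => f (-s)) (fun s => by simpa using hf (-s)) (-t) (by linarith)
    rw [intervalIntegral.integral_comp_neg] at h
    rw [intervalIntegral.integral_symm, norm_neg]
    simpa using h

/-- The terms of the Picard series of the linear equation `y' = A(p, t) y`, `y(0) = x₀`. -/
noncomputable def picardTerm {P E : Type*} [NormedAddCommGroup E] [NormedSpace ℝ E]
    (A : P → ℝ → E →L[ℝ] E) (x₀ : E) : ℕ → P → ℝ → E
  | 0 => fun _ _ => x₀
  | n + 1 => fun p t => ∫ s in (0 : ℝ)..t, A p s (picardTerm A x₀ n p s)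

/-- A linear equation whose coefficient is bounded and jointly continuous in a parameter and in
time has global solutions, jointly continuous in the parameter and time: the Picard series
converges, its `n`-th term being at most `2⁻ⁿ e^{2M|t|} ‖x₀‖`. -/
theorem exists_linearODE_solution {P E : Type*} [TopologicalSpace P]
    [NormedAddCommGroup E] [NormedSpace ℝ E] [CompleteSpace E]
    (A : P → ℝ → E →L[ℝ] E) (hA : Continuous fun q : P × ℝ => A q.1 q.2)
    {M : ℝ} (hM : 0 < M) (hAM : ∀ p t, ‖A p t‖ ≤ M) (x₀ : E) :
    ∃ y : P → ℝ → E, (Continuous fun q : P × ℝ => y q.1 q.2) ∧ (∀ p, y p 0 = x₀) ∧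
      ∀ p t, HasDerivAt (y p) (A p t (y p t)) t := by
  set a := picardTerm A x₀ with ha
  have a_zero : ∀ p t, a 0 p t = x₀ := fun p t => rfl
  have a_succ : ∀ n p t, a (n + 1) p t = ∫ s in (0 : ℝ)..t, A p s (a n p s) := fun n p t => rfl
  have cont : ∀ n, Continuous fun q : P × ℝ => a n q.1 q.2 := by
    intro n
    induction n with
    | zero => exact continuous_const
    | succ n ih =>
      simp only [a_succ]
      refine intervalIntegral.continuous_parametric_intervalIntegral_of_continuous
        (f := fun (q : P × ℝ) s => A q.1 s (a n q.1 s)) ?_ continuous_snd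
      have e : Continuous fun r : (P × ℝ) × ℝ => (r.1.1, r.2) := by fun_prop
      exact (hA.comp e).clm_apply (ih.comp e)
  have bound : ∀ n p t, ‖a n p t‖ ≤ ‖x₀‖ * (1 / 2) ^ n * Real.exp (2 * M * |t|) := by
    intro n
    induction n with
    | zero =>
      intro p t
      rw [a_zero, pow_zero, mul_one]
      have : 1 ≤ Real.exp (2 * M * |t|) := Real.one_le_exp (by positivity)
      nlinarith [norm_nonneg x₀]
    | succ n ih =>
      intro p t
      rw [a_succ]
      have h := norm_integral_le_of_exp_bound (f := fun s => A p s (a n p s))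
        (K := M * (‖x₀‖ * (1 / 2) ^ n)) (a := 2 * M) (by positivity) (fun s => by
          refine ((A p s).le_opNorm _).trans ?_
          rw [mul_assoc]
          exact mul_le_mul (hAM p s) (ih p s) (norm_nonneg _) hM.le) t
      refine h.trans (le_of_eq ?_)
      rw [pow_succ]; field_simp
  have sumu : ∀ R : ℝ, Summable fun n : ℕ => ‖x₀‖ * (1 / 2) ^ n * Real.exp (2 * M * R) := by
    intro R
    exact ((summable_geometric_of_lt_one (by norm_num) (by norm_num)).mul_left _).mul_right _
  have boundR : ∀ R n p t, |t| ≤ R → ‖a n p t‖ ≤ ‖x₀‖ * (1 / 2) ^ n * Real.exp (2 * M * R) := by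
    intro R n p t ht
    refine (bound n p t).trans ?_
    gcongr
  have summ : ∀ p t, Summable fun n => a n p t := fun p t =>
    Summable.of_norm_bounded (sumu |t|) (fun n => bound n p t)
  refine ⟨fun p t => ∑' n, a n p t, ?_, ?_, ?_⟩
  · rw [continuous_iff_continuousAt]
    rintro ⟨p, t⟩
    have hopen : {q : P × ℝ | |q.2| < |t| + 1} ∈ 𝓝 (p, t) :=
      (isOpen_lt (by fun_prop) continuous_const).mem_nhds (by simp)
    refine ContinuousOn.continuousAt (s := {q : P × ℝ | |q.2| < |t| + 1}) ?_ hopen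
    exact continuousOn_tsum (fun n => (cont n).continuousOn) (sumu (|t| + 1))
      (fun n q hq => boundR _ n q.1 q.2 (le_of_lt hq))
  · intro p
    refine (tsum_eq_single 0 ?_).trans (a_zero p 0)
    intro n hn
    obtain ⟨m, rfl⟩ := Nat.exists_eq_succ_of_ne_zero hn
    simp [a_succ]
  · intro p t
    have hc : ∀ n, Continuous fun s => A p s (a n p s) := by
      intro n
      have e : Continuous fun s : ℝ => (p, s) := by fun_prop
      exact (hA.comp e).clm_apply ((cont n).comp e)
    have hd : HasDerivAt (fun t => ∑' n, a (n + 1) p t) (∑' n, A p t (a n p t)) t := by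
      have htmem : t ∈ Metric.ball (0 : ℝ) (|t| + 1) := by simp
      have hconn : IsPreconnected (Metric.ball (0 : ℝ) (|t| + 1)) :=
        (convex_ball (0 : ℝ) (|t| + 1)).isPreconnected
      refine hasDerivAt_tsum_of_isPreconnected (g := fun n t => a (n + 1) p t)
        (g' := fun n t => A p t (a n p t))
        (u := fun n => M * (‖x₀‖ * (1 / 2) ^ n * Real.exp (2 * M * (|t| + 1))))
        (t := Metric.ball (0 : ℝ) (|t| + 1)) ((sumu _).mul_left M) Metric.isOpen_ball
        hconn ?_ ?_ htmem ?_ htmem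
      · intro n s _
        exact intervalIntegral.integral_hasDerivAt_right ((hc n).intervalIntegrable _ _)
          (hc n).stronglyMeasurable.stronglyMeasurableAtFilter (hc n).continuousAt
      · intro n s hs
        refine ((A p s).le_opNorm _).trans ?_
        refine mul_le_mul (hAM p s) (boundR _ n p s ?_) (norm_nonneg _) hM.le
        simpa using (Metric.mem_ball.1 hs).le
      · exact (summable_nat_add_iff 1).2 (summ p t)
    have e1 : (fun t => ∑' n, a n p t) = fun t => x₀ + ∑' n, a (n + 1) p t := by
      funext s
      rw [(summ p s).tsum_eq_zero_add, a_zero]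
    change HasDerivAt (fun t => ∑' n, a n p t) (A p t (∑' n, a n p t)) t
    rw [e1, ((A p t).map_tsum (summ p t))]
    exact hd.const_add x₀

/-! ### The positive periodic solution of Hill's equation -/

/-- The matrix of the first order system `(f, f')' = (f', c f)`. -/
noncomputable def hillMatrix (c : ℝ) : ℝ × ℝ →L[ℝ] ℝ × ℝ :=
  (ContinuousLinearMap.inl ℝ ℝ ℝ).comp (ContinuousLinearMap.snd ℝ ℝ ℝ) +
    c • (ContinuousLinearMap.inr ℝ ℝ ℝ).comp (ContinuousLinearMap.fst ℝ ℝ ℝ)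

@[simp] theorem hillMatrix_apply (c : ℝ) (y : ℝ × ℝ) : hillMatrix c y = (y.2, c * y.1) := by
  simp [hillMatrix]

theorem exists_norm_hillMatrix_le (K : ℝ) :
    ∃ M : ℝ, 0 < M ∧ ∀ c, |c| ≤ K → ‖hillMatrix c‖ ≤ M := by
  refine ⟨‖(ContinuousLinearMap.inl ℝ ℝ ℝ).comp (ContinuousLinearMap.snd ℝ ℝ ℝ)‖ +
    |K| * ‖(ContinuousLinearMap.inr ℝ ℝ ℝ).comp (ContinuousLinearMap.fst ℝ ℝ ℝ)‖ + 1,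
    by positivity, fun c hc => ?_⟩
  refine (norm_add_le _ _).trans ?_
  rw [norm_smul, Real.norm_eq_abs]
  have : |c| ≤ |K| := hc.trans (le_abs_self K)
  have := mul_le_mul_of_nonneg_right this
    (norm_nonneg ((ContinuousLinearMap.inr ℝ ℝ ℝ).comp (ContinuousLinearMap.fst ℝ ℝ ℝ)))
  linarith

/-- Uniqueness for `f'' = c f`, with bounded `c` and Cauchy data at `t₀`. -/
theorem hill_unique {c : ℝ → ℝ} {K : ℝ} (hc : ∀ t, |c t| ≤ K) {f f' g g' : ℝ → ℝ}
    (hf : ∀ t, HasDerivAt f (f' t) t) (hf' : ∀ t, HasDerivAt f' (c t * f t) t)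
    (hg : ∀ t, HasDerivAt g (g' t) t) (hg' : ∀ t, HasDerivAt g' (c t * g t) t)
    {t₀ : ℝ} (h0 : f t₀ = g t₀) (h1 : f' t₀ = g' t₀) : f = g := by
  obtain ⟨M, hM, hcM⟩ := exists_norm_hillMatrix_le K
  have h := ODE_solution_unique_univ (v := fun t y => hillMatrix (c t) y) (s := fun _ => Set.univ)
    (f := fun t => (f t, f' t)) (g := fun t => (g t, g' t)) (K := M.toNNReal) (t₀ := t₀)
    (fun t => by
      refine ((hillMatrix (c t)).lipschitz.weaken ?_).lipschitzOnWith
      rw [← NNReal.coe_le_coe, Real.coe_toNNReal _ hM.le]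
      exact hcM _ (hc t))
    (fun t => ⟨by simpa using (hf t).prodMk (hf' t), trivial⟩)
    (fun t => ⟨by simpa using (hg t).prodMk (hg' t), trivial⟩) (by simp [h0, h1])
  funext t
  exact congrArg Prod.fst (congrFun h t)

/-- Shooting: the solution of `φ'' = 2 (V - μ) φ`, `φ(0) = 1`, `φ'(0) = 0` is followed from `μ = 0`,
where it is increasing on `[0, b]`, to the first `μ` for which it vanishes in `[0, b]`. There it
vanishes at `b` with negative slope, so that for some smaller `μ` the slope at `b` is zero. -/
theorem exists_neumann_solution {V : ℝ → ℝ} (hV : Continuous V) {MV : ℝ} (hV0 : ∀ z, 0 ≤ V z)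
    (hVM : ∀ z, V z ≤ MV) {b : ℝ} (hb : 0 < b) :
    ∃ μ : ℝ, ∃ f f' : ℝ → ℝ, (∀ t, HasDerivAt f (f' t) t) ∧
      (∀ t, HasDerivAt f' (2 * (V t - μ) * f t) t) ∧ f' 0 = 0 ∧ f' b = 0 ∧
      ∀ t ∈ Set.Icc 0 b, 0 < f t := by
  set k : ℝ := Real.pi / (2 * b) with hk
  have hkpos : 0 < k := by positivity
  have hMV : 0 ≤ MV := (hV0 0).trans (hVM 0)
  set B : ℝ := MV + k ^ 2 with hB
  have hBpos : 0 < B := by positivity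
  -- the parameter is clamped to `[0, B]` to keep the coefficient bounded
  set pr : ℝ → ℝ := fun p => max 0 (min p B) with hpr
  have hpr0 : ∀ p, 0 ≤ pr p := fun p => le_max_left _ _
  have hprB : ∀ p, pr p ≤ B := fun p => max_le hBpos.le (min_le_right _ _)
  have hpr_id : ∀ p, 0 ≤ p → p ≤ B → pr p = p := by
    intro p h0 h1
    simp only [hpr]; rw [min_eq_left h1, max_eq_right h0]
  have hcb : ∀ p t, |2 * (V t - pr p)| ≤ 2 * (MV + B) := by
    intro p t
    rw [abs_le]
    constructor <;> nlinarith [hV0 t, hVM t, hpr0 p, hprB p]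
  obtain ⟨M, hM, hcM⟩ := exists_norm_hillMatrix_le (2 * (MV + B))
  obtain ⟨y, hyc, hy0, hyd⟩ := exists_linearODE_solution
    (fun (p t : ℝ) => hillMatrix (2 * (V t - pr p)))
    (by unfold hillMatrix; simp only [hpr]; fun_prop) hM (fun p t => hcM _ (hcb p t))
    ((1 : ℝ), (0 : ℝ))
  have hd1 : ∀ p t, HasDerivAt (fun t => (y p t).1) ((y p t).2) t := by
    intro p t
    simpa using! (hasFDerivAt_fst.comp_hasDerivAt t (hyd p t))
  have hd2 : ∀ p t, HasDerivAt (fun t => (y p t).2) (2 * (V t - pr p) * (y p t).1) t := by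
    intro p t
    simpa using! (hasFDerivAt_snd.comp_hasDerivAt t (hyd p t))
  have hc1 : ∀ p, Continuous fun t => (y p t).1 := fun p =>
    continuous_iff_continuousAt.2 fun t => (hd1 p t).continuousAt
  have hne : ∀ p t, ¬ ((y p t).1 = 0 ∧ (y p t).2 = 0) := by
    rintro p t ⟨h1, h2⟩
    have := hill_unique (hcb p) (hd1 p) (hd2 p) (g := fun _ => 0) (g' := fun _ => 0)
      (fun t => hasDerivAt_const _ _) (fun t => by simpa using hasDerivAt_const t (0 : ℝ)) h1 h2
    have h := congrFun this 0
    simp [hy0] at h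
  -- the set of parameters for which the solution has a zero
  set C : Set (ℝ × ℝ) := (Set.Icc 0 B ×ˢ Set.Icc 0 b) ∩ {q | (y q.1 q.2).1 ≤ 0} with hC
  have hCc : IsCompact C := (isCompact_Icc.prod isCompact_Icc).inter_right
    (isClosed_le (continuous_fst.comp hyc) continuous_const)
  have hCne : C.Nonempty := by
    by_contra hemp
    have hpos : ∀ t ∈ Set.Icc 0 b, 0 < (y B t).1 := by
      intro t ht
      by_contra hle
      exact hemp ⟨(B, t), ⟨⟨hBpos.le, le_rfl⟩, ht⟩, not_lt.1 hle⟩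
    -- for `μ = B` the Wronskian with the Neumann solution `cos (kt)`, which vanishes at `b`, is
    -- non-increasing from `0`, while it equals `k φ(b)` at `b`
    have hanti : AntitoneOn
        (fun t => (y B t).2 * Real.cos (k * t) + k * ((y B t).1 * Real.sin (k * t)))
        (Set.Icc 0 b) := by
      have hder : ∀ t, HasDerivAt
          (fun t => (y B t).2 * Real.cos (k * t) + k * ((y B t).1 * Real.sin (k * t)))
          ((2 * (V t - B) + k ^ 2) * (y B t).1 * Real.cos (k * t)) t := by
        intro t
        have hl : HasDerivAt (fun t => k * t) k t := by simpa using (hasDerivAt_id t).const_mul k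
        have h := ((hd2 B t).mul hl.cos).add (((hd1 B t).mul hl.sin).const_mul k)
        rw [hpr_id B hBpos.le le_rfl] at h
        convert! h using 1
        ring
      refine antitoneOn_of_hasDerivWithinAt_nonpos (convex_Icc _ _)
        (fun t _ => (hder t).continuousAt.continuousWithinAt)
        (fun t _ => (hder t).hasDerivWithinAt) ?_
      intro t ht
      rw [interior_Icc] at ht
      have h1 := hpos t ⟨ht.1.le, ht.2.le⟩
      have h2 : 0 ≤ Real.cos (k * t) := by
        apply Real.cos_nonneg_of_mem_Icc
        constructor
        · have : 0 ≤ k * t := mul_nonneg hkpos.le ht.1.le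
          linarith [Real.pi_pos]
        · rw [hk, div_mul_eq_mul_div, div_le_div_iff₀ (by positivity) (by norm_num)]
          nlinarith [Real.pi_pos, ht.2]
      have h3 : 2 * (V t - B) + k ^ 2 ≤ 0 := by nlinarith [hVM t, sq_nonneg k]
      exact mul_nonpos_of_nonpos_of_nonneg
        (mul_nonpos_of_nonpos_of_nonneg h3 h1.le) h2
    have h := hanti (Set.left_mem_Icc.2 hb.le) (Set.right_mem_Icc.2 hb.le) hb.le
    have hkb : k * b = Real.pi / 2 := by rw [hk]; field_simp
    simp only [hkb, Real.cos_pi_div_two, Real.sin_pi_div_two, hy0, mul_zero, Real.sin_zero] at h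
    have := hpos b (Set.right_mem_Icc.2 hb.le)
    nlinarith
  obtain ⟨μ₀, ⟨⟨⟨q, t₀⟩, ⟨⟨⟨hq0, hqB⟩, ht₀⟩, hqt⟩, rfl⟩, hleast⟩⟩ :=
    (hCc.image continuous_fst).exists_isLeast (hCne.image _)
  simp only at hq0 hqB ht₀ hqt hleast
  have hlt : ∀ p, 0 ≤ p → p < q → ∀ t ∈ Set.Icc 0 b, 0 < (y p t).1 := by
    intro p hp0 hpq t ht
    by_contra hle
    have := hleast ⟨(p, t), ⟨⟨⟨hp0, (hpq.trans_le hqB).le⟩, ht⟩, not_lt.1 hle⟩, rfl⟩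
    exact absurd this (not_le.2 hpq)
  have hzero_mono : MonotoneOn (fun t => (y 0 t).2) (Set.Icc 0 b) ∧
      ∀ t ∈ Set.Icc 0 b, 1 ≤ (y 0 t).1 := by
    have hpr00 : pr 0 = 0 := hpr_id 0 le_rfl hBpos.le
    -- `φ φ'` is non-decreasing at `μ = 0`
    have hm : ∀ t, 0 ≤ t → 0 ≤ (y 0 t).1 * (y 0 t).2 := by
      have hder : ∀ t, HasDerivAt (fun t => (y 0 t).1 * (y 0 t).2)
          ((y 0 t).2 * (y 0 t).2 + (y 0 t).1 * (2 * (V t - pr 0) * (y 0 t).1)) t := fun t =>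
        (hd1 0 t).mul (hd2 0 t)
      have hmono : Monotone fun t => (y 0 t).1 * (y 0 t).2 :=
        monotone_of_hasDerivAt_nonneg hder fun t => by
          rw [hpr00]; simp only [Pi.zero_apply];
          nlinarith [hV0 t, mul_nonneg (hV0 t) (sq_nonneg (y 0 t).1), sq_nonneg (y 0 t).2]
      intro t ht
      have := hmono ht
      simpa [hy0] using this
    have hsq : ∀ t, 0 ≤ t → 1 ≤ (y 0 t).1 ^ 2 := by
      have hmono : MonotoneOn (fun t => (y 0 t).1 ^ 2) (Set.Ici 0) := by
        refine monotoneOn_of_hasDerivWithinAt_nonneg (f' := fun t => 2 * (y 0 t).1 * (y 0 t).2)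
          (convex_Ici _) (by have := hc1 0; fun_prop) (fun t _ => ?_) ?_
        · have h := ((hd1 0 t).pow 2).hasDerivWithinAt (s := interior (Set.Ici 0))
          convert! h using 1; simp
        · intro t ht
          rw [interior_Ici] at ht
          have := hm t ht.le
          linarith
      intro t ht
      have := hmono (Set.mem_Ici.2 le_rfl) (Set.mem_Ici.2 ht) ht
      simpa [hy0] using this
    have hpos : ∀ t ∈ Set.Icc 0 b, 1 ≤ (y 0 t).1 := by
      intro t ht
      by_contra hlt1
      have hlt0 : (y 0 t).1 ≤ 0 := by nlinarith [hsq t ht.1]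
      have hiv := intermediate_value_Icc' ht.1 (hc1 0).continuousOn
      obtain ⟨s, hs, hs0⟩ := hiv ⟨hlt0, by simp [hy0]⟩
      have := hsq s hs.1
      simp only at hs0
      rw [hs0] at this
      norm_num at this
    refine ⟨?_, hpos⟩
    refine monotoneOn_of_hasDerivWithinAt_nonneg (convex_Icc _ _)
      (fun t _ => (hd2 0 t).continuousAt.continuousWithinAt)
      (fun t _ => (hd2 0 t).hasDerivWithinAt) fun t ht => ?_
    have := hpos t (interior_subset ht)
    rw [hpr00]
    have := hV0 t
    simp only [sub_zero]
    positivity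
  have hq : 0 < q := by
    rcases hq0.lt_or_eq with h | h
    · exact h
    · have := hzero_mono.2 t₀ ht₀
      rw [h] at this
      have h2 : (y q t₀).1 ≤ 0 := hqt
      linarith
  have hge : ∀ t ∈ Set.Icc 0 b, 0 ≤ (y q t).1 := by
    intro t ht
    have hcp : Continuous fun p => (y p t).1 := by
      have e : Continuous fun p : ℝ => (p, t) := by fun_prop
      exact continuous_fst.comp (hyc.comp e)
    refine ge_of_tendsto (x := 𝓝[<] q) (hcp.continuousAt.continuousWithinAt (x := q)).tendsto ?_
    filter_upwards [Ioo_mem_nhdsLT hq] with p hp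
    exact (hlt p hp.1.le hp.2 t ht).le
  have ht₀0 : (y q t₀).1 = 0 := le_antisymm hqt (hge t₀ ht₀)
  have ht₀pos : 0 < t₀ := by
    rcases ht₀.1.lt_or_eq with h | h
    · exact h
    · rw [← h, hy0] at ht₀0; norm_num at ht₀0
  -- an interior zero would be a double zero
  have ht₀b : t₀ = b := by
    by_contra hneb
    have hlt' : t₀ < b := lt_of_le_of_ne ht₀.2 hneb
    have hmin : IsLocalMin (fun t => (y q t).1) t₀ := by
      filter_upwards [Ioo_mem_nhds ht₀pos hlt'] with t ht
      rw [ht₀0]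
      exact hge t ⟨ht.1.le, ht.2.le⟩
    exact hne q t₀ ⟨ht₀0, hmin.hasDerivAt_eq_zero (hd1 q t₀)⟩
  subst ht₀b
  have hslope : (y q t₀).2 ≤ 0 := by
    have hw : HasDerivWithinAt (fun t => (y q t).1) (y q t₀).2 (Set.Iio t₀) t₀ :=
      (hd1 q t₀).hasDerivWithinAt
    rw [hasDerivWithinAt_iff_tendsto_slope' (by simp)] at hw
    refine le_of_tendsto hw ?_
    filter_upwards [Ioo_mem_nhdsLT ht₀pos] with t ht
    rw [slope_def_field, ht₀0, sub_zero]
    exact div_nonpos_of_nonneg_of_nonpos (hge t ⟨ht.1.le, ht.2.le⟩) (by linarith [ht.2])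
  have hslope0 : 0 ≤ (y 0 t₀).2 := by
    have := hzero_mono.1 (Set.left_mem_Icc.2 hb.le) (Set.right_mem_Icc.2 hb.le) hb.le
    simpa [hy0] using this
  have hcp2 : Continuous fun p => (y p t₀).2 := by
    have e : Continuous fun p : ℝ => (p, t₀) := by fun_prop
    exact continuous_snd.comp (hyc.comp e)
  obtain ⟨μ, hμ, hμ0⟩ := intermediate_value_Icc' hq0 hcp2.continuousOn ⟨hslope, hslope0⟩
  simp only at hμ0
  have hμq : μ < q := by
    refine lt_of_le_of_ne hμ.2 fun h => ?_
    rw [h] at hμ0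
    exact hne q t₀ ⟨ht₀0, hμ0⟩
  refine ⟨μ, fun t => (y μ t).1, fun t => (y μ t).2, hd1 μ, fun t => ?_, ?_, hμ0,
    hlt μ hμ.1 hμq⟩
  · have := hd2 μ t
    rwa [hpr_id μ hμ.1 (hμ.2.trans hqB)] at this
  · simp [hy0]

/-- A continuous, even, non-negative and periodic potential has a positive periodic solution of
Hill's equation: reflecting the Neumann solution on half a period at both ends reproduces it. -/
theorem exists_periodic_positive_solution {V : ℝ → ℝ} (hV : Continuous V) {MV T : ℝ} (hT : 0 < T)
    (hV0 : ∀ z, 0 ≤ V z) (hVM : ∀ z, V z ≤ MV) (heven : ∀ z, V (-z) = V z)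
    (hper : ∀ z, V (z + T) = V z) :
    ∃ μ : ℝ, ∃ f f' : ℝ → ℝ, (∀ t, HasDerivAt f (f' t) t) ∧
      (∀ t, HasDerivAt f' (2 * (V t - μ) * f t) t) ∧ (∀ z, f (z + T) = f z) ∧ ∀ z, 0 < f z := by
  obtain ⟨μ, f, f', h1, h2, h0, hb, hpos⟩ :=
    exists_neumann_solution hV hV0 hVM (b := T / 2) (by positivity)
  have hc : ∀ t, |2 * (V t - μ)| ≤ 2 * (MV + |μ|) := by
    intro t
    have hMV : 0 ≤ MV := (hV0 0).trans (hVM 0)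
    rw [abs_le]
    constructor <;> nlinarith [hV0 t, hVM t, neg_abs_le μ, le_abs_self μ]
  have hrefl : ∀ a : ℝ, (∀ z, V (a - z) = V z) → f' (a / 2) = 0 → ∀ z, f (a - z) = f z := by
    intro a hVa ha z
    have hs : ∀ t, HasDerivAt (fun t => a - t) (-1) t := fun t => by
      simpa using (hasDerivAt_id t).const_sub a
    have hg : ∀ t, HasDerivAt (fun t => f (a - t)) (-f' (a - t)) t := fun t => by
      simpa using! (h1 (a - t)).comp t (hs t)
    have hg' : ∀ t, HasDerivAt (fun t => -f' (a - t)) (2 * (V t - μ) * f (a - t)) t := fun t => by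
      have := ((h2 (a - t)).comp t (hs t)).neg
      rw [hVa] at this
      simpa using! this
    have h := hill_unique hc hg hg' h1 h2 (t₀ := a / 2) (by ring_nf)
      (by rw [show a - a / 2 = a / 2 by ring, ha, neg_zero])
    exact congrFun h z
  have he : ∀ z, f (-z) = f z := by
    have := hrefl 0 (fun z => by rw [zero_sub, heven]) (by simpa using h0)
    simpa using this
  have hr : ∀ z, f (T - z) = f z := hrefl T
    (fun z => by rw [sub_eq_neg_add, hper, heven]) hb
  have hp : ∀ z, f (z + T) = f z := fun z => by
    rw [← he z, ← hr (-z), sub_neg_eq_add, add_comm]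
  refine ⟨μ, f, f', h1, h2, hp, fun z => ?_⟩
  obtain ⟨x, hx, hxz⟩ := (show Function.Periodic f T from hp).exists_mem_Ico₀ hT z
  rw [hxz]
  rcases le_total x (T / 2) with h | h
  · exact hpos x ⟨hx.1, h⟩
  · rw [← hr x]
    exact hpos _ ⟨by linarith [hx.2], by linarith⟩

/-! ### The ground state of the longitudinal problem -/

/-- A continuous, non-negative, periodic function with zero mean over a period vanishes. -/
theorem eq_zero_of_periodic_integral_eq_zero {T : ℝ} (hT : 0 < T) {g : ℝ → ℝ} (hg : Continuous g)
    (hper : ∀ z, g (z + T) = g z) (h0 : ∀ z, 0 ≤ g z)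
    (hint : ∫ z in (-(T / 2))..(T / 2), g z = 0) (z : ℝ) : g z = 0 := by
  by_contra hne
  have hpos : 0 < g z := lt_of_le_of_ne (h0 z) (Ne.symm hne)
  have h1 := (show Function.Periodic g T from hper).intervalIntegral_add_eq (-(T / 2)) z
  rw [show -(T / 2) + T = T / 2 by ring, hint] at h1
  have h2 : 0 < ∫ x in z..(z + T), g x :=
    intervalIntegral.integral_pos (by linarith) hg.continuousOn (fun x _ => h0 x)
      ⟨z, ⟨le_rfl, by linarith⟩, hpos⟩
  linarith

theorem integral_deriv_eq_zero_of_periodic {T : ℝ} {F F' : ℝ → ℝ}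
    (hF : ∀ z, HasDerivAt F (F' z) z) (hF' : Continuous F') (hper : ∀ z, F (z + T) = F z) :
    ∫ z in (-(T / 2))..(T / 2), F' z = 0 := by
  rw [intervalIntegral.integral_eq_sub_of_hasDerivAt (fun z _ => hF z)
    (hF'.intervalIntegrable _ _), ← hper (-(T / 2))]
  ring_nf

/-- `f` is a smooth, positive, `T`-periodic solution of `-f''/2 + W_ε f = μ f`. -/
structure IsPositiveSolution (T : ℝ) (w : ℝ → ℝ) (ε μ : ℝ) (f : ℝ → ℝ) : Prop where
  contDiff : ContDiff ℝ ∞ f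
  periodic : ∀ z, f (z + T) = f z
  pos : ∀ z, 0 < f z
  equation : ∀ z, deriv (deriv f) z = 2 * (latticePotential w ε z - μ) * f z

section

variable {T : ℝ} {w : ℝ → ℝ} {ε : ℝ}

theorem IsLatticeProfile.contDiff_potential (hw : IsLatticeProfile T w) (ε : ℝ) :
    ContDiff ℝ ∞ (latticePotential w ε) := hw.smooth.div_const _

theorem IsLatticeProfile.potential_nonneg (hw : IsLatticeProfile T w) (ε z : ℝ) :
    0 ≤ latticePotential w ε z := div_nonneg (hw.nonneg z) (sq_nonneg _)

theorem IsLatticeProfile.potential_periodic (hw : IsLatticeProfile T w) (ε z : ℝ) :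
    latticePotential w ε (z + T) = latticePotential w ε z := by
  simp [latticePotential, hw.periodic]

theorem exists_abs_le_of_periodic {T : ℝ} (hT : 0 < T) {g : ℝ → ℝ} (hg : Continuous g)
    (hper : ∀ z, g (z + T) = g z) : ∃ M, 0 < M ∧ ∀ z, |g z| ≤ M := by
  obtain ⟨M, hM⟩ := isCompact_Icc.exists_bound_of_continuousOn (s := Set.Icc 0 T) hg.continuousOn
  refine ⟨|M| + 1, by positivity, fun z => ?_⟩
  obtain ⟨x, hx, hxz⟩ := (show Function.Periodic g T from hper).exists_mem_Ico₀ hT z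
  rw [hxz]
  exact (hM x ⟨hx.1, hx.2.le⟩).trans ((le_abs_self M).trans (by linarith))

/-- Bootstrap of regularity for `f'' = c f` with smooth `c`. -/
theorem contDiff_of_linear_second_order {c f f' : ℝ → ℝ} (hc : ContDiff ℝ ∞ c)
    (h1 : ∀ t, HasDerivAt f (f' t) t) (h2 : ∀ t, HasDerivAt f' (c t * f t) t) :
    ContDiff ℝ ∞ f := by
  have hd1 : deriv f = f' := funext fun t => (h1 t).deriv
  have hd2 : deriv f' = fun t => c t * f t := funext fun t => (h2 t).deriv
  have key : ∀ n : ℕ, ContDiff ℝ n f ∧ ContDiff ℝ n f' := by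
    intro n
    induction n with
    | zero =>
      constructor
      · exact contDiff_zero.2 (continuous_iff_continuousAt.2 fun t => (h1 t).continuousAt)
      · exact contDiff_zero.2 (continuous_iff_continuousAt.2 fun t => (h2 t).continuousAt)
    | succ n ih =>
      have hcn : ContDiff ℝ n c := hc.of_le (by exact_mod_cast le_top)
      constructor
      · push_cast
        refine contDiff_succ_iff_deriv.2 ⟨fun t => (h1 t).differentiableAt, by simp, ?_⟩
        rw [hd1]; exact ih.2
      · push_cast
        refine contDiff_succ_iff_deriv.2 ⟨fun t => (h2 t).differentiableAt, by simp, ?_⟩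
        rw [hd2]; exact hcn.mul ih.1
  exact contDiff_infty.2 fun n => (key n).1

theorem exists_isPositiveSolution (hw : IsLatticeProfile T w) (ε : ℝ) :
    ∃ μ f, IsPositiveSolution T w ε μ f := by
  obtain ⟨M, -, hM⟩ := exists_abs_le_of_periodic hw.period_pos (hw.contDiff_potential ε).continuous
    (hw.potential_periodic ε)
  obtain ⟨μ, f, f', h1, h2, hp, hpos⟩ := exists_periodic_positive_solution
    (hw.contDiff_potential ε).continuous hw.period_pos (hw.potential_nonneg ε)
    (fun z => (le_abs_self _).trans (hM z)) (fun z => by simp [latticePotential, hw.even])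
    (hw.potential_periodic ε)
  refine ⟨μ, f, ?_, hp, hpos, fun z => ?_⟩
  · exact contDiff_of_linear_second_order (c := fun t => 2 * (latticePotential w ε t - μ))
      (contDiff_const.mul ((hw.contDiff_potential ε).sub contDiff_const)) h1 h2
  · rw [show deriv f = f' from funext fun t => (h1 t).deriv]
    exact (h2 z).deriv

namespace IsPositiveSolution

variable {μ : ℝ} {f : ℝ → ℝ}

theorem hasDerivAt (hf : IsPositiveSolution T w ε μ f) (z : ℝ) : HasDerivAt f (deriv f z) z :=
  (hf.contDiff.differentiable (by simp) z).hasDerivAt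

theorem contDiff_deriv (hf : IsPositiveSolution T w ε μ f) : ContDiff ℝ ∞ (deriv f) :=
  (contDiff_infty_iff_deriv.1 hf.contDiff).2

theorem hasDerivAt_deriv (hf : IsPositiveSolution T w ε μ f) (z : ℝ) :
    HasDerivAt (deriv f) (2 * (latticePotential w ε z - μ) * f z) z := by
  rw [← hf.equation z]
  exact (hf.contDiff_deriv.differentiable (by simp) z).hasDerivAt

theorem periodic_deriv (hf : IsPositiveSolution T w ε μ f) (z : ℝ) :
    deriv f (z + T) = deriv f z := by
  rw [← deriv_comp_add_const]
  congr 1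
  exact funext hf.periodic

theorem smul (hf : IsPositiveSolution T w ε μ f) {c : ℝ} (hc : 0 < c) :
    IsPositiveSolution T w ε μ (fun z => c * f z) where
  contDiff := contDiff_const.mul hf.contDiff
  periodic z := by simp [hf.periodic]
  pos z := mul_pos hc (hf.pos z)
  equation z := by
    have h1 : deriv (fun z => c * f z) = fun z => c * deriv f z :=
      funext fun z => ((hf.hasDerivAt z).const_mul c).deriv
    rw [h1, ((hf.hasDerivAt_deriv z).const_mul c).deriv]
    ring

/-- The logarithmic derivative of a positive solution satisfies the Riccati equation. -/
theorem hasDerivAt_logDeriv (hf : IsPositiveSolution T w ε μ f) (z : ℝ) :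
    HasDerivAt (logDeriv f) (2 * (latticePotential w ε z - μ) - logDeriv f z ^ 2) z := by
  have h := (hf.hasDerivAt_deriv z).div (hf.hasDerivAt z) (hf.pos z).ne'
  have hne := (hf.pos z).ne'
  convert! h using 1
  simp only [logDeriv_apply]
  field_simp

theorem contDiff_logDeriv (hf : IsPositiveSolution T w ε μ f) : ContDiff ℝ ∞ (logDeriv f) :=
  hf.contDiff_deriv.div hf.contDiff fun z => (hf.pos z).ne'

theorem logDeriv_periodic (hf : IsPositiveSolution T w ε μ f) (z : ℝ) :
    logDeriv f (z + T) = logDeriv f z := by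
  simp [logDeriv_apply, hf.periodic, hf.periodic_deriv]

/-- Jacobi's identity: relative to a positive solution `f`, the quadratic form of `H_z - μ` is half
the square of the `L²` norm of `ψ' - (f'/f) ψ`. -/
theorem jacobi_identity (hw : IsLatticeProfile T w) (hf : IsPositiveSolution T w ε μ f)
    {ψ ψ' : ℝ → ℂ} (hψ : ∀ z, HasDerivAt ψ (ψ' z) z) (hψ' : Continuous ψ')
    (hper : ∀ z, ψ (z + T) = ψ z) :
    ∫ z in (-(T / 2))..(T / 2), (1 / 2 * ‖ψ' z‖ ^ 2 + (latticePotential w ε z - μ) * ‖ψ z‖ ^ 2)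
      = ∫ z in (-(T / 2))..(T / 2), 1 / 2 * ‖ψ' z - logDeriv f z • ψ z‖ ^ 2 := by
  have hψc : Continuous ψ := continuous_iff_continuousAt.2 fun z => (hψ z).continuousAt
  have hac : Continuous (logDeriv f) := hf.contDiff_logDeriv.continuous
  have hWc : Continuous (latticePotential w ε) := (hw.contDiff_potential ε).continuous
  have hexp : ∀ z, 1 / 2 * ‖ψ' z - logDeriv f z • ψ z‖ ^ 2 =
      1 / 2 * ‖ψ' z‖ ^ 2 - logDeriv f z * inner ℝ (ψ z) (ψ' z)
        + 1 / 2 * logDeriv f z ^ 2 * ‖ψ z‖ ^ 2 := by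
    intro z
    rw [norm_sub_sq_real, inner_smul_right, real_inner_comm, norm_smul, mul_pow,
      Real.norm_eq_abs, sq_abs]
    ring
  rw [← sub_eq_zero, ← intervalIntegral.integral_sub]
  · have hF : ∀ z, HasDerivAt (fun z => 1 / 2 * (logDeriv f z * ‖ψ z‖ ^ 2))
        ((1 / 2 * ‖ψ' z‖ ^ 2 + (latticePotential w ε z - μ) * ‖ψ z‖ ^ 2)
          - 1 / 2 * ‖ψ' z - logDeriv f z • ψ z‖ ^ 2) z := by
      intro z
      have h := ((hf.hasDerivAt_logDeriv z).mul (hψ z).norm_sq).const_mul (1 / 2)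
      convert! h using 1
      rw [hexp]
      ring
    refine integral_deriv_eq_zero_of_periodic hF (by fun_prop) fun z => ?_
    rw [hf.logDeriv_periodic, hper]
  · exact (by fun_prop : Continuous _).intervalIntegrable _ _
  · exact (by fun_prop : Continuous _).intervalIntegrable _ _

end IsPositiveSolution

theorem IsPeriodicEigenfunction.hasDerivAt {ν : ℝ} {ψ : ℝ → ℂ}
    (h : IsPeriodicEigenfunction T w ε ν ψ) (z : ℝ) : HasDerivAt ψ (deriv ψ z) z :=
  (h.contDiff.differentiable (by simp) z).hasDerivAt

theorem IsPeriodicEigenfunction.hasDerivAt_deriv {ν : ℝ} {ψ : ℝ → ℂ}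
    (h : IsPeriodicEigenfunction T w ε ν ψ) (z : ℝ) :
    HasDerivAt (deriv ψ) ((2 * (latticePotential w ε z - ν)) • ψ z) z := by
  have h1 : ContDiff ℝ 1 (deriv ψ) :=
    (contDiff_succ_iff_deriv (n := 1).1 (by simpa [one_add_one_eq_two] using h.contDiff)).2.2
  have h2 : deriv (deriv ψ) z = (2 * (latticePotential w ε z - ν)) • ψ z := by
    have e := h.equation z
    rw [show iteratedDeriv 2 ψ = deriv (deriv ψ) by
      rw [iteratedDeriv_succ, iteratedDeriv_one]] at e
    rw [Complex.real_smul]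
    push_cast
    linear_combination (-2) * e
  rw [← h2]
  exact (h1.differentiable (by simp) z).hasDerivAt

theorem IsPeriodicEigenfunction.continuous {ν : ℝ} {ψ : ℝ → ℂ}
    (h : IsPeriodicEigenfunction T w ε ν ψ) : Continuous ψ := h.contDiff.continuous

theorem IsPeriodicEigenfunction.continuous_deriv {ν : ℝ} {ψ : ℝ → ℂ}
    (h : IsPeriodicEigenfunction T w ε ν ψ) : Continuous (deriv ψ) :=
  continuous_iff_continuousAt.2 fun z => (h.hasDerivAt_deriv z).continuousAt

theorem IsPeriodicEigenfunction.integral_norm_sq_pos (hT : 0 < T) {ν : ℝ} {ψ : ℝ → ℂ}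
    (h : IsPeriodicEigenfunction T w ε ν ψ) : 0 < ∫ z in (-(T / 2))..(T / 2), ‖ψ z‖ ^ 2 := by
  have hc := h.continuous
  refine lt_of_le_of_ne (intervalIntegral.integral_nonneg (by linarith) fun z _ => by positivity)
    fun h0 => ?_
  obtain ⟨z, hz⟩ := h.ne_zero
  have := eq_zero_of_periodic_integral_eq_zero hT (g := fun z => ‖ψ z‖ ^ 2) (by fun_prop)
    (fun z => by simp [h.periodic]) (fun z => by positivity) h0.symm z
  simp [hz] at this

/-- Jacobi's identity for an eigenfunction `ψ` with eigenvalue `ν`: the quadratic form of `H_z - μ`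
is `(ν - μ) ∫ |ψ|²`. Hence `μ` is the lowest eigenvalue, and an eigenfunction for `μ` solves the
first order equation `ψ' = (f'/f) ψ`. -/
theorem IsPeriodicEigenfunction.jacobi (hw : IsLatticeProfile T w) {μ ν : ℝ} {f : ℝ → ℝ}
    {ψ : ℝ → ℂ} (hf : IsPositiveSolution T w ε μ f) (h : IsPeriodicEigenfunction T w ε ν ψ) :
    (ν - μ) * ∫ z in (-(T / 2))..(T / 2), ‖ψ z‖ ^ 2
      = ∫ z in (-(T / 2))..(T / 2), 1 / 2 * ‖deriv ψ z - logDeriv f z • ψ z‖ ^ 2 := by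
  have hψc := h.continuous
  have hψc' := h.continuous_deriv
  have hWc : Continuous (latticePotential w ε) := (hw.contDiff_potential ε).continuous
  rw [← hf.jacobi_identity hw h.hasDerivAt h.continuous_deriv h.periodic,
    ← intervalIntegral.integral_const_mul, ← sub_eq_zero, ← intervalIntegral.integral_sub]
  · have hF : ∀ z, HasDerivAt (fun z => -(1 / 2) * inner ℝ (ψ z) (deriv ψ z))
        ((ν - μ) * ‖ψ z‖ ^ 2
          - (1 / 2 * ‖deriv ψ z‖ ^ 2 + (latticePotential w ε z - μ) * ‖ψ z‖ ^ 2)) z := by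
      intro z
      have h1 := ((h.hasDerivAt z).inner ℝ (h.hasDerivAt_deriv z)).const_mul (-(1 / 2))
      convert! h1 using 1
      rw [inner_smul_right, real_inner_self_eq_norm_sq, real_inner_self_eq_norm_sq]
      ring
    refine integral_deriv_eq_zero_of_periodic hF (by fun_prop) fun z => ?_
    have hp : deriv ψ (z + T) = deriv ψ z := by
      rw [← deriv_comp_add_const]
      congr 1
      exact funext h.periodic
    rw [h.periodic, hp]
  · exact (by fun_prop : Continuous _).intervalIntegrable _ _
  · exact (by fun_prop : Continuous _).intervalIntegrable _ _

theorem IsPositiveSolution.isPeriodicEigenfunction {μ : ℝ} {f : ℝ → ℝ}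
    (hf : IsPositiveSolution T w ε μ f) :
    IsPeriodicEigenfunction T w ε μ (fun z => (f z : ℂ)) where
  contDiff := by
    have : ContDiff ℝ ∞ (fun z => (f z : ℂ)) := Complex.ofRealCLM.contDiff.comp hf.contDiff
    exact_mod_cast contDiff_infty.1 this 2
  periodic z := by rw [hf.periodic]
  ne_zero := ⟨0, by simpa using (hf.pos 0).ne'⟩
  equation z := by
    have h1 : deriv (fun z => (f z : ℂ)) = fun z => ((deriv f z : ℝ) : ℂ) :=
      funext fun z => (hf.hasDerivAt z).ofReal_comp.deriv
    rw [iteratedDeriv_succ, iteratedDeriv_one, h1, (hf.hasDerivAt_deriv z).ofReal_comp.deriv]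
    push_cast
    ring

theorem IsPositiveSolution.isLeast (hw : IsLatticeProfile T w) {μ : ℝ} {f : ℝ → ℝ}
    (hf : IsPositiveSolution T w ε μ f) : IsLeast (periodicEigenvalues T w ε) μ := by
  refine ⟨⟨_, hf.isPeriodicEigenfunction⟩, ?_⟩
  rintro ν ⟨ψ, hψ⟩
  have h1 := hψ.jacobi hw hf
  have h2 := hψ.integral_norm_sq_pos hw.period_pos
  have h3 : 0 ≤ ∫ z in (-(T / 2))..(T / 2), 1 / 2 * ‖deriv ψ z - logDeriv f z • ψ z‖ ^ 2 :=
    intervalIntegral.integral_nonneg (by linarith [hw.period_pos]) fun z _ => by positivity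
  rw [← h1] at h3
  have := nonneg_of_mul_nonneg_left h3 h2
  linarith

/-- The ground state is unique up to a phase: its modulus is the normalized positive solution. -/
theorem IsGroundState.norm_eq (hw : IsLatticeProfile T w) {f : ℝ → ℝ}
    (hf : IsPositiveSolution T w ε (lambdaOne T w ε) f)
    (hnorm : ∫ z in (-(T / 2))..(T / 2), f z ^ 2 = 1) {φ : ℝ → ℂ} (hφ : IsGroundState T w ε φ)
    (z : ℝ) : ‖φ z‖ = f z := by
  have h1 := hφ.eigen.jacobi hw hf
  rw [sub_self, zero_mul] at h1
  have hc := hφ.eigen.continuous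
  have hc' := hφ.eigen.continuous_deriv
  have hac : Continuous (logDeriv f) := hf.contDiff_logDeriv.continuous
  have hp : ∀ z, deriv φ (z + T) = deriv φ z := fun z => by
    rw [← deriv_comp_add_const]
    congr 1
    exact funext hφ.eigen.periodic
  have h2 : ∀ z, deriv φ z = logDeriv f z • φ z := by
    intro z
    have := eq_zero_of_periodic_integral_eq_zero hw.period_pos
      (g := fun z => 1 / 2 * ‖deriv φ z - logDeriv f z • φ z‖ ^ 2) (by fun_prop)
      (fun z => by simp only [hp, hf.logDeriv_periodic, hφ.eigen.periodic])
      (fun z => by positivity) h1.symm z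
    simpa [sub_eq_zero] using this
  have h3 : ∀ z, HasDerivAt (fun z => (f z)⁻¹ • φ z) 0 z := by
    intro z
    have h := ((hf.hasDerivAt z).inv (hf.pos z).ne').smul (hφ.eigen.hasDerivAt z)
    convert! h using 1
    have hne := (hf.pos z).ne'
    rw [h2 z, logDeriv_apply, smul_smul, ← add_smul]
    have : (f z)⁻¹ * (deriv f z / f z) + -deriv f z / f z ^ 2 = 0 := by field_simp; ring
    simp [this]
  have h4 : ∀ z, φ z = f z • ((f 0)⁻¹ • φ 0) := by
    intro z
    have h := is_const_of_deriv_eq_zero (fun z => (h3 z).differentiableAt)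
      (fun z => (h3 z).deriv) z 0
    rw [← h, smul_smul, mul_inv_cancel₀ (hf.pos z).ne', one_smul]
  set c := (f 0)⁻¹ • φ 0 with hcdef
  have h5 : ∀ z, ‖φ z‖ ^ 2 = ‖c‖ ^ 2 * f z ^ 2 := by
    intro z
    rw [h4 z, norm_smul, Real.norm_eq_abs, mul_pow, sq_abs, mul_comm]
  have h6 := hφ.normalized
  simp_rw [h5] at h6
  rw [intervalIntegral.integral_const_mul, hnorm, mul_one] at h6
  have h7 := h5 z
  rw [h6, one_mul] at h7
  exact (sq_eq_sq₀ (norm_nonneg _) (hf.pos z).le).1 h7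

theorem exists_positive_groundState (hw : IsLatticeProfile T w) (ε : ℝ) :
    IsLeast (periodicEigenvalues T w ε) (lambdaOne T w ε) ∧
      ∃ f, IsPositiveSolution T w ε (lambdaOne T w ε) f ∧
        ∫ z in (-(T / 2))..(T / 2), f z ^ 2 = 1 := by
  obtain ⟨μ, f, hf⟩ := exists_isPositiveSolution hw ε
  have hl := hf.isLeast hw
  have hμ : lambdaOne T w ε = μ := hl.csInf_eq
  rw [hμ]
  refine ⟨hl, ?_⟩
  set I := ∫ z in (-(T / 2))..(T / 2), f z ^ 2 with hI
  have hfc := hf.contDiff.continuous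
  have hIpos : 0 < I := by
    have h := hf.isPeriodicEigenfunction.integral_norm_sq_pos hw.period_pos
    simpa using h
  refine ⟨fun z => (√I)⁻¹ * f z, hf.smul (by positivity), ?_⟩
  simp_rw [mul_pow]
  rw [intervalIntegral.integral_const_mul, ← hI, inv_pow, Real.sq_sqrt hIpos.le,
    inv_mul_cancel₀ hIpos.ne']

theorem IsPositiveSolution.isGroundState {f : ℝ → ℝ}
    (hf : IsPositiveSolution T w ε (lambdaOne T w ε) f)
    (hnorm : ∫ z in (-(T / 2))..(T / 2), f z ^ 2 = 1) :
    IsGroundState T w ε (fun z => (f z : ℂ)) :=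
  ⟨hf.isPeriodicEigenfunction, by simpa using hnorm⟩

end

/-! ### Comparison of the lattice profile with trigonometric functions -/

/-- The periodic model `1 - cos (2πz/T)` of the quadratic function `(2π/T)² z²/2`. -/
noncomputable def hmod (T z : ℝ) : ℝ := 1 - Real.cos (2 * Real.pi / T * z)

/-- The periodic model `(T/2π) sin (2πz/T)` of the identity. -/
noncomputable def smod (T z : ℝ) : ℝ := T / (2 * Real.pi) * Real.sin (2 * Real.pi / T * z)

/-- The frequency `√(w''(0))` of the harmonic approximation at the bottom of a well. -/
noncomputable def kappa (w : ℝ → ℝ) : ℝ := √(iteratedDeriv 2 w 0)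

section

variable {T : ℝ}

@[fun_prop] theorem contDiff_hmod (T : ℝ) : ContDiff ℝ ∞ (hmod T) := by
  unfold hmod; fun_prop

@[fun_prop] theorem contDiff_smod (T : ℝ) : ContDiff ℝ ∞ (smod T) := by
  unfold smod; fun_prop

@[fun_prop] theorem continuous_hmod (T : ℝ) : Continuous (hmod T) := (contDiff_hmod T).continuous

@[fun_prop] theorem continuous_smod (T : ℝ) : Continuous (smod T) := (contDiff_smod T).continuous

theorem hmod_nonneg (T z : ℝ) : 0 ≤ hmod T z := by
  unfold hmod; linarith [Real.cos_le_one (2 * Real.pi / T * z)]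

theorem hmod_le_two (T z : ℝ) : hmod T z ≤ 2 := by
  unfold hmod; linarith [Real.neg_one_le_cos (2 * Real.pi / T * z)]

theorem hmod_zero (T : ℝ) : hmod T 0 = 0 := by simp [hmod]

theorem smod_zero (T : ℝ) : smod T 0 = 0 := by simp [smod]

theorem hmod_periodic (hT : 0 < T) (z : ℝ) : hmod T (z + T) = hmod T z := by
  unfold hmod
  rw [show 2 * Real.pi / T * (z + T) = 2 * Real.pi / T * z + 2 * Real.pi by field_simp,
    Real.cos_add_two_pi]

theorem smod_periodic (hT : 0 < T) (z : ℝ) : smod T (z + T) = smod T z := by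
  unfold smod
  rw [show 2 * Real.pi / T * (z + T) = 2 * Real.pi / T * z + 2 * Real.pi by field_simp,
    Real.sin_add_two_pi]

theorem hasDerivAt_hmod (hT : 0 < T) (z : ℝ) :
    HasDerivAt (hmod T) ((2 * Real.pi / T) ^ 2 * smod T z) z := by
  have hl : HasDerivAt (fun z => 2 * Real.pi / T * z) (2 * Real.pi / T) z := by
    simpa using (hasDerivAt_id z).const_mul (2 * Real.pi / T)
  have h := hl.cos.const_sub 1
  convert! h using 1
  unfold smod
  have := Real.pi_pos
  field_simp

theorem hasDerivAt_smod (hT : 0 < T) (z : ℝ) : HasDerivAt (smod T) (1 - hmod T z) z := by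
  have hl : HasDerivAt (fun z => 2 * Real.pi / T * z) (2 * Real.pi / T) z := by
    simpa using (hasDerivAt_id z).const_mul (2 * Real.pi / T)
  have h := hl.sin.const_mul (T / (2 * Real.pi))
  convert! h using 1
  unfold hmod
  have := Real.pi_pos
  field_simp
  ring

theorem smod_sq (T z : ℝ) :
    smod T z ^ 2 = (T / (2 * Real.pi)) ^ 2 * (hmod T z * (2 - hmod T z)) := by
  unfold smod hmod
  rw [mul_pow, Real.sin_sq]
  ring

theorem le_hmod (hT : 0 < T) {z : ℝ} (hz : |z| ≤ T / 2) : 8 / T ^ 2 * z ^ 2 ≤ hmod T z := by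
  have h := Real.cos_le_one_sub_mul_cos_sq (x := 2 * Real.pi / T * z) (by
    rw [abs_mul, abs_of_pos (by positivity)]
    calc 2 * Real.pi / T * |z| ≤ 2 * Real.pi / T * (T / 2) := by gcongr
      _ = Real.pi := by field_simp)
  unfold hmod
  have e : 2 / Real.pi ^ 2 * (2 * Real.pi / T * z) ^ 2 = 8 / T ^ 2 * z ^ 2 := by
    have := Real.pi_pos
    field_simp; ring
  rw [e] at h
  linarith

theorem hmod_le (T z : ℝ) : hmod T z ≤ (2 * Real.pi / T) ^ 2 / 2 * z ^ 2 := by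
  have h := Real.one_sub_sq_div_two_le_cos (x := 2 * Real.pi / T * z)
  unfold hmod
  rw [mul_pow] at h
  linarith

/-- An even function vanishing to second order at `0` vanishes there to fourth order. -/
theorem exists_abs_le_pow_four {g : ℝ → ℝ} (hg : ContDiff ℝ ∞ g) (heven : ∀ z, g (-z) = g z)
    (h0 : g 0 = 0) (h2 : iteratedDeriv 2 g 0 = 0) {b : ℝ} (hb : 0 < b) :
    ∃ C, 0 ≤ C ∧ ∀ z, |z| ≤ b → |g z| ≤ C * z ^ 4 := by
  have hodd : ∀ n, Odd n → iteratedDeriv n g 0 = 0 := by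
    intro n hn
    have h := iteratedDeriv_comp_neg n g 0
    rw [show (fun x => g (-x)) = g from funext heven, neg_zero, hn.neg_one_pow] at h
    simp only [smul_eq_mul] at h
    linarith
  obtain ⟨C, hC⟩ := exists_taylor_mean_remainder_bound (n := 3) hb.le
    ((contDiff_infty.1 hg 4).contDiffOn (s := Set.Icc 0 b))
  have hw : ∀ n : ℕ, iteratedDerivWithin n g (Set.Icc 0 b) 0 = iteratedDeriv n g 0 := fun n =>
    iteratedDerivWithin_eq_iteratedDeriv (uniqueDiffOn_Icc hb)
      (contDiff_infty.1 hg n).contDiffAt (Set.left_mem_Icc.2 hb.le)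
  have ht : ∀ x, taylorWithinEval g 3 (Set.Icc 0 b) 0 x = 0 := by
    intro x
    simp only [taylorWithinEval_succ, taylor_within_zero_eval, hw]
    simp [h0, h2, hodd 1 (by decide), hodd 3 (by decide)]
  refine ⟨|C|, abs_nonneg _, fun z hz => ?_⟩
  have hz' : g z = g |z| := by
    rcases abs_choice z with h | h <;> rw [h]
    exact (heven z).symm
  have h := hC |z| ⟨abs_nonneg z, hz⟩
  rw [ht, sub_zero, sub_zero, ← hz', Real.norm_eq_abs] at h
  refine h.trans ?_
  have e : |z| ^ (3 + 1) = z ^ 4 := Even.pow_abs (by decide) z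
  rw [e]
  exact mul_le_mul_of_nonneg_right (le_abs_self C) (by positivity)

variable {w : ℝ → ℝ}

theorem IsLatticeProfile.kappa_pos (hw : IsLatticeProfile T w) : 0 < kappa w :=
  Real.sqrt_pos.2 hw.nondegenerate

/-- Every point is congruent modulo `T` to a point of `[-T/2, T/2]`. -/
theorem exists_mem_abs_le_half (hT : 0 < T) (z : ℝ) :
    ∃ x, |x| ≤ T / 2 ∧ ∀ g : ℝ → ℝ, (∀ z, g (z + T) = g z) → g z = g x := by
  obtain ⟨y, hy, n, hn⟩ : ∃ y ∈ Set.Ico (-(T / 2)) (-(T / 2) + T), ∃ n : ℤ, y = z - n * T := by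
    refine ⟨toIcoMod hT (-(T / 2)) z, toIcoMod_mem_Ico hT _ z, toIcoDiv hT (-(T / 2)) z, ?_⟩
    rw [toIcoMod, zsmul_eq_mul]
  refine ⟨y, abs_le.2 ⟨hy.1, by linarith [hy.2]⟩, fun g hg => ?_⟩
  rw [hn]
  exact ((show Function.Periodic g T from hg).sub_int_mul_eq n).symm

/-- The profile agrees with its periodic harmonic approximation `κ² S² / 2` up to fourth order at
the wells, because it is even. -/
theorem IsLatticeProfile.abs_sub_le (hw : IsLatticeProfile T w) :
    ∃ C, 0 < C ∧ ∀ z, |w z - 1 / 2 * kappa w ^ 2 * smod T z ^ 2| ≤ C * hmod T z ^ 2 := by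
  have hT := hw.period_pos
  set g : ℝ → ℝ := fun z => w z - 1 / 2 * kappa w ^ 2 * smod T z ^ 2 with hg
  have hgs : ContDiff ℝ ∞ g := hw.smooth.sub (contDiff_const.mul ((contDiff_smod T).pow 2))
  have heven : ∀ z, g (-z) = g z := by
    intro z
    simp only [hg, hw.even, smod, mul_neg, Real.sin_neg, neg_sq]
  have hg0 : g 0 = 0 := by simp [hg, hw.zero, smod_zero]
  have hwd : ∀ z, HasDerivAt w (deriv w z) z := fun z =>
    (hw.smooth.differentiable (by simp) z).hasDerivAt
  have hwd2 : HasDerivAt (deriv w) (iteratedDeriv 2 w 0) 0 := by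
    rw [iteratedDeriv_succ, iteratedDeriv_one]
    exact ((contDiff_infty_iff_deriv.1 hw.smooth).2.differentiable (by simp) 0).hasDerivAt
  have hg2 : iteratedDeriv 2 g 0 = 0 := by
    rw [iteratedDeriv_succ, iteratedDeriv_one]
    have e1 : deriv g = fun z => deriv w z - kappa w ^ 2 * (smod T z * (1 - hmod T z)) := by
      funext z
      have h := (hwd z).sub (((hasDerivAt_smod hT z).pow 2).const_mul (1 / 2 * kappa w ^ 2))
      rw [show g = w - fun z => 1 / 2 * kappa w ^ 2 * (smod T ^ 2) z from rfl, h.deriv]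
      norm_num
      ring
    rw [e1]
    have h := hwd2.sub (((hasDerivAt_smod hT 0).mul
      ((hasDerivAt_hmod hT 0).const_sub 1)).const_mul (kappa w ^ 2))
    refine h.deriv.trans ?_
    rw [smod_zero, hmod_zero, kappa, Real.sq_sqrt hw.nondegenerate.le]
    ring
  obtain ⟨C, hC0, hC⟩ := exists_abs_le_pow_four hgs heven hg0 hg2 (b := T / 2) (by positivity)
  refine ⟨C * (T ^ 2 / 8) ^ 2 + 1, by positivity, fun z => ?_⟩
  obtain ⟨x, hx, hxz⟩ := exists_mem_abs_le_half hT z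
  have hgp : ∀ z, g (z + T) = g z := fun z => by simp only [hg, hw.periodic, smod_periodic hT]
  have e1 := hxz g hgp
  have e2 := hxz (hmod T) (hmod_periodic hT)
  change |g z| ≤ _
  rw [e1, e2]
  refine (hC x hx).trans ?_
  have h1 := le_hmod hT hx
  have h2 : x ^ 2 ≤ T ^ 2 / 8 * hmod T x := by
    have : x ^ 2 = T ^ 2 / 8 * (8 / T ^ 2 * x ^ 2) := by field_simp
    rw [this]; gcongr
  calc C * x ^ 4 = C * (x ^ 2) ^ 2 := by ring
    _ ≤ C * (T ^ 2 / 8 * hmod T x) ^ 2 := by gcongr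
    _ ≤ (C * (T ^ 2 / 8) ^ 2 + 1) * hmod T x ^ 2 := by nlinarith [sq_nonneg (hmod T x)]

/-- The profile dominates a multiple of `1 - cos (2πz/T)`: near the wells by the harmonic
approximation, elsewhere by compactness. -/
theorem IsLatticeProfile.exists_le (hw : IsLatticeProfile T w) :
    ∃ c, 0 < c ∧ ∀ z, c * hmod T z ≤ w z := by
  have hT := hw.period_pos
  have hκ := hw.kappa_pos
  obtain ⟨C, hC0, hC⟩ := hw.abs_sub_le
  set c₀ : ℝ := 1 / 2 * kappa w ^ 2 * (T / (2 * Real.pi)) ^ 2 with hc₀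
  have hc₀pos : 0 < c₀ := by have := Real.pi_pos; positivity
  set δ : ℝ := min 1 (c₀ / (2 * C)) with hδ
  have hδpos : 0 < δ := by positivity
  -- away from the wells, compactness gives a positive lower bound
  obtain ⟨m, hm, hmw⟩ : ∃ m, 0 < m ∧ ∀ z, |z| ≤ T / 2 → δ ≤ hmod T z → m ≤ w z := by
    have hK : IsCompact (Set.Icc (-(T / 2)) (T / 2) ∩ {z | δ ≤ hmod T z}) :=
      isCompact_Icc.inter_right (isClosed_le continuous_const (continuous_hmod T))
    rcases Set.eq_empty_or_nonempty (Set.Icc (-(T / 2)) (T / 2) ∩ {z | δ ≤ hmod T z}) with h | h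
    · refine ⟨1, one_pos, fun z hz hδz => ?_⟩
      have hmem : z ∈ Set.Icc (-(T / 2)) (T / 2) ∩ {z | δ ≤ hmod T z} := ⟨abs_le.1 hz, hδz⟩
      rw [h] at hmem
      exact absurd hmem (Set.notMem_empty z)
    · obtain ⟨x, hx, hxmin⟩ := hK.exists_isMinOn h hw.smooth.continuous.continuousOn
      refine ⟨w x, hw.pos x fun k hk => ?_, fun z hz hδz => hxmin ⟨abs_le.1 hz, hδz⟩⟩
      have h1 : hmod T x = 0 := by
        have := (show Function.Periodic (hmod T) T from hmod_periodic hT).int_mul_eq k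
        rw [hk, this, hmod_zero]
      have h2 : δ ≤ hmod T x := hx.2
      linarith
  refine ⟨min (c₀ / 2) (m / 2), by positivity, fun z => ?_⟩
  obtain ⟨x, hx, hxz⟩ := exists_mem_abs_le_half hT z
  rw [hxz w hw.periodic, hxz (hmod T) (hmod_periodic hT)]
  have hh0 := hmod_nonneg T x
  rcases le_total δ (hmod T x) with h | h
  · calc min (c₀ / 2) (m / 2) * hmod T x ≤ m / 2 * 2 :=
        mul_le_mul (min_le_right _ _) (hmod_le_two T x) hh0 (by positivity)
      _ = m := by ring
      _ ≤ w x := hmw x hx h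
  · have h1 : hmod T x ≤ 1 := h.trans (min_le_left _ _)
    have h2 : hmod T x ≤ c₀ / (2 * C) := h.trans (min_le_right _ _)
    have h3 := (abs_le.1 (hC x)).1
    rw [smod_sq] at h3
    have h4 : C * hmod T x ≤ c₀ / 2 := by
      rw [le_div_iff₀ (by positivity)] at h2
      linarith
    have h5 : w x ≥ c₀ * (hmod T x * (2 - hmod T x)) - C * hmod T x ^ 2 := by
      rw [hc₀]; linarith
    have h6 : c₀ * hmod T x ≤ c₀ * (hmod T x * (2 - hmod T x)) := by
      apply mul_le_mul_of_nonneg_left _ hc₀pos.le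
      nlinarith
    calc min (c₀ / 2) (m / 2) * hmod T x ≤ c₀ / 2 * hmod T x := by
          gcongr; exact min_le_left _ _
      _ ≤ w x := by nlinarith

end

/-! ### Semiclassical estimates for the longitudinal ground state -/

section

variable {T : ℝ} {w : ℝ → ℝ} {ε : ℝ} {μ : ℝ} {f : ℝ → ℝ}

theorem integral_combination {a b : ℝ} {g₁ g₂ g₃ : ℝ → ℝ} (h₁ : Continuous g₁)
    (h₂ : Continuous g₂) (h₃ : Continuous g₃) (c₁ c₂ c₃ : ℝ) :
    ∫ z in a..b, (c₁ * g₁ z + c₂ * g₂ z + c₃ * g₃ z) =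
      c₁ * (∫ z in a..b, g₁ z) + c₂ * (∫ z in a..b, g₂ z) + c₃ * ∫ z in a..b, g₃ z := by
  rw [intervalIntegral.integral_add (by exact (by fun_prop : Continuous _).intervalIntegrable _ _)
      (by exact (by fun_prop : Continuous _).intervalIntegrable _ _),
    intervalIntegral.integral_add (by exact (by fun_prop : Continuous _).intervalIntegrable _ _)
      (by exact (by fun_prop : Continuous _).intervalIntegrable _ _)]
  simp only [intervalIntegral.integral_const_mul]

theorem integral_mono_continuous {a b : ℝ} (hab : a ≤ b) {g₁ g₂ : ℝ → ℝ} (h₁ : Continuous g₁)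
    (h₂ : Continuous g₂) (h : ∀ z, g₁ z ≤ g₂ z) :
    ∫ z in a..b, g₁ z ≤ ∫ z in a..b, g₂ z :=
  intervalIntegral.integral_mono hab (h₁.intervalIntegrable _ _) (h₂.intervalIntegrable _ _) h

namespace IsPositiveSolution

/-- The virial-type identity `∫ (f'²/2 + W f²) = μ ∫ f²`. -/
theorem energy_identity (hw : IsLatticeProfile T w) (hf : IsPositiveSolution T w ε μ f) :
    1 / 2 * (∫ z in (-(T / 2))..(T / 2), deriv f z ^ 2)
      + (∫ z in (-(T / 2))..(T / 2), latticePotential w ε z * f z ^ 2)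
      = μ * ∫ z in (-(T / 2))..(T / 2), f z ^ 2 := by
  have hfc := hf.contDiff.continuous
  have hfc' := hf.contDiff_deriv.continuous
  have hW := (hw.contDiff_potential ε).continuous
  have hF : ∀ z, HasDerivAt (fun z => f z * deriv f z)
      (1 * deriv f z ^ 2 + 2 * (latticePotential w ε z * f z ^ 2) + -(2 * μ) * f z ^ 2) z := by
    intro z
    have h := (hf.hasDerivAt z).mul (hf.hasDerivAt_deriv z)
    convert! h using 1
    ring
  have h := integral_deriv_eq_zero_of_periodic (T := T) hF (by fun_prop)
    (fun z => by rw [hf.periodic, hf.periodic_deriv])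
  rw [integral_combination (by fun_prop) (by fun_prop) (by fun_prop)] at h
  linarith

/-- The equation tested against `h f`, where `h = 1 - cos (2πz/T)`. -/
theorem weighted_identity (hw : IsLatticeProfile T w) (hf : IsPositiveSolution T w ε μ f) :
    ∫ z in (-(T / 2))..(T / 2), (hmod T z * deriv f z ^ 2
      + 2 * (latticePotential w ε z - μ) * (hmod T z * f z ^ 2)
      - 1 / 2 * (2 * Real.pi / T) ^ 2 * (1 - hmod T z) * f z ^ 2) = 0 := by
  have hfc := hf.contDiff.continuous
  have hfc' := hf.contDiff_deriv.continuous
  have hW := (hw.contDiff_potential ε).continuous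
  have hT := hw.period_pos
  have hF : ∀ z, HasDerivAt
      (fun z => hmod T z * (f z * deriv f z) - 1 / 2 * (2 * Real.pi / T) ^ 2 * (smod T z * f z ^ 2))
      (hmod T z * deriv f z ^ 2
      + 2 * (latticePotential w ε z - μ) * (hmod T z * f z ^ 2)
      - 1 / 2 * (2 * Real.pi / T) ^ 2 * (1 - hmod T z) * f z ^ 2) z := by
    intro z
    have h := ((hasDerivAt_hmod hT z).mul ((hf.hasDerivAt z).mul (hf.hasDerivAt_deriv z))).sub
      (((hasDerivAt_smod hT z).mul ((hf.hasDerivAt z).pow 2)).const_mul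
        (1 / 2 * (2 * Real.pi / T) ^ 2))
    convert! h using 1
    simp only [Pi.mul_apply, Pi.pow_apply]
    norm_num
    ring
  exact integral_deriv_eq_zero_of_periodic (T := T) hF (by fun_prop)
    (fun z => by simp only [hf.periodic, hf.periodic_deriv, hmod_periodic hT, smod_periodic hT])

/-- Completing the square with the logarithmic derivative `-κ S / ε` of the periodic Gaussian. -/
theorem square_identity (hw : IsLatticeProfile T w) (hε : 0 < ε)
    (hf : IsPositiveSolution T w ε μ f) :
    1 / 2 * (∫ z in (-(T / 2))..(T / 2), (deriv f z + kappa w / ε * smod T z * f z) ^ 2)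
      = (μ - kappa w / (2 * ε)) * (∫ z in (-(T / 2))..(T / 2), f z ^ 2)
        + kappa w / (2 * ε) * (∫ z in (-(T / 2))..(T / 2), hmod T z * f z ^ 2)
        + -(1 / ε ^ 2) * ∫ z in (-(T / 2))..(T / 2),
            (w z - 1 / 2 * kappa w ^ 2 * smod T z ^ 2) * f z ^ 2 := by
  have hfc := hf.contDiff.continuous
  have hfc' := hf.contDiff_deriv.continuous
  have hwc := hw.smooth.continuous
  have hT := hw.period_pos
  rw [← integral_combination (by fun_prop) (by fun_prop) (by fun_prop),
    ← intervalIntegral.integral_const_mul, ← sub_eq_zero, ← intervalIntegral.integral_sub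
      (by exact (by fun_prop : Continuous _).intervalIntegrable _ _)
      (by exact (by fun_prop : Continuous _).intervalIntegrable _ _)]
  have hF : ∀ z, HasDerivAt
      (fun z => 1 / 2 * (f z * deriv f z) + kappa w / (2 * ε) * (smod T z * f z ^ 2))
      (1 / 2 * (deriv f z + kappa w / ε * smod T z * f z) ^ 2
        - ((μ - kappa w / (2 * ε)) * f z ^ 2 + kappa w / (2 * ε) * (hmod T z * f z ^ 2)
        + -(1 / ε ^ 2) * ((w z - 1 / 2 * kappa w ^ 2 * smod T z ^ 2) * f z ^ 2))) z := by
    intro z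
    have h := (((hf.hasDerivAt z).mul (hf.hasDerivAt_deriv z)).const_mul (1 / 2)).add
      (((hasDerivAt_smod hT z).mul ((hf.hasDerivAt z).pow 2)).const_mul (kappa w / (2 * ε)))
    convert! h using 1
    simp only [Pi.pow_apply, latticePotential]
    norm_num
    field_simp
    ring
  exact integral_deriv_eq_zero_of_periodic (T := T) hF (by fun_prop)
    (fun z => by simp only [hf.periodic, hf.periodic_deriv, smod_periodic hT])

end IsPositiveSolution

/-- The periodic Gaussian `exp (-κ h / (k² ε))`, `k = 2π/T`, `h = 1 - cos (kz)`. -/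
noncomputable def gaussTrial (T : ℝ) (w : ℝ → ℝ) (ε z : ℝ) : ℝ :=
  Real.exp (-(kappa w / (2 * Real.pi / T) ^ 2 / ε * hmod T z))

@[fun_prop] theorem continuous_gaussTrial (T : ℝ) (w : ℝ → ℝ) (ε : ℝ) :
    Continuous (gaussTrial T w ε) := by
  unfold gaussTrial; fun_prop

theorem gaussTrial_pos (T : ℝ) (w : ℝ → ℝ) (ε z : ℝ) : 0 < gaussTrial T w ε z := Real.exp_pos _

theorem hasDerivAt_gaussTrial (hT : 0 < T) (w : ℝ → ℝ) (ε z : ℝ) :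
    HasDerivAt (gaussTrial T w ε) (-(kappa w / ε * smod T z * gaussTrial T w ε z)) z := by
  have h := (((hasDerivAt_hmod hT z).const_mul
    (kappa w / (2 * Real.pi / T) ^ 2 / ε)).neg).exp
  convert! h using 1
  simp only [gaussTrial, Pi.neg_apply]
  have : (2 * Real.pi / T) ^ 2 ≠ 0 := by have := Real.pi_pos; positivity
  field_simp

theorem gaussTrial_periodic (hT : 0 < T) (w : ℝ → ℝ) (ε z : ℝ) :
    gaussTrial T w ε (z + T) = gaussTrial T w ε z := by
  simp [gaussTrial, hmod_periodic hT]

theorem gaussTrial_sq (T : ℝ) (w : ℝ → ℝ) (ε z : ℝ) :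
    gaussTrial T w ε z ^ 2 = Real.exp (-(2 * kappa w / (2 * Real.pi / T) ^ 2 / ε * hmod T z)) := by
  rw [gaussTrial, ← Real.exp_nat_mul]
  congr 1
  push_cast
  ring

theorem gaussTrial_sq_le (hw : IsLatticeProfile T w) (hε : 0 < ε) {z : ℝ} (hz : |z| ≤ T / 2) :
    gaussTrial T w ε z ^ 2 ≤ Real.exp (-(4 * kappa w / Real.pi ^ 2 / ε * z ^ 2)) := by
  have hT := hw.period_pos
  have hκ := hw.kappa_pos
  have hpi := Real.pi_pos
  rw [gaussTrial_sq, Real.exp_le_exp, neg_le_neg_iff]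
  calc 4 * kappa w / Real.pi ^ 2 / ε * z ^ 2
      = 2 * kappa w / (2 * Real.pi / T) ^ 2 / ε * (8 / T ^ 2 * z ^ 2) := by field_simp; ring
    _ ≤ _ := by gcongr; exact le_hmod hT hz

theorem le_gaussTrial_sq (hw : IsLatticeProfile T w) (hε : 0 < ε) (z : ℝ) :
    Real.exp (-(kappa w / ε * z ^ 2)) ≤ gaussTrial T w ε z ^ 2 := by
  have hT := hw.period_pos
  have hκ := hw.kappa_pos
  have hpi := Real.pi_pos
  rw [gaussTrial_sq, Real.exp_le_exp, neg_le_neg_iff]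
  calc 2 * kappa w / (2 * Real.pi / T) ^ 2 / ε * hmod T z
      ≤ 2 * kappa w / (2 * Real.pi / T) ^ 2 / ε * ((2 * Real.pi / T) ^ 2 / 2 * z ^ 2) := by
        gcongr; exact hmod_le T z
    _ = kappa w / ε * z ^ 2 := by field_simp

/-- The error term `∫ h² v² / ε²` of the periodic Gaussian `v` is bounded relative to `∫ v²`. -/
theorem exists_gaussTrial_error_le (hw : IsLatticeProfile T w) :
    ∃ C, 0 < C ∧ ∀ ε, 0 < ε → ε ≤ (T / 2) ^ 2 →
      1 / ε ^ 2 * (∫ z in (-(T / 2))..(T / 2), hmod T z ^ 2 * gaussTrial T w ε z ^ 2)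
        ≤ C * ∫ z in (-(T / 2))..(T / 2), gaussTrial T w ε z ^ 2 := by
  have hT := hw.period_pos
  have hκ := hw.kappa_pos
  have hpi := Real.pi_pos
  set A : ℝ := 2 * kappa w / (2 * Real.pi / T) ^ 2 with hA
  have hApos : 0 < A := by positivity
  set B : ℝ := 2 * kappa w / Real.pi ^ 2 with hB
  have hBpos : 0 < B := by positivity
  refine ⟨8 / A ^ 2 * √(Real.pi / B) * Real.exp (kappa w), by positivity, fun ε hε hεT => ?_⟩
  have hs : √ε ≤ T / 2 := by
    rw [Real.sqrt_le_left (by positivity)]; exact hεT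
  have hspos : 0 < √ε := Real.sqrt_pos.2 hε
  have hss : √ε ^ 2 = ε := Real.sq_sqrt hε.le
  -- on `[0, √ε]` the Gaussian is bounded below
  have hlow : √ε * Real.exp (-kappa w) ≤ ∫ z in (-(T / 2))..(T / 2), gaussTrial T w ε z ^ 2 := by
    calc √ε * Real.exp (-kappa w) = ∫ z in (0 : ℝ)..√ε, Real.exp (-kappa w) := by simp
      _ ≤ ∫ z in (0 : ℝ)..√ε, gaussTrial T w ε z ^ 2 := by
        refine intervalIntegral.integral_mono_on hspos.le (by simp)
          ((by fun_prop : Continuous _).intervalIntegrable _ _) fun z hz => ?_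
        refine le_trans (Real.exp_le_exp.2 ?_) (le_gaussTrial_sq hw hε z)
        have : z ^ 2 ≤ ε := by
          rw [← hss]; exact pow_le_pow_left₀ hz.1 hz.2 2
        rw [neg_le_neg_iff, div_mul_eq_mul_div, div_le_iff₀ hε]
        gcongr
      _ ≤ _ := by
        refine intervalIntegral.integral_mono_interval (by linarith) hspos.le hs
          (Eventually.of_forall fun z => by positivity)
          ((by fun_prop : Continuous _).intervalIntegrable _ _)
  -- half of the Gaussian absorbs the factor `(h / ε)²`, the other half is integrable
  have hup : 1 / ε ^ 2 * (∫ z in (-(T / 2))..(T / 2), hmod T z ^ 2 * gaussTrial T w ε z ^ 2)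
      ≤ 8 / A ^ 2 * √(Real.pi / B) * √ε := by
    have hpt : ∀ z ∈ Set.Icc (-(T / 2)) (T / 2), 1 / ε ^ 2 * (hmod T z ^ 2 * gaussTrial T w ε z ^ 2)
        ≤ 8 / A ^ 2 * Real.exp (-(B / ε) * z ^ 2) := by
      intro z hz
      have hh := hmod_nonneg T z
      rw [gaussTrial_sq, ← hA]
      set x := hmod T z / ε with hx
      have hx0 : 0 ≤ x := by positivity
      have e1 : A / ε * hmod T z = A * x := by rw [hx]; ring
      have e2 : 1 / ε ^ 2 * (hmod T z ^ 2 * Real.exp (-(A / ε * hmod T z)))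
          = x ^ 2 * (Real.exp (-(A * x / 2)) * Real.exp (-(A * x / 2))) := by
        rw [← Real.exp_add, e1, hx]; field_simp; ring_nf
      rw [e2]
      have h1 : (A * x / 2) ^ 2 / 2 ≤ Real.exp (A * x / 2) := by
        have := Real.quadratic_le_exp_of_nonneg (x := A * x / 2) (by positivity)
        have : 0 ≤ A * x / 2 := by positivity
        linarith
      have h2 : x ^ 2 * Real.exp (-(A * x / 2)) ≤ 8 / A ^ 2 := by
        rw [Real.exp_neg, ← div_eq_mul_inv, div_le_iff₀ (Real.exp_pos _)]
        calc x ^ 2 = 8 / A ^ 2 * ((A * x / 2) ^ 2 / 2) := by field_simp; ring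
          _ ≤ _ := by gcongr
      have h3 : Real.exp (-(A * x / 2)) ≤ Real.exp (-(B / ε) * z ^ 2) := by
        rw [Real.exp_le_exp, neg_mul, neg_le_neg_iff]
        have h4 := le_hmod hT (abs_le.2 hz)
        calc B / ε * z ^ 2 = A / (2 * ε) * (8 / T ^ 2 * z ^ 2) := by
              rw [hA, hB]; field_simp; ring
          _ ≤ A / (2 * ε) * hmod T z := by gcongr
          _ = A * x / 2 := by rw [hx]; field_simp
      calc x ^ 2 * (Real.exp (-(A * x / 2)) * Real.exp (-(A * x / 2)))
          = x ^ 2 * Real.exp (-(A * x / 2)) * Real.exp (-(A * x / 2)) := by ring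
        _ ≤ _ := by gcongr
    have hBε : 0 < B / ε := by positivity
    rw [← intervalIntegral.integral_const_mul]
    calc _ ≤ ∫ z in (-(T / 2))..(T / 2), 8 / A ^ 2 * Real.exp (-(B / ε) * z ^ 2) :=
          intervalIntegral.integral_mono_on (by linarith)
            ((by fun_prop : Continuous _).intervalIntegrable _ _)
            ((by fun_prop : Continuous _).intervalIntegrable _ _) hpt
      _ = 8 / A ^ 2 * ∫ z in (-(T / 2))..(T / 2), Real.exp (-(B / ε) * z ^ 2) := by
          rw [intervalIntegral.integral_const_mul]
      _ ≤ 8 / A ^ 2 * ∫ z : ℝ, Real.exp (-(B / ε) * z ^ 2) := by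
          gcongr
          rw [intervalIntegral.integral_of_le (by linarith)]
          exact setIntegral_le_integral (integrable_exp_neg_mul_sq hBε)
            (Eventually.of_forall fun z => (Real.exp_pos _).le)
      _ = 8 / A ^ 2 * √(Real.pi / B) * √ε := by
          rw [integral_gaussian, mul_assoc, ← Real.sqrt_mul (by positivity)]
          congr 2
          field_simp
  calc _ ≤ 8 / A ^ 2 * √(Real.pi / B) * √ε := hup
    _ = 8 / A ^ 2 * √(Real.pi / B) * Real.exp (kappa w) * (√ε * Real.exp (-kappa w)) := by
        rw [Real.exp_neg]; field_simp
    _ ≤ _ := by gcongr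

/-- Upper bound of the lowest eigenvalue, from the periodic Gaussian as trial function. -/
theorem exists_eigenvalue_le (hw : IsLatticeProfile T w) :
    ∃ C, 0 < C ∧ ∀ ε, 0 < ε → ε ≤ (T / 2) ^ 2 → ∀ μ f, IsPositiveSolution T w ε μ f →
      μ ≤ kappa w / (2 * ε) + C := by
  have hT := hw.period_pos
  have hκ := hw.kappa_pos
  obtain ⟨C₁, hC₁, h₁⟩ := hw.abs_sub_le
  obtain ⟨C₂, hC₂, h₂⟩ := exists_gaussTrial_error_le hw
  refine ⟨C₁ * C₂, by positivity, fun ε hε hεT μ f hf => ?_⟩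
  set v := gaussTrial T w ε with hv
  have hvc : Continuous v := continuous_gaussTrial T w ε
  have hwc := hw.smooth.continuous
  have hWc : Continuous (latticePotential w ε) := (hw.contDiff_potential ε).continuous
  have hJ := hf.jacobi_identity hw (ψ := fun z => (v z : ℂ))
    (ψ' := fun z => ((-(kappa w / ε * smod T z * v z) : ℝ) : ℂ))
    (fun z => (hasDerivAt_gaussTrial hT w ε z).ofReal_comp) (by fun_prop)
    (fun z => by simp only [hv, gaussTrial_periodic hT])
  have hJ0 : 0 ≤ ∫ z in (-(T / 2))..(T / 2), (1 / 2 * (kappa w / ε * smod T z * v z) ^ 2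
      + (latticePotential w ε z - μ) * v z ^ 2) := by
    have h : 0 ≤ ∫ z in (-(T / 2))..(T / 2), 1 / 2 *
        ‖((-(kappa w / ε * smod T z * v z) : ℝ) : ℂ) - logDeriv f z • (v z : ℂ)‖ ^ 2 :=
      intervalIntegral.integral_nonneg (by linarith) fun z _ => by positivity
    rw [← hJ] at h
    simpa only [Complex.norm_real, Real.norm_eq_abs, sq_abs, neg_sq] using h
  have hF : ∀ z, HasDerivAt (fun z => kappa w / (2 * ε) * (smod T z * v z ^ 2))
      (kappa w / (2 * ε) * (1 - hmod T z) * v z ^ 2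
        - (kappa w / ε) ^ 2 * smod T z ^ 2 * v z ^ 2) z := by
    intro z
    have h := ((hasDerivAt_smod hT z).mul ((hasDerivAt_gaussTrial hT w ε z).pow 2)).const_mul
      (kappa w / (2 * ε))
    convert! h using 1
    simp only [Pi.pow_apply, ← hv]
    norm_num
    field_simp
    ring
  have hF0 := integral_deriv_eq_zero_of_periodic (T := T) hF (by fun_prop)
    (fun z => by simp only [hv, gaussTrial_periodic hT, smod_periodic hT])
  -- the harmonic part of the potential is turned into `κ / (2ε)` by adding the derivative `hF`
  have hle : (∫ z in (-(T / 2))..(T / 2), (1 / 2 * (kappa w / ε * smod T z * v z) ^ 2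
      + (latticePotential w ε z - μ) * v z ^ 2))
      ≤ ∫ z in (-(T / 2))..(T / 2), ((kappa w / (2 * ε) - μ) * v z ^ 2
        + C₁ * (1 / ε ^ 2) * (hmod T z ^ 2 * v z ^ 2)
        + -1 * (kappa w / (2 * ε) * (1 - hmod T z) * v z ^ 2
        - (kappa w / ε) ^ 2 * smod T z ^ 2 * v z ^ 2)) := by
    refine integral_mono_continuous (by linarith) (by fun_prop) (by fun_prop) fun z => ?_
    have h3 := (abs_le.1 (h₁ z)).2
    have h4 : latticePotential w ε z
        ≤ 1 / 2 * (kappa w / ε) ^ 2 * smod T z ^ 2 + C₁ * (1 / ε ^ 2) * hmod T z ^ 2 := by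
      rw [latticePotential, div_le_iff₀ (by positivity)]
      have : (1 / 2 * (kappa w / ε) ^ 2 * smod T z ^ 2 + C₁ * (1 / ε ^ 2) * hmod T z ^ 2) * ε ^ 2
        = 1 / 2 * kappa w ^ 2 * smod T z ^ 2 + C₁ * hmod T z ^ 2 := by field_simp
      rw [this]; linarith
    have h5 := mul_le_mul_of_nonneg_right h4 (sq_nonneg (v z))
    have h6 : 0 ≤ kappa w / (2 * ε) * hmod T z * v z ^ 2 := by
      have := hmod_nonneg T z
      positivity
    nlinarith
  rw [integral_combination (by fun_prop) (by fun_prop) (by fun_prop), hF0] at hle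
  have hI := h₂ ε hε hεT
  rw [← hv] at hI
  have hvpos : 0 < ∫ z in (-(T / 2))..(T / 2), v z ^ 2 :=
    intervalIntegral.intervalIntegral_pos_of_pos
      ((by fun_prop : Continuous fun z => v z ^ 2).intervalIntegrable _ _)
      (fun z => pow_pos (gaussTrial_pos T w ε z) 2) (by linarith)
  have h7 : 0 ≤ (kappa w / (2 * ε) - μ + C₁ * C₂) * ∫ z in (-(T / 2))..(T / 2), v z ^ 2 := by
    have := mul_le_mul_of_nonneg_left hI hC₁.le
    nlinarith
  have := nonneg_of_mul_nonneg_left h7 hvpos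
  linarith

end

section

variable {T : ℝ} {w : ℝ → ℝ} {ε : ℝ} {μ : ℝ} {f : ℝ → ℝ}

/-- The estimates on a normalized positive solution that are uniform in the semiclassical
parameter: energy, moments of order two and four, and defect with respect to the Gaussian. -/
structure SemiclassicalBounds (T : ℝ) (w : ℝ → ℝ) (C ε μ : ℝ) (f : ℝ → ℝ) : Prop where
  lower : kappa w / (2 * ε) - C ≤ μ
  moment_two : ∫ z in (-(T / 2))..(T / 2), hmod T z * f z ^ 2 ≤ C * ε
  moment_four : ∫ z in (-(T / 2))..(T / 2), hmod T z ^ 2 * f z ^ 2 ≤ C * ε ^ 2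
  defect : ∫ z in (-(T / 2))..(T / 2), (deriv f z + kappa w / ε * smod T z * f z) ^ 2 ≤ C
  kinetic : ∫ z in (-(T / 2))..(T / 2), deriv f z ^ 2 ≤ C / ε

/-- The upper bound of the eigenvalue controls the second moment through the potential energy; the
equation tested against `h f` then controls the fourth moment. With these, completing the square
bounds the defect and, its left-hand side being non-negative, the eigenvalue from below. -/
theorem exists_semiclassicalBounds (hw : IsLatticeProfile T w) :
    ∃ C, 0 < C ∧ ∀ ε, 0 < ε → ε ≤ 1 → ε ≤ (T / 2) ^ 2 → ∀ μ f, IsPositiveSolution T w ε μ f →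
      ∫ z in (-(T / 2))..(T / 2), f z ^ 2 = 1 → SemiclassicalBounds T w C ε μ f := by
  have hT := hw.period_pos
  have hκ := hw.kappa_pos
  obtain ⟨C₁, hC₁, h₁⟩ := hw.abs_sub_le
  obtain ⟨c, hc, hcw⟩ := hw.exists_le
  obtain ⟨Cu, hCu, hup⟩ := exists_eigenvalue_le hw
  set k : ℝ := 2 * Real.pi / T with hk
  set K : ℝ := kappa w / 2 + Cu with hK
  have hKpos : 0 < K := by positivity
  set K₁ : ℝ := K / c with hK₁
  have hK₁pos : 0 < K₁ := by positivity
  set K₂ : ℝ := (2 * K * K₁ + 1 / 2 * k ^ 2) / (2 * c) with hK₂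
  have hK₂pos : 0 < K₂ := by positivity
  set K₃ : ℝ := Cu + kappa w / 2 * K₁ + C₁ * K₂ with hK₃
  have hK₃pos : 0 < K₃ := by positivity
  refine ⟨2 * K + K₁ + K₂ + 2 * K₃, by positivity, fun ε hε hε1 hεT μ f hf hnorm => ?_⟩
  have hfc := hf.contDiff.continuous
  have hfc' := hf.contDiff_deriv.continuous
  have hwc := hw.smooth.continuous
  have hWc : Continuous (latticePotential w ε) := (hw.contDiff_potential ε).continuous
  have hTT : -(T / 2) ≤ T / 2 := by linarith
  have hμ := hup ε hε hεT μ f hf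
  have hμK : μ * ε ≤ K := by
    calc μ * ε ≤ (kappa w / (2 * ε) + Cu) * ε := by gcongr
      _ = kappa w / 2 + Cu * ε := by field_simp
      _ ≤ K := by rw [hK]; nlinarith
  have hE := hf.energy_identity hw
  rw [hnorm, mul_one] at hE
  have hP0 : 0 ≤ ∫ z in (-(T / 2))..(T / 2), deriv f z ^ 2 :=
    intervalIntegral.integral_nonneg hTT fun z _ => sq_nonneg _
  have hQ0 : 0 ≤ ∫ z in (-(T / 2))..(T / 2), latticePotential w ε z * f z ^ 2 :=
    intervalIntegral.integral_nonneg hTT fun z _ =>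
      mul_nonneg (hw.potential_nonneg ε z) (sq_nonneg _)
  have hμ0 : 0 ≤ μ := by linarith
  -- second moment: `c h ≤ w`
  have hX1 : ∫ z in (-(T / 2))..(T / 2), hmod T z * f z ^ 2 ≤ K₁ * ε := by
    have h : c / ε ^ 2 * (∫ z in (-(T / 2))..(T / 2), hmod T z * f z ^ 2)
        ≤ ∫ z in (-(T / 2))..(T / 2), latticePotential w ε z * f z ^ 2 := by
      rw [← intervalIntegral.integral_const_mul]
      refine integral_mono_continuous hTT (by fun_prop) (by fun_prop) fun z => ?_
      rw [← mul_assoc]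
      refine mul_le_mul_of_nonneg_right ?_ (sq_nonneg _)
      rw [latticePotential, div_mul_eq_mul_div]
      gcongr
      exact hcw z
    have h2 : c / ε ^ 2 * (∫ z in (-(T / 2))..(T / 2), hmod T z * f z ^ 2) ≤ μ := by linarith
    rw [div_mul_eq_mul_div, div_le_iff₀ (by positivity)] at h2
    rw [hK₁, div_mul_eq_mul_div, le_div_iff₀ hc]
    nlinarith
  -- fourth moment
  have hX2 : ∫ z in (-(T / 2))..(T / 2), hmod T z ^ 2 * f z ^ 2 ≤ K₂ * ε ^ 2 := by
    have h : ∫ z in (-(T / 2))..(T / 2), (2 * (c / ε ^ 2) * (hmod T z ^ 2 * f z ^ 2)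
        + -(2 * μ) * (hmod T z * f z ^ 2) + -(1 / 2 * k ^ 2) * f z ^ 2) ≤ 0 := by
      rw [← hf.weighted_identity hw]
      refine integral_mono_continuous hTT (by fun_prop) (by fun_prop) fun z => ?_
      have hh := hmod_nonneg T z
      have hW : c / ε ^ 2 * hmod T z ≤ latticePotential w ε z := by
        rw [latticePotential, div_mul_eq_mul_div]
        gcongr
        exact hcw z
      have e1 := mul_le_mul_of_nonneg_right hW (mul_nonneg hh (sq_nonneg (f z)))
      have e2 : 0 ≤ hmod T z * deriv f z ^ 2 := mul_nonneg hh (sq_nonneg _)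
      have e3 : 0 ≤ 1 / 2 * k ^ 2 * hmod T z * f z ^ 2 := by positivity
      rw [← hk]
      nlinarith
    rw [integral_combination (by fun_prop) (by fun_prop) (by fun_prop), hnorm] at h
    have h2 : 2 * μ * (∫ z in (-(T / 2))..(T / 2), hmod T z * f z ^ 2) ≤ 2 * K * K₁ := by
      calc _ ≤ 2 * μ * (K₁ * ε) := by gcongr
        _ = 2 * (μ * ε) * K₁ := by ring
        _ ≤ _ := by gcongr
    have h3 : 2 * (c / ε ^ 2) * (∫ z in (-(T / 2))..(T / 2), hmod T z ^ 2 * f z ^ 2)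
        ≤ 2 * K * K₁ + 1 / 2 * k ^ 2 := by linarith
    have h4 : (∫ z in (-(T / 2))..(T / 2), hmod T z ^ 2 * f z ^ 2)
        = ε ^ 2 / (2 * c) * (2 * (c / ε ^ 2)
          * (∫ z in (-(T / 2))..(T / 2), hmod T z ^ 2 * f z ^ 2)) := by field_simp
    rw [h4]
    calc _ ≤ ε ^ 2 / (2 * c) * (2 * K * K₁ + 1 / 2 * k ^ 2) := by gcongr
      _ = K₂ * ε ^ 2 := by rw [hK₂]; ring
  -- the defect
  have hD := hf.square_identity hw hε
  rw [hnorm, mul_one] at hD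
  have hR : -(1 / ε ^ 2) * (∫ z in (-(T / 2))..(T / 2),
      (w z - 1 / 2 * kappa w ^ 2 * smod T z ^ 2) * f z ^ 2) ≤ C₁ * K₂ := by
    have h : ∫ z in (-(T / 2))..(T / 2), (-C₁) * (hmod T z ^ 2 * f z ^ 2)
        ≤ ∫ z in (-(T / 2))..(T / 2), (w z - 1 / 2 * kappa w ^ 2 * smod T z ^ 2) * f z ^ 2 := by
      refine integral_mono_continuous hTT (by fun_prop) (by fun_prop) fun z => ?_
      have := mul_le_mul_of_nonneg_right (abs_le.1 (h₁ z)).1 (sq_nonneg (f z))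
      linarith
    rw [intervalIntegral.integral_const_mul] at h
    have h2 : -(∫ z in (-(T / 2))..(T / 2), (w z - 1 / 2 * kappa w ^ 2 * smod T z ^ 2) * f z ^ 2)
        ≤ C₁ * (K₂ * ε ^ 2) := by nlinarith
    calc _ = 1 / ε ^ 2 * -(∫ z in (-(T / 2))..(T / 2),
          (w z - 1 / 2 * kappa w ^ 2 * smod T z ^ 2) * f z ^ 2) := by ring
      _ ≤ 1 / ε ^ 2 * (C₁ * (K₂ * ε ^ 2)) := by gcongr
      _ = C₁ * K₂ := by field_simp
  have hS : kappa w / (2 * ε) * (∫ z in (-(T / 2))..(T / 2), hmod T z * f z ^ 2)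
      ≤ kappa w / 2 * K₁ := by
    calc _ ≤ kappa w / (2 * ε) * (K₁ * ε) := by gcongr
      _ = _ := by field_simp
  have hD0 : 0 ≤ ∫ z in (-(T / 2))..(T / 2),
      (deriv f z + kappa w / ε * smod T z * f z) ^ 2 :=
    intervalIntegral.integral_nonneg hTT fun z _ => sq_nonneg _
  refine ⟨?_, ?_, ?_, ?_, ?_⟩
  · linarith
  · refine hX1.trans ?_
    gcongr
    linarith
  · refine hX2.trans ?_
    gcongr
    linarith
  · linarith
  · rw [le_div_iff₀ hε]
    have h : (∫ z in (-(T / 2))..(T / 2), deriv f z ^ 2) * ε ≤ 2 * μ * ε := by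
      gcongr
      linarith
    linarith

/-- The oscillation of a differentiable function is at most the integral of a bound of its
derivative. -/
theorem abs_sub_le_integral {a b : ℝ} {F F' B : ℝ → ℝ} (hF : ∀ z, HasDerivAt F (F' z) z)
    (hF' : Continuous F') (hB : Continuous B) (hle : ∀ z, |F' z| ≤ B z) {x y : ℝ}
    (hx : x ∈ Set.Icc a b) (hy : y ∈ Set.Icc a b) : |F x - F y| ≤ ∫ z in a..b, B z := by
  have hB0 : ∀ z, 0 ≤ B z := fun z => (abs_nonneg _).trans (hle z)
  wlog hxy : y ≤ x generalizing x y
  · rw [abs_sub_comm]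
    exact this hy hx (le_of_not_ge hxy)
  rw [← intervalIntegral.integral_eq_sub_of_hasDerivAt (fun z _ => hF z)
    (hF'.intervalIntegrable _ _)]
  calc |∫ z in y..x, F' z| ≤ ∫ z in y..x, |F' z| :=
        intervalIntegral.abs_integral_le_integral_abs hxy
    _ ≤ ∫ z in y..x, B z := integral_mono_continuous hxy hF'.abs hB hle
    _ ≤ _ := intervalIntegral.integral_mono_interval hy.1 hxy hx.2
        (Eventually.of_forall hB0) (hB.intervalIntegrable _ _)

/-- Pointwise decay of the ground state at the scale `√ε`. -/
theorem exists_sq_le (hw : IsLatticeProfile T w) {C : ℝ} (hC : 0 < C) :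
    ∃ C', 0 < C' ∧ ∀ ε, 0 < ε → ε ≤ 1 → ∀ μ f, IsPositiveSolution T w ε μ f →
      ∫ z in (-(T / 2))..(T / 2), f z ^ 2 = 1 → SemiclassicalBounds T w C ε μ f →
      ∀ z, |z| ≤ T / 2 → √ε * f z ^ 2 ≤ C' ∧ z ^ 2 * f z ^ 2 ≤ C' * √ε := by
  have hT := hw.period_pos
  have hpi := Real.pi_pos
  have hTT : -(T / 2) ≤ T / 2 := by linarith
  set k : ℝ := 2 * Real.pi / T with hk
  have hkpos : 0 < k := by positivity
  set L₁ : ℝ := 1 / T + 1 + C with hL₁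
  set L₂ : ℝ := k ^ 2 * (1 + (T / (2 * Real.pi)) ^ 2 * 2 * C) + 2 * C with hL₂
  have hL₁pos : 0 < L₁ := by positivity
  have hL₂pos : 0 < L₂ := by positivity
  refine ⟨L₁ + T ^ 2 / 8 * L₂, by positivity, fun ε hε hε1 μ f hf hnorm hb z hz => ?_⟩
  have hfc := hf.contDiff.continuous
  have hfc' := hf.contDiff_deriv.continuous
  set s := √ε with hs
  have hspos : 0 < s := Real.sqrt_pos.2 hε
  have hss : s ^ 2 = ε := Real.sq_sqrt hε.le
  have hs1 : s ≤ 1 := Real.sqrt_le_one.2 hε1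
  have hzI := abs_le.1 hz
  have hkin := hb.kinetic
  have hm2 := hb.moment_two
  have hm4 := hb.moment_four
  rw [← hss] at hkin hm2 hm4
  constructor
  · -- compare `f(z)²` with its mean over a period
    have hosc : ∀ t ∈ Set.Icc (-(T / 2)) (T / 2), f z ^ 2 ≤ f t ^ 2 + (1 + C) / s := by
      intro t ht
      have h := abs_sub_le_integral (F := fun z => f z ^ 2) (F' := fun z => 2 * f z * deriv f z)
        (B := fun z => 1 / s * f z ^ 2 + s * deriv f z ^ 2 + 0 * 0)
        (fun z => by simpa using! (hf.hasDerivAt z).pow 2) (by fun_prop) (by fun_prop)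
        (fun z => by
          have e1 : 0 ≤ s * (f z / s - deriv f z) ^ 2 := by positivity
          have e2 : 0 ≤ s * (f z / s + deriv f z) ^ 2 := by positivity
          have e3 : s * (f z / s - deriv f z) ^ 2
              = 1 / s * f z ^ 2 + s * deriv f z ^ 2 - 2 * f z * deriv f z := by
            field_simp; ring
          have e4 : s * (f z / s + deriv f z) ^ 2
              = 1 / s * f z ^ 2 + s * deriv f z ^ 2 + 2 * f z * deriv f z := by
            field_simp; ring
          rw [abs_le]; constructor <;> linarith) hzI ht
      rw [integral_combination (by fun_prop) (by fun_prop) (by fun_prop), hnorm] at h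
      have h2 : s * (∫ z in (-(T / 2))..(T / 2), deriv f z ^ 2) ≤ C / s := by
        calc _ ≤ s * (C / s ^ 2) := by gcongr
          _ = C / s := by field_simp
      have h3 := (abs_le.1 h).2
      rw [add_div]
      linarith
    have hint := intervalIntegral.integral_mono_on hTT (μ := volume)
      (continuous_const.intervalIntegrable _ _)
      ((by fun_prop : Continuous fun t => f t ^ 2 + (1 + C) / s).intervalIntegrable _ _) hosc
    rw [intervalIntegral.integral_add ((by fun_prop : Continuous _).intervalIntegrable _ _)
      (continuous_const.intervalIntegrable _ _), hnorm] at hint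
    simp only [intervalIntegral.integral_const, smul_eq_mul] at hint
    have e : T / 2 - -(T / 2) = T := by ring
    rw [e] at hint
    have h4 : s * f z ^ 2 ≤ s / T + 1 + C := by
      have : s / T * (T * f z ^ 2) ≤ s / T * (1 + T * ((1 + C) / s)) := by gcongr
      calc s * f z ^ 2 = s / T * (T * f z ^ 2) := by field_simp
        _ ≤ _ := this
        _ = _ := by field_simp; ring
    have h5 : s / T ≤ 1 / T := by gcongr
    have : 0 ≤ T ^ 2 / 8 * L₂ := by positivity
    linarith
  · -- compare `h f²` with its value `0` at the bottom of the well
    have h := abs_sub_le_integral (F := fun z => hmod T z * f z ^ 2)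
      (F' := fun z => k ^ 2 * smod T z * f z ^ 2 + hmod T z * (2 * f z * deriv f z))
      (B := fun z => k ^ 2 * s * f z ^ 2
        + (k ^ 2 * ((T / (2 * Real.pi)) ^ 2 * 2) / s) * (hmod T z * f z ^ 2)
        + 1 * (1 / s ^ 3 * (hmod T z ^ 2 * f z ^ 2) + s ^ 3 * deriv f z ^ 2 + 0 * 0))
      (fun z => by
        have h := (hasDerivAt_hmod hT z).mul ((hf.hasDerivAt z).pow 2)
        convert! h using 1
        simp [hk]) (by fun_prop) (by fun_prop)
      (fun z => by
        have hh := hmod_nonneg T z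
        have e0 : |smod T z| ≤ s + (T / (2 * Real.pi)) ^ 2 * 2 / s * hmod T z := by
          have e1 : smod T z ^ 2 ≤ (T / (2 * Real.pi)) ^ 2 * 2 * hmod T z := by
            rw [smod_sq, mul_assoc]
            exact mul_le_mul_of_nonneg_left (by nlinarith) (sq_nonneg _)
          have e2 : |smod T z| ≤ s + smod T z ^ 2 / s := by
            have : 0 ≤ (s - |smod T z|) ^ 2 / s := by positivity
            have e3 : (s - |smod T z|) ^ 2 / s = s + smod T z ^ 2 / s - 2 * |smod T z| := by
              rw [← sq_abs (smod T z)]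
              field_simp
              ring
            have := abs_nonneg (smod T z)
            linarith
          refine e2.trans ?_
          have : smod T z ^ 2 / s ≤ (T / (2 * Real.pi)) ^ 2 * 2 * hmod T z / s := by gcongr
          have e4 : (T / (2 * Real.pi)) ^ 2 * 2 * hmod T z / s
            = (T / (2 * Real.pi)) ^ 2 * 2 / s * hmod T z := by ring
          linarith
        have e5 : |k ^ 2 * smod T z * f z ^ 2| ≤ k ^ 2 * s * f z ^ 2
            + (k ^ 2 * ((T / (2 * Real.pi)) ^ 2 * 2) / s) * (hmod T z * f z ^ 2) := by
          rw [abs_mul, abs_mul, abs_of_nonneg (sq_nonneg k), abs_of_nonneg (sq_nonneg (f z))]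
          have := mul_le_mul_of_nonneg_right e0
            (mul_nonneg (sq_nonneg k) (sq_nonneg (f z)))
          calc k ^ 2 * |smod T z| * f z ^ 2 = |smod T z| * (k ^ 2 * f z ^ 2) := by ring
            _ ≤ _ := this
            _ = _ := by ring
        have e6 : |hmod T z * (2 * f z * deriv f z)|
            ≤ 1 / s ^ 3 * (hmod T z ^ 2 * f z ^ 2) + s ^ 3 * deriv f z ^ 2 := by
          have e1 : 0 ≤ s ^ 3 * (hmod T z * f z / s ^ 3 - deriv f z) ^ 2 := by positivity
          have e2 : 0 ≤ s ^ 3 * (hmod T z * f z / s ^ 3 + deriv f z) ^ 2 := by positivity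
          have e3 : s ^ 3 * (hmod T z * f z / s ^ 3 - deriv f z) ^ 2
              = 1 / s ^ 3 * (hmod T z ^ 2 * f z ^ 2) + s ^ 3 * deriv f z ^ 2
                - hmod T z * (2 * f z * deriv f z) := by
            field_simp; ring
          have e4 : s ^ 3 * (hmod T z * f z / s ^ 3 + deriv f z) ^ 2
              = 1 / s ^ 3 * (hmod T z ^ 2 * f z ^ 2) + s ^ 3 * deriv f z ^ 2
                + hmod T z * (2 * f z * deriv f z) := by
            field_simp; ring
          rw [abs_le]; constructor <;> linarith
        have := abs_add_le (k ^ 2 * smod T z * f z ^ 2) (hmod T z * (2 * f z * deriv f z))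
        linarith) hzI (y := 0) ⟨by linarith, by linarith⟩
    rw [integral_combination (by fun_prop) (by fun_prop) (by fun_prop),
      integral_combination (by fun_prop) (by fun_prop) (by fun_prop), hnorm, hmod_zero] at h
    have b1 : k ^ 2 * ((T / (2 * Real.pi)) ^ 2 * 2) / s
        * (∫ z in (-(T / 2))..(T / 2), hmod T z * f z ^ 2)
        ≤ k ^ 2 * ((T / (2 * Real.pi)) ^ 2 * 2) * C * s := by
      calc _ ≤ k ^ 2 * ((T / (2 * Real.pi)) ^ 2 * 2) / s * (C * s ^ 2) := by gcongr
        _ = _ := by field_simp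
    have b2 : 1 / s ^ 3 * (∫ z in (-(T / 2))..(T / 2), hmod T z ^ 2 * f z ^ 2) ≤ C * s := by
      calc _ ≤ 1 / s ^ 3 * (C * (s ^ 2) ^ 2) := by gcongr
        _ = _ := by field_simp
    have b3 : s ^ 3 * (∫ z in (-(T / 2))..(T / 2), deriv f z ^ 2) ≤ C * s := by
      calc _ ≤ s ^ 3 * (C / s ^ 2) := by gcongr
        _ = _ := by field_simp
    have h5 : hmod T z * f z ^ 2 ≤ L₂ * s := by
      have := (abs_le.1 h).2
      rw [hL₂]
      linarith
    calc z ^ 2 * f z ^ 2 = T ^ 2 / 8 * ((8 / T ^ 2 * z ^ 2) * f z ^ 2) := by field_simp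
      _ ≤ T ^ 2 / 8 * (hmod T z * f z ^ 2) := by
        gcongr
        exact le_hmod hT hz
      _ ≤ T ^ 2 / 8 * (L₂ * s) := by gcongr
      _ ≤ (L₁ + T ^ 2 / 8 * L₂) * s := by nlinarith

/-- On the scale `√ε` the quotient of the ground state by the periodic Gaussian is nearly
constant. -/
theorem abs_quotient_sub_le (hw : IsLatticeProfile T w) {C : ℝ} (hε : 0 < ε)
    (hf : IsPositiveSolution T w ε μ f) (hnorm : ∫ z in (-(T / 2))..(T / 2), f z ^ 2 = 1)
    (hb : SemiclassicalBounds T w C ε μ f) {z : ℝ} (hz : |z| ≤ T / 2) :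
    |f z ^ 2 / gaussTrial T w ε z ^ 2 - f 0 ^ 2 / gaussTrial T w ε 0 ^ 2|
      ≤ Real.exp (kappa w / ε * z ^ 2) * (1 + C) := by
  have hT := hw.period_pos
  have hκ := hw.kappa_pos
  have hfc := hf.contDiff.continuous
  have hfc' := hf.contDiff_deriv.continuous
  set v := gaussTrial T w ε with hv
  have hvpos : ∀ z, 0 < v z := gaussTrial_pos T w ε
  have hvc : Continuous v := continuous_gaussTrial T w ε
  set D : ℝ → ℝ := fun z => deriv f z + kappa w / ε * smod T z * f z with hD
  have hDc : Continuous D := by fun_prop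
  have hder : ∀ t, HasDerivAt (fun t => f t ^ 2 / v t ^ 2) (2 * (f t * D t) / v t ^ 2) t := by
    intro t
    have h := ((hf.hasDerivAt t).pow 2).div ((hasDerivAt_gaussTrial hT w ε t).pow 2)
      (pow_ne_zero 2 (hvpos t).ne')
    convert! h using 1
    simp only [Pi.pow_apply, ← hv, hD]
    have := (hvpos t).ne'
    norm_num
    field_simp
  have hcont : Continuous fun t => 2 * (f t * D t) / v t ^ 2 :=
    Continuous.div (by fun_prop) (by fun_prop) fun t => pow_ne_zero 2 (hvpos t).ne'
  have hmem : ∀ t ∈ Set.uIcc 0 z, |t| ≤ |z| := by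
    intro t ht
    rcases le_total 0 z with h | h
    · rw [Set.uIcc_of_le h] at ht
      rw [abs_of_nonneg ht.1, abs_of_nonneg h]; exact ht.2
    · rw [Set.uIcc_of_ge h] at ht
      rw [abs_of_nonpos ht.2, abs_of_nonpos h]; linarith [ht.1]
  have hpt : ∀ t ∈ Set.uIcc 0 z, |2 * (f t * D t) / v t ^ 2|
      ≤ Real.exp (kappa w / ε * z ^ 2) * (f t ^ 2 + D t ^ 2) := by
    intro t ht
    have h1 : (v t ^ 2)⁻¹ ≤ Real.exp (kappa w / ε * z ^ 2) := by
      have h2 := le_gaussTrial_sq hw hε t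
      rw [← hv] at h2
      have h3 : t ^ 2 ≤ z ^ 2 := sq_le_sq.2 (hmem t ht)
      rw [inv_le_comm₀ (pow_pos (hvpos t) 2) (Real.exp_pos _), ← Real.exp_neg]
      refine le_trans (Real.exp_le_exp.2 ?_) h2
      rw [neg_le_neg_iff]
      gcongr
    have h4 : |2 * (f t * D t)| ≤ f t ^ 2 + D t ^ 2 := by
      rw [abs_le]
      constructor <;> nlinarith [sq_nonneg (f t - D t), sq_nonneg (f t + D t)]
    rw [abs_div, abs_of_pos (pow_pos (hvpos t) 2), div_eq_mul_inv, mul_comm]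
    exact mul_le_mul h1 h4 (abs_nonneg _) (Real.exp_pos _).le
  rw [← intervalIntegral.integral_eq_sub_of_hasDerivAt (fun t _ => hder t)
    (hcont.intervalIntegrable _ _)]
  have hBc : Continuous fun t => Real.exp (kappa w / ε * z ^ 2) * (f t ^ 2 + D t ^ 2) := by fun_prop
  have hB0 : ∀ t, 0 ≤ Real.exp (kappa w / ε * z ^ 2) * (f t ^ 2 + D t ^ 2) := fun t => by positivity
  have hsub : Set.uIoc 0 z ⊆ Set.Ioc (-(T / 2)) (T / 2) := by
    have := abs_le.1 hz
    rw [← Set.uIoc_of_le (by linarith : -(T / 2) ≤ T / 2)]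
    apply Set.uIoc_subset_uIoc_of_uIcc_subset_uIcc
    apply Set.uIcc_subset_uIcc <;> rw [Set.uIcc_of_le (by linarith)]
    · exact ⟨by linarith, by linarith⟩
    · exact this
  have hII := hBc.intervalIntegrable (μ := volume) (-(T / 2)) (T / 2)
  rw [intervalIntegrable_iff_integrableOn_Ioc_of_le (by linarith)] at hII
  have e1 := intervalIntegral.norm_integral_le_integral_norm_uIoc
    (f := fun t => 2 * (f t * D t) / v t ^ 2) (a := 0) (b := z) (μ := volume)
  rw [Real.norm_eq_abs] at e1
  refine e1.trans ?_
  calc ∫ t in Set.uIoc 0 z, ‖2 * (f t * D t) / v t ^ 2‖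
      ≤ ∫ t in Set.uIoc 0 z, Real.exp (kappa w / ε * z ^ 2) * (f t ^ 2 + D t ^ 2) := by
        refine setIntegral_mono_on ?_ (hII.mono_set hsub) measurableSet_uIoc fun t ht =>
          hpt t (Set.uIoc_subset_uIcc ht)
        exact (intervalIntegrable_iff.1 (hcont.norm.intervalIntegrable 0 z))
    _ ≤ ∫ t in Set.Ioc (-(T / 2)) (T / 2),
          Real.exp (kappa w / ε * z ^ 2) * (f t ^ 2 + D t ^ 2) :=
        setIntegral_mono_set hII (Eventually.of_forall hB0) hsub.eventuallyLE
    _ = Real.exp (kappa w / ε * z ^ 2) * (1 + ∫ t in (-(T / 2))..(T / 2), D t ^ 2) := by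
        rw [← intervalIntegral.integral_of_le (by linarith), intervalIntegral.integral_const_mul,
          intervalIntegral.integral_add ((by fun_prop : Continuous _).intervalIntegrable _ _)
            ((by fun_prop : Continuous _).intervalIntegrable _ _), hnorm]
    _ ≤ _ := by
        gcongr
        exact hb.defect

end

section

variable {T : ℝ} {w : ℝ → ℝ}

/-- The change of variables `z = s y` on a period. -/
theorem integral_indicator_dilation {s T : ℝ} (hs : 0 < s) (hT : 0 < T) (g : ℝ → ℝ) :
    ∫ y, (Set.Ioc (-(T / (2 * s))) (T / (2 * s))).indicator (fun y => s * g (s * y)) y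
      = ∫ z in (-(T / 2))..(T / 2), g z := by
  rw [integral_indicator measurableSet_Ioc, ← intervalIntegral.integral_of_le (by
      have : 0 < T / (2 * s) := by positivity
      linarith), intervalIntegral.integral_const_mul,
    intervalIntegral.mul_integral_comp_mul_left]
  congr 1 <;> field_simp

/-- In the variable `z / √ε`, the function `(1 - cos (2πz/T)) / ε` tends to its quadratic model. -/
theorem tendsto_hmod_div (T y : ℝ) :
    Tendsto (fun ε => hmod T (√ε * y) / ε) (𝓝[>] (0 : ℝ))
      (𝓝 ((2 * Real.pi / T) ^ 2 / 2 * y ^ 2)) := by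
  set k := 2 * Real.pi / T with hk
  have hs0 : Tendsto (fun ε : ℝ => √ε) (𝓝[>] (0 : ℝ)) (𝓝 0) := by
    have : Tendsto (fun ε : ℝ => √ε) (𝓝 0) (𝓝 (√0)) := Real.continuous_sqrt.tendsto 0
    rw [Real.sqrt_zero] at this
    exact this.mono_left nhdsWithin_le_nhds
  rw [tendsto_iff_norm_sub_tendsto_zero]
  have hlim : Tendsto (fun ε : ℝ => 5 / 96 * |k * y| ^ 4 * ε) (𝓝[>] (0 : ℝ)) (𝓝 0) := by
    have : Tendsto (fun ε : ℝ => 5 / 96 * |k * y| ^ 4 * ε) (𝓝 0) (𝓝 (5 / 96 * |k * y| ^ 4 * 0)) :=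
      (continuous_const.mul continuous_id).tendsto 0
    rw [mul_zero] at this
    exact this.mono_left nhdsWithin_le_nhds
  refine squeeze_zero' (Eventually.of_forall fun _ => norm_nonneg _) ?_ hlim
  have hsmall : ∀ᶠ ε in 𝓝[>] (0 : ℝ), |k * (√ε * y)| ≤ 1 := by
    have h : Tendsto (fun ε : ℝ => |k * (√ε * y)|) (𝓝[>] (0 : ℝ)) (𝓝 (|k * (0 * y)|)) :=
      ((hs0.mul_const y).const_mul k).abs
    simp only [zero_mul, mul_zero, abs_zero] at h
    exact (h.eventually (gt_mem_nhds one_pos)).mono fun _ h => le_of_lt h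
  filter_upwards [self_mem_nhdsWithin, hsmall] with ε hε hsm
  have hε : 0 < ε := hε
  have hb := Real.cos_bound hsm
  have hss : √ε ^ 2 = ε := Real.sq_sqrt hε.le
  have e1 : hmod T (√ε * y) / ε - k ^ 2 / 2 * y ^ 2
      = -(Real.cos (k * (√ε * y)) - (1 - (k * (√ε * y)) ^ 2 / 2)) / ε := by
    rw [mul_pow, mul_pow, hss, hmod, ← hk]
    field_simp
    ring
  rw [e1, norm_div, norm_neg, Real.norm_eq_abs, Real.norm_eq_abs, abs_of_pos hε,
    div_le_iff₀ hε]
  refine hb.trans (le_of_eq ?_)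
  have e2 : |k * (√ε * y)| = √ε * |k * y| := by
    rw [abs_mul, abs_mul, abs_mul, abs_of_nonneg (Real.sqrt_nonneg ε)]; ring
  rw [e2, mul_pow, show √ε ^ 4 = (√ε ^ 2) ^ 2 by ring, hss]
  ring

theorem tendsto_gaussTrial_sq (hw : IsLatticeProfile T w) (y : ℝ) :
    Tendsto (fun ε => gaussTrial T w ε (√ε * y) ^ 2) (𝓝[>] (0 : ℝ))
      (𝓝 (Real.exp (-kappa w * y ^ 2))) := by
  have hT := hw.period_pos
  have hpi := Real.pi_pos
  have h := (tendsto_hmod_div T y).const_mul (-(2 * kappa w / (2 * Real.pi / T) ^ 2))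
  have h2 := (Real.continuous_exp.tendsto _).comp h
  have e : -(2 * kappa w / (2 * Real.pi / T) ^ 2) * ((2 * Real.pi / T) ^ 2 / 2 * y ^ 2)
      = -kappa w * y ^ 2 := by field_simp
  rw [e] at h2
  refine h2.congr fun ε => ?_
  rw [gaussTrial_sq, Function.comp]
  congr 1
  ring

/-- In the variable `z / √ε` the density of the ground state converges to the normalized Gaussian
density, pointwise and with an integrable majorant, so that `√ε ∫ φ⁴` converges. -/
theorem tendsto_integral_pow_four (hw : IsLatticeProfile T w) {f : ℝ → ℝ → ℝ}
    (hf : ∀ ε, 0 < ε → IsPositiveSolution T w ε (lambdaOne T w ε) (f ε))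
    (hnorm : ∀ ε, 0 < ε → ∫ z in (-(T / 2))..(T / 2), f ε z ^ 2 = 1) :
    Tendsto (fun ε => √ε * ∫ z in (-(T / 2))..(T / 2), f ε z ^ 4) (𝓝[>] (0 : ℝ))
      (𝓝 (∫ y, ((√(Real.pi / kappa w))⁻¹ * Real.exp (-kappa w * y ^ 2)) ^ 2)) := by
  have hT := hw.period_pos
  have hκ := hw.kappa_pos
  have hpi := Real.pi_pos
  obtain ⟨C, hC, hCb⟩ := exists_semiclassicalBounds hw
  obtain ⟨C', hC', hC'b⟩ := exists_sq_le hw hC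
  set Z : ℝ := √(Real.pi / kappa w) with hZ
  have hZpos : 0 < Z := by positivity
  have hs0 : Tendsto (fun ε : ℝ => √ε) (𝓝[>] (0 : ℝ)) (𝓝 0) := by
    have : Tendsto (fun ε : ℝ => √ε) (𝓝 0) (𝓝 (√0)) := Real.continuous_sqrt.tendsto 0
    rw [Real.sqrt_zero] at this
    exact this.mono_left nhdsWithin_le_nhds
  have hgood : ∀ᶠ ε in 𝓝[>] (0 : ℝ), 0 < ε ∧ ε ≤ 1 ∧ ε ≤ (T / 2) ^ 2 := by
    have h1 : Set.Ioo (0 : ℝ) (min 1 ((T / 2) ^ 2)) ∈ 𝓝[>] (0 : ℝ) :=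
      Ioo_mem_nhdsGT (by positivity)
    filter_upwards [h1] with ε hε
    exact ⟨hε.1, hε.2.le.trans (min_le_left _ _), hε.2.le.trans (min_le_right _ _)⟩
  -- in the variable `y = z / √ε`: `S` is the period, `F` the density of the ground state, `G` the
  -- square of the periodic Gaussian, both extended by zero, and `b` the value of `F` at `0`
  set S : ℝ → Set ℝ := fun ε => Set.Ioc (-(T / (2 * √ε))) (T / (2 * √ε)) with hS
  set F : ℝ → ℝ → ℝ := fun ε => (S ε).indicator fun y => √ε * f ε (√ε * y) ^ 2 with hF
  set G : ℝ → ℝ → ℝ := fun ε => (S ε).indicator fun y => gaussTrial T w ε (√ε * y) ^ 2 with hG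
  set b : ℝ → ℝ := fun ε => √ε * f ε 0 ^ 2 with hb
  have hSmem : ∀ ε, 0 < ε → ∀ y ∈ S ε, |√ε * y| ≤ T / 2 := by
    intro ε hε y hy
    have hspos : 0 < √ε := Real.sqrt_pos.2 hε
    rw [abs_mul, abs_of_pos hspos]
    have : |y| ≤ T / (2 * √ε) := abs_le.2 ⟨hy.1.le, hy.2⟩
    calc √ε * |y| ≤ √ε * (T / (2 * √ε)) := by gcongr
      _ = T / 2 := by field_simp
  have hSev : ∀ y, ∀ᶠ ε in 𝓝[>] (0 : ℝ), y ∈ S ε := by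
    intro y
    have h : ∀ᶠ ε in 𝓝[>] (0 : ℝ), √ε * (2 * |y| + 1) < T := by
      have h := hs0.mul_const (2 * |y| + 1)
      rw [zero_mul] at h
      exact h.eventually (gt_mem_nhds hT)
    filter_upwards [h, self_mem_nhdsWithin] with ε h1 hε
    have hspos : 0 < √ε := Real.sqrt_pos.2 hε
    have h2 : |y| < T / (2 * √ε) := by
      rw [lt_div_iff₀ (by positivity)]
      nlinarith
    exact ⟨(abs_lt.1 h2).1, (abs_lt.1 h2).2.le⟩
  have hFmeas : ∀ ε, 0 < ε → AEStronglyMeasurable (F ε) volume := by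
    intro ε hε
    have := (hf ε hε).contDiff.continuous
    exact (by fun_prop : Continuous fun y => √ε * f ε (√ε * y) ^ 2).aestronglyMeasurable.indicator
      measurableSet_Ioc
  have hGmeas : ∀ ε, AEStronglyMeasurable (G ε) volume := fun ε =>
    (by fun_prop : Continuous fun y => gaussTrial T w ε (√ε * y) ^ 2).aestronglyMeasurable.indicator
      measurableSet_Ioc
  have hF0 : ∀ ε y, 0 ≤ F ε y := fun ε y => Set.indicator_nonneg (fun _ _ => by positivity) y
  have hG0 : ∀ ε y, 0 ≤ G ε y := fun ε y => Set.indicator_nonneg (fun _ _ => by positivity) y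
  have hFle : ∀ ε, 0 < ε → ε ≤ 1 → ε ≤ (T / 2) ^ 2 → ∀ y,
      F ε y ≤ C' ∧ F ε y ≤ 2 * C' * (1 + y ^ 2)⁻¹ := by
    intro ε hε hε1 hεT y
    by_cases hy : y ∈ S ε
    · have hspos : 0 < √ε := Real.sqrt_pos.2 hε
      obtain ⟨h1, h2⟩ := hC'b ε hε hε1 _ _ (hf ε hε) (hnorm ε hε)
        (hCb ε hε hε1 hεT _ _ (hf ε hε) (hnorm ε hε)) _ (hSmem ε hε y hy)
      have e : F ε y = √ε * f ε (√ε * y) ^ 2 := Set.indicator_of_mem hy _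
      rw [e]
      refine ⟨h1, ?_⟩
      rw [← div_eq_mul_inv, le_div_iff₀ (by positivity)]
      have h3 : √ε * (y ^ 2 * (√ε * f ε (√ε * y) ^ 2)) ≤ √ε * C' := by
        calc _ = (√ε * y) ^ 2 * f ε (√ε * y) ^ 2 := by ring
          _ ≤ C' * √ε := h2
          _ = _ := mul_comm _ _
      have h4 := le_of_mul_le_mul_left h3 hspos
      linarith
    · have e : F ε y = 0 := Set.indicator_of_notMem hy _
      rw [e]
      exact ⟨hC'.le, by positivity⟩
  have hGle : ∀ ε, 0 < ε → ∀ y, G ε y ≤ Real.exp (-(4 * kappa w / Real.pi ^ 2) * y ^ 2) := by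
    intro ε hε y
    by_cases hy : y ∈ S ε
    · have e : G ε y = gaussTrial T w ε (√ε * y) ^ 2 := Set.indicator_of_mem hy _
      rw [e]
      refine (gaussTrial_sq_le hw hε (hSmem ε hε y hy)).trans (le_of_eq ?_)
      rw [mul_pow, Real.sq_sqrt hε.le]
      congr 1
      field_simp
    · have e : G ε y = 0 := Set.indicator_of_notMem hy _
      rw [e]
      exact (Real.exp_pos _).le
  have hb0 : ∀ ε, 0 ≤ b ε := fun ε => by positivity
  have hble : ∀ ε, 0 < ε → ε ≤ 1 → ε ≤ (T / 2) ^ 2 → b ε ≤ C' := by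
    intro ε hε hε1 hεT
    exact (hC'b ε hε hε1 _ _ (hf ε hε) (hnorm ε hε)
        (hCb ε hε hε1 hεT _ _ (hf ε hε) (hnorm ε hε)) 0 (by rw [abs_zero]; positivity)).1
  have hIexp : ∀ c : ℝ, 0 < c → Integrable fun y : ℝ => Real.exp (-c * y ^ 2) := fun c hc =>
    integrable_exp_neg_mul_sq hc
  have hcpos : 0 < 4 * kappa w / Real.pi ^ 2 := by positivity
  have hFint : ∀ ε, 0 < ε → ε ≤ 1 → ε ≤ (T / 2) ^ 2 → Integrable (F ε) := by
    intro ε hε hε1 hεT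
    refine (integrable_inv_one_add_sq.const_mul (2 * C')).mono' (hFmeas ε hε)
      (Eventually.of_forall fun y => ?_)
    rw [Real.norm_eq_abs, abs_of_nonneg (hF0 ε y)]
    exact (hFle ε hε hε1 hεT y).2
  have hGint : ∀ ε, 0 < ε → Integrable (G ε) := by
    intro ε hε
    refine (hIexp _ hcpos).mono' (hGmeas ε) (Eventually.of_forall fun y => ?_)
    rw [Real.norm_eq_abs, abs_of_nonneg (hG0 ε y)]
    exact hGle ε hε y
  have hGlim : ∀ y, Tendsto (fun ε => G ε y) (𝓝[>] (0 : ℝ)) (𝓝 (Real.exp (-kappa w * y ^ 2))) := by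
    intro y
    refine (tendsto_gaussTrial_sq hw y).congr' ?_
    filter_upwards [hSev y] with ε hy
    exact (Set.indicator_of_mem hy fun y => gaussTrial T w ε (√ε * y) ^ 2).symm
  have hGlimI : Tendsto (fun ε => ∫ y, G ε y) (𝓝[>] (0 : ℝ)) (𝓝 Z) := by
    have h := tendsto_integral_filter_of_dominated_convergence (l := 𝓝[>] (0 : ℝ)) (F := G)
      (f := fun y => Real.exp (-kappa w * y ^ 2))
      (fun y => Real.exp (-(4 * kappa w / Real.pi ^ 2) * y ^ 2)) (Eventually.of_forall hGmeas)
      (hgood.mono fun ε hε => Eventually.of_forall fun y => by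
        rw [Real.norm_eq_abs, abs_of_nonneg (hG0 ε y)]
        exact hGle ε hε.1 y) (hIexp _ hcpos) (Eventually.of_forall hGlim)
    rwa [integral_gaussian] at h
  -- the density is asymptotically a multiple of the Gaussian
  have hHlim : ∀ y, Tendsto (fun ε => F ε y - b ε * G ε y) (𝓝[>] (0 : ℝ)) (𝓝 0) := by
    intro y
    have hlim := hs0.mul_const (Real.exp (kappa w * y ^ 2) * (1 + C))
    rw [zero_mul] at hlim
    refine squeeze_zero_norm' ?_ hlim
    filter_upwards [hSev y, hgood] with ε hy hε
    obtain ⟨hε, hε1, hεT⟩ := hε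
    have hq := abs_quotient_sub_le hw hε (hf ε hε) (hnorm ε hε)
      (hCb ε hε hε1 hεT _ _ (hf ε hε) (hnorm ε hε)) (hSmem ε hε y hy)
    have e1 : F ε y = √ε * f ε (√ε * y) ^ 2 := Set.indicator_of_mem hy _
    have e2 : G ε y = gaussTrial T w ε (√ε * y) ^ 2 := Set.indicator_of_mem hy _
    have e3 : gaussTrial T w ε 0 = 1 := by simp [gaussTrial, hmod_zero]
    have hv := gaussTrial_pos T w ε (√ε * y)
    rw [e3, one_pow, div_one] at hq
    have hG1 : G ε y ≤ 1 := (hGle ε hε y).trans (by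
      rw [Real.exp_le_one_iff]
      nlinarith [mul_nonneg hcpos.le (sq_nonneg y)])
    have e4 : F ε y - b ε * G ε y = √ε * (f ε (√ε * y) ^ 2 / gaussTrial T w ε (√ε * y) ^ 2
        - f ε 0 ^ 2) * G ε y := by
      rw [e1, e2, hb]
      field_simp
    have e5 : kappa w / ε * (√ε * y) ^ 2 = kappa w * y ^ 2 := by
      rw [mul_pow, Real.sq_sqrt hε.le]; field_simp
    rw [e5] at hq
    rw [e4, norm_mul, norm_mul, Real.norm_eq_abs, Real.norm_eq_abs, Real.norm_eq_abs,
      abs_of_nonneg (Real.sqrt_nonneg ε), abs_of_nonneg (hG0 ε y)]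
    calc _ ≤ √ε * (Real.exp (kappa w * y ^ 2) * (1 + C)) * 1 := by
          gcongr
          exact hG0 ε y
      _ = _ := mul_one _
  have hHlimI : Tendsto (fun ε => ∫ y, (F ε y - b ε * G ε y)) (𝓝[>] (0 : ℝ)) (𝓝 0) := by
    have h := tendsto_integral_filter_of_dominated_convergence (l := 𝓝[>] (0 : ℝ))
      (F := fun ε y => F ε y - b ε * G ε y) (f := fun _ => (0 : ℝ))
      (fun y => 2 * C' * (1 + y ^ 2)⁻¹ + C' * Real.exp (-(4 * kappa w / Real.pi ^ 2) * y ^ 2))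
      (hgood.mono fun ε hε => (hFmeas ε hε.1).sub ((hGmeas ε).const_mul _))
      (hgood.mono fun ε hε => Eventually.of_forall fun y => by
        obtain ⟨hε, hε1, hεT⟩ := hε
        refine (norm_sub_le _ _).trans ?_
        rw [norm_mul, Real.norm_eq_abs, Real.norm_eq_abs, Real.norm_eq_abs,
          abs_of_nonneg (hF0 ε y), abs_of_nonneg (hG0 ε y), abs_of_nonneg (hb0 ε)]
        exact add_le_add (hFle ε hε hε1 hεT y).2
          (mul_le_mul (hble ε hε hε1 hεT) (hGle ε hε y) (hG0 ε y) hC'.le))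
      ((integrable_inv_one_add_sq.const_mul _).add ((hIexp _ hcpos).const_mul _))
      (Eventually.of_forall hHlim)
    simpa using h
  -- the normalization `∫ F = 1` determines the limit of `b`
  have hbG : Tendsto (fun ε => b ε * ∫ y, G ε y) (𝓝[>] (0 : ℝ)) (𝓝 1) := by
    have h := hHlimI.const_sub 1
    rw [sub_zero] at h
    refine h.congr' ?_
    filter_upwards [hgood] with ε hε
    obtain ⟨hε, hε1, hεT⟩ := hε
    have e : ∫ y, F ε y = 1 := by
      rw [← hnorm ε hε]
      exact integral_indicator_dilation (Real.sqrt_pos.2 hε) hT (fun z => f ε z ^ 2)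
    rw [integral_sub (hFint ε hε hε1 hεT) ((hGint ε hε).const_mul _), e, integral_const_mul]
    ring
  have hblim : Tendsto b (𝓝[>] (0 : ℝ)) (𝓝 Z⁻¹) := by
    have h := hbG.div hGlimI hZpos.ne'
    rw [one_div] at h
    refine h.congr' ?_
    have hev : ∀ᶠ ε in 𝓝[>] (0 : ℝ), 0 < ∫ y, G ε y := hGlimI.eventually (lt_mem_nhds hZpos)
    filter_upwards [hev] with ε hε
    simp only [Pi.div_apply]
    field_simp
  have hFlim : ∀ y, Tendsto (fun ε => F ε y) (𝓝[>] (0 : ℝ))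
      (𝓝 (Z⁻¹ * Real.exp (-kappa w * y ^ 2))) := by
    intro y
    have h := (hHlim y).add (hblim.mul (hGlim y))
    simpa using h
  have hfin := tendsto_integral_filter_of_dominated_convergence (l := 𝓝[>] (0 : ℝ))
    (F := fun ε y => F ε y ^ 2) (f := fun y => (Z⁻¹ * Real.exp (-kappa w * y ^ 2)) ^ 2)
    (fun y => C' * (2 * C' * (1 + y ^ 2)⁻¹))
    (hgood.mono fun ε hε => (hFmeas ε hε.1).pow 2)
    (hgood.mono fun ε hε => Eventually.of_forall fun y => by
      obtain ⟨hε, hε1, hεT⟩ := hε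
      rw [Real.norm_eq_abs, abs_of_nonneg (sq_nonneg _), sq]
      have := hFle ε hε hε1 hεT y
      exact mul_le_mul this.1 this.2 (hF0 ε y) hC'.le)
    ((integrable_inv_one_add_sq.const_mul _).const_mul _)
    (Eventually.of_forall fun y => (hFlim y).pow 2)
  refine hfin.congr' ?_
  filter_upwards [hgood] with ε hε
  rw [← intervalIntegral.integral_const_mul,
    ← integral_indicator_dilation (Real.sqrt_pos.2 hε.1) hT (fun z => √ε * f ε z ^ 4)]
  congr 1
  funext y
  by_cases hy : y ∈ S ε
  · have e1 : F ε y = √ε * f ε (√ε * y) ^ 2 := Set.indicator_of_mem hy _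
    rw [e1, Set.indicator_of_mem hy]
    ring
  · have e1 : F ε y = 0 := Set.indicator_of_notMem hy _
    rw [e1, Set.indicator_of_notMem hy]
    simp

theorem integral_gaussian_density_sq_pos {κ : ℝ} (hκ : 0 < κ) :
    0 < ∫ y : ℝ, ((√(Real.pi / κ))⁻¹ * Real.exp (-κ * y ^ 2)) ^ 2 := by
  have hpi := Real.pi_pos
  have e : ∀ y : ℝ, ((√(Real.pi / κ))⁻¹ * Real.exp (-κ * y ^ 2)) ^ 2
      = (√(Real.pi / κ))⁻¹ ^ 2 * Real.exp (-(2 * κ) * y ^ 2) := by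
    intro y
    rw [mul_pow, ← Real.exp_nat_mul]
    congr 2
    push_cast
    ring
  simp_rw [e]
  rw [integral_const_mul, integral_gaussian]
  positivity

end

/-! ### Mollification of weakly differentiable functions -/

instance isAddHaarMeasure_volume_space : (volume : Measure (ℝ × ℝ × ℝ)).IsAddHaarMeasure :=
  have : (volume : Measure (ℝ × ℝ)).IsAddHaarMeasure := Measure.prod.instIsAddHaarMeasure _ _
  Measure.prod.instIsAddHaarMeasure _ _

open ContinuousLinearMap in
/-- The mollification `x ↦ ∫ ρ(x - t) u(t) dt`. -/
noncomputable def mollify (ρ : ℝ × ℝ × ℝ → ℝ) (u : ℝ × ℝ × ℝ → ℂ) : ℝ × ℝ × ℝ → ℂ :=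
  convolution u ρ (lsmul ℝ ℝ : ℝ →L[ℝ] ℂ →L[ℝ] ℂ).flip volume

theorem mollify_apply (ρ : ℝ × ℝ × ℝ → ℝ) (u : ℝ × ℝ × ℝ → ℂ) (x : ℝ × ℝ × ℝ) :
    mollify ρ u x = ∫ t, ρ (x - t) • u t := rfl

theorem mollify_apply' (ρ : ℝ × ℝ × ℝ → ℝ) (u : ℝ × ℝ × ℝ → ℂ) (x : ℝ × ℝ × ℝ) :
    mollify ρ u x = ∫ t, ρ t • u (x - t) := by
  rw [mollify_apply, ← integral_sub_left_eq_self (fun t => ρ t • u (x - t)) volume x]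
  simp

theorem contDiff_mollify {ρ : ℝ × ℝ × ℝ → ℝ} (hρ : ContDiff ℝ ∞ ρ) (hρc : HasCompactSupport ρ)
    {u : ℝ × ℝ × ℝ → ℂ} (hu : LocallyIntegrable u volume) : ContDiff ℝ ∞ (mollify ρ u) :=
  hρc.contDiff_convolution_right _ hu hρ

/-- Mollification commutes with weak derivatives. -/
theorem HasWeakDeriv.fderiv_mollify {e : ℝ × ℝ × ℝ} {u u' : ℝ × ℝ × ℝ → ℂ}
    (h : HasWeakDeriv e u u') {ρ : ℝ × ℝ × ℝ → ℝ} (hρ : ContDiff ℝ ∞ ρ)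
    (hρc : HasCompactSupport ρ) (x : ℝ × ℝ × ℝ) :
    fderiv ℝ (mollify ρ u) x e = mollify ρ u' x := by
  have h1 := hρc.hasFDerivAt_convolution_right
    (ContinuousLinearMap.lsmul ℝ ℝ : ℝ →L[ℝ] ℂ →L[ℝ] ℂ).flip h.locallyIntegrable
    (hρ.of_le (by exact_mod_cast le_top)) x
  have h2 : fderiv ℝ (mollify ρ u) x = _ := h1.fderiv
  rw [h2, convolution_precompR_apply _ h.locallyIntegrable (hρc.fderiv ℝ)
    (hρ.continuous_fderiv (by simp))]
  have hθ : ContDiff ℝ ∞ fun t => ρ (x - t) := hρ.comp (contDiff_const.sub contDiff_id)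
  have hθc : HasCompactSupport fun t => ρ (x - t) :=
    hρc.comp_homeomorph (Homeomorph.subLeft x)
  have h3 := h.integral_eq _ hθ hθc
  have h4 : ∀ t, fderiv ℝ (fun t => ρ (x - t)) t e = -(fderiv ℝ ρ (x - t) e) := by
    intro t
    have hd : HasFDerivAt (fun t => x - t) (-(ContinuousLinearMap.id ℝ (ℝ × ℝ × ℝ))) t :=
      (hasFDerivAt_id t).const_sub x
    have := ((hρ.differentiable (by simp) (x - t)).hasFDerivAt.comp t hd).fderiv
    change fderiv ℝ (ρ ∘ fun t => x - t) t e = _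
    rw [this]
    simp
  simp_rw [h4, neg_smul] at h3
  rw [integral_neg, neg_inj] at h3
  rw [mollify_apply, ← h3]
  rfl

/-- Bump functions with supports shrinking to `0`. -/
noncomputable def mollifierBump (n : ℕ) : ContDiffBump (0 : ℝ × ℝ × ℝ) where
  rIn := 1 / (2 * (n + 1))
  rOut := 1 / (n + 1)
  rIn_pos := by positivity
  rIn_lt_rOut := by
    have : (0 : ℝ) < n + 1 := by positivity
    rw [div_lt_div_iff₀ (by positivity) (by positivity)]
    linarith

/-- The mollifier supported in the ball of radius `1 / (n + 1)`, of integral `1`. -/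
noncomputable def mollifier (n : ℕ) : ℝ × ℝ × ℝ → ℝ := (mollifierBump n).normed volume

theorem contDiff_mollifier (n : ℕ) : ContDiff ℝ ∞ (mollifier n) :=
  (mollifierBump n).contDiff_normed

theorem hasCompactSupport_mollifier (n : ℕ) : HasCompactSupport (mollifier n) :=
  (mollifierBump n).hasCompactSupport_normed

theorem mollifier_eq_zero (n : ℕ) {t : ℝ × ℝ × ℝ} (ht : 1 < ‖t‖) : mollifier n t = 0 := by
  by_contra hne
  have h : t ∈ Function.support ((mollifierBump n).normed volume) := hne
  rw [ContDiffBump.support_normed_eq] at h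
  have h1 : ‖t‖ < (mollifierBump n).rOut := by simpa using h
  change ‖t‖ < 1 / ((n : ℝ) + 1) at h1
  have h2 : 1 / ((n : ℝ) + 1) ≤ 1 := by
    rw [div_le_one (by positivity)]
    have : (0 : ℝ) ≤ n := by positivity
    linarith
  linarith

theorem tendsto_integral_mollifier {g : ℝ × ℝ × ℝ → ℝ} (hg : Continuous g) :
    Tendsto (fun n => ∫ t, mollifier n t * g t) atTop (𝓝 (g 0)) := by
  have hφ : Tendsto (fun n => (mollifierBump n).rOut) atTop (𝓝 0) :=
    tendsto_one_div_add_atTop_nhds_zero_nat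
  have hg' : Continuous fun t => g (-t) := hg.comp continuous_neg
  have h := ContDiffBump.convolution_tendsto_right_of_continuous (μ := volume) hφ hg' 0
  rw [neg_zero] at h
  refine h.congr fun n => ?_
  simp [convolution, mollifier]

/-- `L²` pairings of translates depend continuously on the translation. -/
theorem continuous_integral_inner_translate {h f : ℝ × ℝ × ℝ → ℂ} (hh : MemLp h 2 volume)
    (hf : MemLp f 2 volume) : Continuous fun t => ∫ x, inner ℝ (h x) (f (x - t)) := by
  have hmp : ∀ t : ℝ × ℝ × ℝ, MeasurePreserving (fun x => x - t) volume volume := fun t =>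
    measurePreserving_sub_right volume t
  let τ : ℝ × ℝ × ℝ → C(ℝ × ℝ × ℝ, ℝ × ℝ × ℝ) := fun t => ⟨fun x => x - t, by fun_prop⟩
  have hτ : Continuous τ := ContinuousMap.continuous_of_continuous_uncurry _ (by
    change Continuous fun p : (ℝ × ℝ × ℝ) × (ℝ × ℝ × ℝ) => p.2 - p.1
    fun_prop)
  have hc : Continuous fun t => Lp.compMeasurePreserving (τ t) (hmp t) (hf.toLp f) :=
    Continuous.compMeasurePreservingLp continuous_const hτ hmp (by norm_num)
  have hi : Continuous fun t => inner ℝ (hh.toLp h)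
      (Lp.compMeasurePreserving (τ t) (hmp t) (hf.toLp f)) := continuous_const.inner hc
  convert! hi using 2 with t
  rw [L2.inner_def]
  refine integral_congr_ae ?_
  have e1 := hh.coeFn_toLp
  have e2 := Lp.coeFn_compMeasurePreserving (hf.toLp f) (hmp t)
  have e3 := (hmp t).quasiMeasurePreserving.ae_eq_comp hf.coeFn_toLp
  filter_upwards [e1, e2, e3] with x h1 h2 h3
  have h4 : (Lp.compMeasurePreserving (τ t) (hmp t) (hf.toLp f)) x = f (x - t) := by
    change (Lp.compMeasurePreserving (fun x => x - t) (hmp t) (hf.toLp f)) x = _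
    rw [h2]
    exact h3
  rw [h1, h4]

theorem integral_inner_mollify {h f : ℝ × ℝ × ℝ → ℂ} (hh : MemLp h 2 volume)
    (hf : MemLp f 2 volume) {ρ : ℝ × ℝ × ℝ → ℝ} (hρ : Continuous ρ) (hρc : HasCompactSupport ρ) :
    ∫ x, inner ℝ (h x) (mollify ρ f x) = ∫ t, ρ t * ∫ x, inner ℝ (h x) (f (x - t)) := by
  have hfl : LocallyIntegrable f volume := hf.locallyIntegrable (by norm_num)
  have hρi : Integrable ρ volume := hρ.integrable_of_hasCompactSupport hρc
  have hex : ∀ x, Integrable (fun t => ρ t • f (x - t)) volume := fun x =>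
    (hρc.convolutionExists_left (ContinuousLinearMap.lsmul ℝ ℝ : ℝ →L[ℝ] ℂ →L[ℝ] ℂ) hρ hfl) x
  have hmeas : AEStronglyMeasurable
      (fun p : (ℝ × ℝ × ℝ) × (ℝ × ℝ × ℝ) => ρ p.2 • f (p.1 - p.2)) (volume.prod volume) :=
    hρ.aestronglyMeasurable.convolution_integrand
      (ContinuousLinearMap.lsmul ℝ ℝ : ℝ →L[ℝ] ℂ →L[ℝ] ℂ) hf.1
  have hint : Integrable (Function.uncurry fun x t => inner ℝ (h x) (ρ t • f (x - t)))
      (volume.prod volume) := by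
    have i1 : Integrable (fun p : (ℝ × ℝ × ℝ) × (ℝ × ℝ × ℝ) => ‖h p.1‖ ^ 2 * |ρ p.2|)
        (volume.prod volume) := (hh.integrable_norm_pow (by norm_num)).mul_prod hρi.abs
    have i2 : Integrable (fun p : (ℝ × ℝ × ℝ) × (ℝ × ℝ × ℝ) => |ρ p.2| * ‖f (p.1 - p.2)‖ ^ 2)
        (volume.prod volume) :=
      hρi.abs.convolution_integrand (ContinuousLinearMap.mul ℝ ℝ)
        (hf.integrable_norm_pow (by norm_num))
    refine (i1.add i2).mono' (hh.1.comp_fst.inner hmeas) (Eventually.of_forall fun p => ?_)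
    simp only [Function.uncurry, Pi.add_apply]
    refine (norm_inner_le_norm _ _).trans ?_
    rw [norm_smul, Real.norm_eq_abs]
    nlinarith [mul_nonneg (abs_nonneg (ρ p.2)) (sq_nonneg (‖h p.1‖ - ‖f (p.1 - p.2)‖)),
      mul_nonneg (abs_nonneg (ρ p.2)) (sq_nonneg ‖h p.1‖),
      mul_nonneg (abs_nonneg (ρ p.2)) (sq_nonneg ‖f (p.1 - p.2)‖)]
  calc ∫ x, inner ℝ (h x) (mollify ρ f x) = ∫ x, ∫ t, inner ℝ (h x) (ρ t • f (x - t)) := by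
        refine integral_congr_ae (Eventually.of_forall fun x => ?_)
        simp only
        rw [mollify_apply', integral_inner (hex x)]
    _ = ∫ t, ∫ x, inner ℝ (h x) (ρ t • f (x - t)) := integral_integral_swap hint
    _ = _ := by
        refine integral_congr_ae (Eventually.of_forall fun t => ?_)
        simp only [inner_smul_right]
        rw [integral_const_mul]

theorem tendsto_integral_inner_mollify {h f : ℝ × ℝ × ℝ → ℂ} (hh : MemLp h 2 volume)
    (hf : MemLp f 2 volume) :
    Tendsto (fun n => ∫ x, inner ℝ (h x) (mollify (mollifier n) f x)) atTop
      (𝓝 (∫ x, inner ℝ (h x) (f x))) := by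
  have h1 := tendsto_integral_mollifier (continuous_integral_inner_translate hh hf)
  simp only [sub_zero] at h1
  refine h1.congr fun n => ?_
  rw [integral_inner_mollify hh hf (contDiff_mollifier n).continuous
    (hasCompactSupport_mollifier n)]

/-- Square integrability on compact sets. -/
def LocallyL2 (f : ℝ × ℝ × ℝ → ℂ) : Prop :=
  ∀ K : Set (ℝ × ℝ × ℝ), IsCompact K → MemLp f 2 (volume.restrict K)

theorem LocallyL2.memLp_smul {f : ℝ × ℝ × ℝ → ℂ} (hf : LocallyL2 f) {θ : ℝ × ℝ × ℝ → ℝ}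
    (hθ : Continuous θ) (hθc : HasCompactSupport θ) : MemLp (fun p => θ p • f p) 2 volume := by
  obtain ⟨C, hC⟩ := hθ.bounded_above_of_compact_support hθc
  have hK : IsCompact (tsupport θ) := hθc
  have e : (fun p => θ p • f p) = (tsupport θ).indicator (fun p => θ p • f p) := by
    symm
    rw [Set.indicator_eq_self]
    intro p hp
    apply subset_tsupport
    intro h0
    exact hp (by simp [h0])
  rw [e, memLp_indicator_iff_restrict hK.measurableSet]
  have hfK := hf _ hK
  refine hfK.of_le_mul (c := C) (hθ.aestronglyMeasurable.smul hfK.1)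
    (Eventually.of_forall fun p => ?_)
  rw [norm_smul]
  gcongr
  exact hC p

/-- Mollifications converge weakly in `L²` on compact sets. -/
theorem LocallyL2.tendsto_integral_inner_mollify {f : ℝ × ℝ × ℝ → ℂ} (hf : LocallyL2 f)
    {h : ℝ × ℝ × ℝ → ℂ} (hh : MemLp h 2 volume) {K : Set (ℝ × ℝ × ℝ)} (hK : IsCompact K)
    (hhK : ∀ p, p ∉ K → h p = 0) :
    Tendsto (fun n => ∫ x, inner ℝ (h x) (mollify (mollifier n) f x)) atTop
      (𝓝 (∫ x, inner ℝ (h x) (f x))) := by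
  -- only the values of `f` within distance `1` of `K` matter
  set K' := Metric.cthickening 1 K with hK'
  have hK'c : IsCompact K' := hK.cthickening
  have hf' : MemLp (K'.indicator f) 2 volume :=
    (memLp_indicator_iff_restrict hK'c.measurableSet).2 (hf _ hK'c)
  have h1 := OpticalLattice.tendsto_integral_inner_mollify hh hf'
  have e1 : ∫ x, inner ℝ (h x) (K'.indicator f x) = ∫ x, inner ℝ (h x) (f x) := by
    congr 1
    funext x
    by_cases hx : x ∈ K
    · rw [Set.indicator_of_mem (Metric.self_subset_cthickening K hx)]
    · rw [hhK x hx, inner_zero_left, inner_zero_left]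
  rw [e1] at h1
  refine h1.congr fun n => ?_
  congr 1
  funext x
  by_cases hx : x ∈ K
  · congr 1
    rw [mollify_apply', mollify_apply']
    congr 1
    funext t
    by_cases ht : 1 < ‖t‖
    · rw [mollifier_eq_zero n ht, zero_smul, zero_smul]
    · rw [Set.indicator_of_mem]
      refine Metric.mem_cthickening_of_dist_le _ x _ _ hx ?_
      rw [dist_eq_norm]
      simpa using not_lt.1 ht
  · rw [hhK x hx, inner_zero_left, inner_zero_left]

/-! ### Integration by parts in Sobolev spaces -/

/-- The weak derivative may be tested against complex functions, with the real inner product. -/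
theorem HasWeakDeriv.integral_inner_eq {e : ℝ × ℝ × ℝ} {u u' : ℝ × ℝ × ℝ → ℂ}
    (h : HasWeakDeriv e u u') {φ : ℝ × ℝ × ℝ → ℂ} (hφ : ContDiff ℝ ∞ φ)
    (hφc : HasCompactSupport φ) :
    ∫ p, inner ℝ (fderiv ℝ φ p e) (u p) = -∫ p, inner ℝ (φ p) (u' p) := by
  have key : ∀ L : ℂ →L[ℝ] ℝ, ∫ p, L (fderiv ℝ φ p e) * L (u p) = -∫ p, L (φ p) * L (u' p) ∧
      Integrable (fun p => L (fderiv ℝ φ p e) * L (u p)) ∧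
      Integrable (fun p => L (φ p) * L (u' p)) := by
    intro L
    have hθ : ContDiff ℝ ∞ fun p => L (φ p) := L.contDiff.comp hφ
    have hθc : HasCompactSupport fun p => L (φ p) := hφc.comp_left (map_zero L)
    have hd : ∀ p, fderiv ℝ (fun p => L (φ p)) p e = L (fderiv ℝ φ p e) := by
      intro p
      have := (L.hasFDerivAt.comp p (hφ.differentiable (by simp) p).hasFDerivAt).fderiv
      change fderiv ℝ (L ∘ φ) p e = _
      rw [this]
      rfl
    have h1 := h.integral_eq _ hθ hθc
    simp_rw [hd] at h1
    have hdc : Continuous fun p => L (fderiv ℝ φ p e) :=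
      L.continuous.comp ((hφ.continuous_fderiv (by simp)).clm_apply continuous_const)
    have hdcs : HasCompactSupport fun p => L (fderiv ℝ φ p e) :=
      (hφc.fderiv_apply ℝ e).comp_left (map_zero L)
    have i1 : Integrable (fun p => L (fderiv ℝ φ p e) • u p) :=
      h.locallyIntegrable.integrable_smul_left_of_hasCompactSupport hdc hdcs
    have i2 : Integrable (fun p => L (φ p) • u' p) :=
      h.locallyIntegrable_deriv.integrable_smul_left_of_hasCompactSupport hθ.continuous hθc
    have h2 := congrArg L h1
    rw [map_neg, ← L.integral_comp_comm i1, ← L.integral_comp_comm i2] at h2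
    simp only [map_smul, smul_eq_mul] at h2
    refine ⟨h2, ?_, ?_⟩
    · have h3 := L.integrable_comp i1
      simp only [map_smul, smul_eq_mul] at h3
      exact h3
    · have h3 := L.integrable_comp i2
      simp only [map_smul, smul_eq_mul] at h3
      exact h3
  obtain ⟨hr, hr1, hr2⟩ := key Complex.reCLM
  obtain ⟨hi, hi1, hi2⟩ := key Complex.imCLM
  have e1 : ∀ a b : ℂ, inner ℝ a b = Complex.reCLM a * Complex.reCLM b
      + Complex.imCLM a * Complex.imCLM b := by
    intro a b
    rw [Complex.inner]
    simp
    ring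
  simp_rw [e1]
  rw [integral_add hr1 hi1, integral_add hr2 hi2, hr, hi]
  ring

theorem integrable_inner_of_memLp {α : Type*} [MeasurableSpace α] {μ : Measure α} {f g : α → ℂ}
    (hf : MemLp f 2 μ) (hg : MemLp g 2 μ) : Integrable (fun p => inner ℝ (f p) (g p)) μ := by
  refine ((hf.integrable_norm_pow (p := 2) (by norm_num)).add
    (hg.integrable_norm_pow (p := 2) (by norm_num))).mono' (hf.1.inner hg.1)
    (Eventually.of_forall fun p => ?_)
  refine (norm_inner_le_norm _ _).trans ?_
  simp only [Pi.add_apply]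
  nlinarith [sq_nonneg (‖f p‖ - ‖g p‖), sq_nonneg (‖f p‖), sq_nonneg ‖g p‖]

theorem integrable_inner_of_hasCompactSupport {g u : ℝ × ℝ × ℝ → ℂ} (hg : Continuous g)
    (hgc : HasCompactSupport g) (hu : LocallyIntegrable u volume) :
    Integrable (fun p => inner ℝ (g p) (u p)) := by
  have h1 : Integrable (fun p => ‖g p‖ • u p) :=
    hu.integrable_smul_left_of_hasCompactSupport hg.norm hgc.norm
  refine h1.norm.mono' (hg.aestronglyMeasurable.inner hu.aestronglyMeasurable)
    (Eventually.of_forall fun p => ?_)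
  refine (norm_inner_le_norm _ _).trans ?_
  rw [norm_smul, norm_norm]

section

variable {θ : ℝ × ℝ × ℝ → ℝ}

theorem continuous_fderiv_apply_of_contDiff (hθ : ContDiff ℝ ∞ θ) (e : ℝ × ℝ × ℝ) :
    Continuous fun p => fderiv ℝ θ p e :=
  (hθ.continuous_fderiv (by simp)).clm_apply continuous_const

theorem LocallyL2.tendsto_smul {f u : ℝ × ℝ × ℝ → ℂ} (hf : LocallyL2 f) (hu : LocallyL2 u)
    {η : ℝ × ℝ × ℝ → ℝ} (hη : Continuous η) (hηc : HasCompactSupport η) :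
    Tendsto (fun n => ∫ x, inner ℝ (η x • u x) (mollify (mollifier n) f x)) atTop
      (𝓝 (∫ x, inner ℝ (η x • u x) (f x))) :=
  hf.tendsto_integral_inner_mollify (hu.memLp_smul hη hηc) (K := tsupport η) hηc
    fun p hp => by rw [image_eq_zero_of_notMem_tsupport hp, zero_smul]

/-- The weak product rule `∂ₑ |u|² = 2 Re (ū ∂ₑu)`: one of the two factors is mollified, which makes
it admissible in a test function. -/
theorem HasWeakDeriv.integral_fderiv_mul_norm_sq {e : ℝ × ℝ × ℝ} {u u' : ℝ × ℝ × ℝ → ℂ}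
    (h : HasWeakDeriv e u u') (hu : LocallyL2 u) (hu' : LocallyL2 u')
    (hθ : ContDiff ℝ ∞ θ) (hθc : HasCompactSupport θ) :
    ∫ p, fderiv ℝ θ p e * ‖u p‖ ^ 2 = -∫ p, θ p * (2 * inner ℝ (u p) (u' p)) := by
  have hdc := continuous_fderiv_apply_of_contDiff hθ e
  have hdcs : HasCompactSupport fun p => fderiv ℝ θ p e := hθc.fderiv_apply ℝ e
  have key : ∀ n, (∫ p, inner ℝ (θ p • u p) (mollify (mollifier n) u' p))
      + (∫ p, inner ℝ (fderiv ℝ θ p e • u p) (mollify (mollifier n) u p))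
      + (∫ p, inner ℝ (θ p • u' p) (mollify (mollifier n) u p)) = 0 := by
    intro n
    have hρ := contDiff_mollifier n
    have hρc := hasCompactSupport_mollifier n
    set v := mollify (mollifier n) u with hv
    have hvs : ContDiff ℝ ∞ v := contDiff_mollify hρ hρc h.locallyIntegrable
    have hv's : ContDiff ℝ ∞ (mollify (mollifier n) u') :=
      contDiff_mollify hρ hρc h.locallyIntegrable_deriv
    have hd : ∀ p, fderiv ℝ (fun p => θ p • v p) p e
        = θ p • mollify (mollifier n) u' p + fderiv ℝ θ p e • v p := by
      intro p
      rw [fderiv_fun_smul (hθ.differentiable (by simp) p) (hvs.differentiable (by simp) p)]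
      simp only [_root_.add_apply, _root_.smul_apply,
        ContinuousLinearMap.smulRight_apply]
      rw [h.fderiv_mollify hρ hρc]
    have h1 := h.integral_inner_eq (φ := fun p => θ p • v p) (hθ.smul hvs) hθc.smul_right
    simp_rw [hd, inner_add_left] at h1
    have i1 : Integrable fun p => inner ℝ (θ p • mollify (mollifier n) u' p) (u p) :=
      integrable_inner_of_hasCompactSupport (hθ.continuous.smul hv's.continuous) hθc.smul_right
        h.locallyIntegrable
    have i2 : Integrable fun p => inner ℝ (fderiv ℝ θ p e • v p) (u p) :=
      integrable_inner_of_hasCompactSupport (hdc.smul hvs.continuous) hdcs.smul_right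
        h.locallyIntegrable
    rw [integral_add i1 i2] at h1
    have e1 : ∀ (c : ℝ) (a b : ℂ), inner ℝ (c • a) b = inner ℝ (c • b) a := by
      intro c a b
      rw [inner_smul_left, inner_smul_left, real_inner_comm]
    simp_rw [e1 _ (mollify (mollifier n) u' _), e1 _ (v _)] at h1
    linarith
  have hlim := ((hu'.tendsto_smul hu hθ.continuous hθc).add (hu.tendsto_smul hu hdc hdcs)).add
    (hu.tendsto_smul hu' hθ.continuous hθc)
  simp_rw [key] at hlim
  have h0 := tendsto_nhds_unique hlim tendsto_const_nhds
  have e2 : ∀ p, inner ℝ (fderiv ℝ θ p e • u p) (u p) = fderiv ℝ θ p e * ‖u p‖ ^ 2 := by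
    intro p
    rw [real_inner_smul_left, real_inner_self_eq_norm_sq]
  have e3 : ∀ p, inner ℝ (θ p • u p) (u' p) = θ p * inner ℝ (u p) (u' p) := fun p =>
    real_inner_smul_left _ _ _
  have e4 : ∀ p, inner ℝ (θ p • u' p) (u p) = θ p * inner ℝ (u p) (u' p) := fun p => by
    rw [real_inner_smul_left, real_inner_comm]
  simp_rw [e2, e3, e4] at h0
  have e5 : ∫ p, θ p * (2 * inner ℝ (u p) (u' p)) = 2 * ∫ p, θ p * inner ℝ (u p) (u' p) := by
    rw [← integral_const_mul]
    congr 1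
    funext p
    ring
  rw [e5]
  linarith

theorem LocallyL2.const_mul {f : ℝ × ℝ × ℝ → ℂ} (hf : LocallyL2 f) (c : ℂ) :
    LocallyL2 fun p => c * f p := fun K hK => (hf K hK).const_mul c

theorem inner_I_mul_left (a b : ℂ) : inner ℝ (Complex.I * a) b = -inner ℝ a (Complex.I * b) := by
  simp [Complex.inner]
  ring

/-- The Jacobian `2 ⟨i∂₁u, ∂₂u⟩` is a divergence. The mollified derivatives serve in test
functions for the other weak derivative of `u`; the mixed second derivatives cancel. -/
theorem integral_jacobian {e₁ e₂ : ℝ × ℝ × ℝ} {u u₁ u₂ : ℝ × ℝ × ℝ → ℂ}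
    (h₁ : HasWeakDeriv e₁ u u₁) (h₂ : HasWeakDeriv e₂ u u₂) (hu : LocallyL2 u)
    (hu₁ : LocallyL2 u₁) (hu₂ : LocallyL2 u₂) (hθ : ContDiff ℝ ∞ θ) (hθc : HasCompactSupport θ) :
    ∫ p, θ p * (2 * inner ℝ (Complex.I * u₁ p) (u₂ p))
      = (∫ p, fderiv ℝ θ p e₁ * inner ℝ (Complex.I * u₂ p) (u p))
        - ∫ p, fderiv ℝ θ p e₂ * inner ℝ (Complex.I * u₁ p) (u p) := by
  have hd1c := continuous_fderiv_apply_of_contDiff hθ e₁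
  have hd1s : HasCompactSupport fun p => fderiv ℝ θ p e₁ := hθc.fderiv_apply ℝ e₁
  have hd2c := continuous_fderiv_apply_of_contDiff hθ e₂
  have hd2s : HasCompactSupport fun p => fderiv ℝ θ p e₂ := hθc.fderiv_apply ℝ e₂
  have swap : ∀ (c : ℝ) (a b : ℂ), inner ℝ (c • (Complex.I * a)) b
      = -inner ℝ (c • (Complex.I * b)) a := by
    intro c a b
    rw [real_inner_smul_left, real_inner_smul_left, inner_I_mul_left, real_inner_comm]
    ring
  -- one direction of the computation; the second derivatives are symmetric and cancel
  have part : ∀ (n : ℕ) (e e' : ℝ × ℝ × ℝ) (ue ue' : ℝ × ℝ × ℝ → ℂ), HasWeakDeriv e u ue →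
      HasWeakDeriv e' u ue' →
      (∫ p, inner ℝ (θ p • (Complex.I * (fderiv ℝ (fderiv ℝ (mollify (mollifier n) u)) p e' e)))
          (u p))
        = (∫ p, inner ℝ (fderiv ℝ θ p e' • (Complex.I * u p)) (mollify (mollifier n) ue p))
          + ∫ p, inner ℝ (θ p • (Complex.I * ue' p)) (mollify (mollifier n) ue p) := by
    intro n e e' ue ue' h h'
    have hρ := contDiff_mollifier n
    have hρc := hasCompactSupport_mollifier n
    set v := mollify (mollifier n) u with hv
    have hvs : ContDiff ℝ ∞ v := contDiff_mollify hρ hρc h.locallyIntegrable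
    have has : ContDiff ℝ ∞ (mollify (mollifier n) ue) :=
      contDiff_mollify hρ hρc h.locallyIntegrable_deriv
    have hfd : ContDiff ℝ ∞ (fderiv ℝ v) := hvs.fderiv_right (by simp)
    have hda : ∀ p, fderiv ℝ (mollify (mollifier n) ue) p e' = fderiv ℝ (fderiv ℝ v) p e' e := by
      intro p
      have e1 : mollify (mollifier n) ue = fun p => fderiv ℝ v p e :=
        funext fun p => (h.fderiv_mollify hρ hρc p).symm
      rw [e1, fderiv_clm_apply (hfd.differentiable (by simp) p) (by fun_prop)]
      simp
    have hIs : ContDiff ℝ ∞ fun p => Complex.I * mollify (mollifier n) ue p :=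
      contDiff_const.mul has
    have hd : ∀ p, fderiv ℝ (fun p => θ p • (Complex.I * mollify (mollifier n) ue p)) p e'
        = θ p • (Complex.I * fderiv ℝ (fderiv ℝ v) p e' e)
          + fderiv ℝ θ p e' • (Complex.I * mollify (mollifier n) ue p) := by
      intro p
      rw [fderiv_fun_smul (hθ.differentiable (by simp) p) (hIs.differentiable (by simp) p),
        fderiv_const_mul (has.differentiable (by simp) p)]
      simp only [_root_.add_apply, _root_.smul_apply,
        ContinuousLinearMap.smulRight_apply, smul_eq_mul, hda]
    have h1 := h'.integral_inner_eq
      (φ := fun p => θ p • (Complex.I * mollify (mollifier n) ue p)) (hθ.smul hIs) hθc.smul_right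
    simp_rw [hd, inner_add_left] at h1
    have hdc := continuous_fderiv_apply_of_contDiff hθ e'
    have hds : HasCompactSupport fun p => fderiv ℝ θ p e' := hθc.fderiv_apply ℝ e'
    have hdd : Continuous fun p => fderiv ℝ (fderiv ℝ v) p e' e :=
      ((hfd.continuous_fderiv (by simp)).clm_apply continuous_const).clm_apply continuous_const
    have i1 : Integrable fun p =>
        inner ℝ (θ p • (Complex.I * fderiv ℝ (fderiv ℝ v) p e' e)) (u p) :=
      integrable_inner_of_hasCompactSupport
        (hθ.continuous.smul (continuous_const.mul hdd)) hθc.smul_right h.locallyIntegrable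
    have i2 : Integrable fun p =>
        inner ℝ (fderiv ℝ θ p e' • (Complex.I * mollify (mollifier n) ue p)) (u p) :=
      integrable_inner_of_hasCompactSupport (hdc.smul hIs.continuous) hds.smul_right
        h.locallyIntegrable
    rw [integral_add i1 i2] at h1
    simp_rw [swap _ (mollify (mollifier n) ue _), integral_neg] at h1
    linarith
  have hsym : ∀ n p, fderiv ℝ (fderiv ℝ (mollify (mollifier n) u)) p e₂ e₁
      = fderiv ℝ (fderiv ℝ (mollify (mollifier n) u)) p e₁ e₂ := by
    intro n p
    have hvs : ContDiff ℝ ∞ (mollify (mollifier n) u) := contDiff_mollify (contDiff_mollifier n)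
      (hasCompactSupport_mollifier n) h₁.locallyIntegrable
    exact ((contDiff_infty.1 hvs 2).contDiffAt.isSymmSndFDerivAt (by simp)) e₂ e₁
  have key : ∀ n, (∫ p, inner ℝ (fderiv ℝ θ p e₂ • (Complex.I * u p)) (mollify (mollifier n) u₁ p))
          + (∫ p, inner ℝ (θ p • (Complex.I * u₂ p)) (mollify (mollifier n) u₁ p))
      - ((∫ p, inner ℝ (fderiv ℝ θ p e₁ • (Complex.I * u p)) (mollify (mollifier n) u₂ p))
          + ∫ p, inner ℝ (θ p • (Complex.I * u₁ p)) (mollify (mollifier n) u₂ p)) = 0 := by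
    intro n
    rw [← part n e₁ e₂ u₁ u₂ h₁ h₂, ← part n e₂ e₁ u₂ u₁ h₂ h₁]
    simp_rw [hsym n]
    ring
  have hlim := ((hu₁.tendsto_smul (hu.const_mul Complex.I) hd2c hd2s).add
      (hu₁.tendsto_smul (hu₂.const_mul Complex.I) hθ.continuous hθc)).sub
    ((hu₂.tendsto_smul (hu.const_mul Complex.I) hd1c hd1s).add
      (hu₂.tendsto_smul (hu₁.const_mul Complex.I) hθ.continuous hθc))
  simp_rw [key] at hlim
  have h0 := tendsto_nhds_unique hlim tendsto_const_nhds
  simp_rw [swap _ (u₂ _), swap _ (u _), integral_neg, real_inner_smul_left] at h0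
  have e5 : ∫ p, θ p * (2 * inner ℝ (Complex.I * u₁ p) (u₂ p))
      = 2 * ∫ p, θ p * inner ℝ (Complex.I * u₁ p) (u₂ p) := by
    rw [← integral_const_mul]
    congr 1
    funext p
    ring
  rw [e5]
  linarith

end

/-! ### Periodic functions on the slab -/

/-- Almost everywhere `L`-periodicity in the third variable. -/
def PeriodicZ {α : Type*} (L : ℝ) (g : ℝ × ℝ × ℝ → α) : Prop :=
  ∀ᵐ p : ℝ × ℝ × ℝ, g (p + (0, 0, L)) = g p

/-- The cell `ℝ² × (nL - L/2, nL + L/2]`. -/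
def cell (L : ℝ) (n : ℤ) : Set (ℝ × ℝ × ℝ) :=
  (fun p => p.2.2) ⁻¹' Set.Ioc (n * L - L / 2) (n * L + L / 2)

theorem measurableSet_cell (L : ℝ) (n : ℤ) : MeasurableSet (cell L n) :=
  measurable_snd.snd measurableSet_Ioc

theorem slab_ae_eq_cell (L : ℝ) : slab L =ᵐ[volume] cell L 0 := by
  have hq : Measure.QuasiMeasurePreserving (fun p : ℝ × ℝ × ℝ => p.2.2) volume volume :=
    (Measure.quasiMeasurePreserving_snd (μ := (volume : Measure ℝ))
      (ν := (volume : Measure ℝ))).comp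
      (Measure.quasiMeasurePreserving_snd (μ := (volume : Measure ℝ))
        (ν := (volume : Measure (ℝ × ℝ))))
  have h : Set.Ioo (-(L / 2)) (L / 2) =ᵐ[volume]
      Set.Ioc (((0 : ℤ) : ℝ) * L - L / 2) (((0 : ℤ) : ℝ) * L + L / 2) := by
    simpa using! (Ioo_ae_eq_Ioc (a := -(L / 2)) (b := L / 2) (μ := (volume : Measure ℝ)))
  exact hq.preimage_ae_eq h

theorem restrict_slab_eq (L : ℝ) :
    (volume : Measure (ℝ × ℝ × ℝ)).restrict (slab L) = volume.restrict (cell L 0) :=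
  Measure.restrict_congr_set (slab_ae_eq_cell L)

theorem measurePreserving_translate (a : ℝ × ℝ × ℝ) :
    MeasurePreserving (fun p : ℝ × ℝ × ℝ => p + a) volume volume :=
  measurePreserving_add_right volume a

theorem measurableEmbedding_translate (a : ℝ × ℝ × ℝ) :
    MeasurableEmbedding (fun p : ℝ × ℝ × ℝ => p + a) :=
  (MeasurableEquiv.addRight a).measurableEmbedding

theorem preimage_cell (L : ℝ) (n : ℤ) :
    (fun p : ℝ × ℝ × ℝ => p + (0, 0, n * L)) ⁻¹' cell L n = cell L 0 := by
  ext p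
  simp only [cell, Set.mem_preimage, Set.mem_Ioc, Prod.snd_add, Int.cast_zero, zero_mul]
  constructor <;> rintro ⟨h1, h2⟩ <;> constructor <;> linarith

namespace PeriodicZ

variable {α β γ : Type*} {L : ℝ}

theorem int {g : ℝ × ℝ × ℝ → α} (hg : PeriodicZ L g) (n : ℤ) :
    ∀ᵐ p : ℝ × ℝ × ℝ, g (p + (0, 0, n * L)) = g p := by
  have hnat : ∀ n : ℕ, ∀ᵐ p : ℝ × ℝ × ℝ, g (p + (0, 0, n * L)) = g p := by
    intro n
    induction n with
    | zero =>
      refine Eventually.of_forall fun p => ?_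
      congr 1
      ext <;> simp
    | succ n ih =>
      have h := (measurePreserving_translate (0, 0, n * L)).quasiMeasurePreserving.ae hg
      filter_upwards [h, ih] with p h1 h2
      rw [← h2, ← h1]
      congr 1
      push_cast
      ext <;> simp
      ring
  obtain ⟨m, rfl | rfl⟩ := n.eq_nat_or_neg
  · simpa using hnat m
  · have h := (measurePreserving_translate (0, 0, -(m * L))).quasiMeasurePreserving.ae (hnat m)
    filter_upwards [h] with p hp
    push_cast
    rw [neg_mul, ← hp]
    congr 1
    ext <;> simp

theorem comp {g : ℝ × ℝ × ℝ → α} (hg : PeriodicZ L g) (F : α → β) :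
    PeriodicZ L fun p => F (g p) := by
  filter_upwards [hg] with p hp
  rw [hp]

theorem comp₂ {g : ℝ × ℝ × ℝ → α} {h : ℝ × ℝ × ℝ → β} (hg : PeriodicZ L g) (hh : PeriodicZ L h)
    (F : α → β → γ) : PeriodicZ L fun p => F (g p) (h p) := by
  filter_upwards [hg, hh] with p h1 h2
  rw [h1, h2]

theorem of_forall {g : ℝ × ℝ × ℝ → α} (hg : ∀ p, g (p + (0, 0, L)) = g p) : PeriodicZ L g :=
  Eventually.of_forall hg

theorem integrableOn_cell {g : ℝ × ℝ × ℝ → ℝ} (hg : PeriodicZ L g)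
    (hi : IntegrableOn g (slab L)) (n : ℤ) : IntegrableOn g (cell L n) := by
  rw [IntegrableOn, restrict_slab_eq] at hi
  rw [← (measurePreserving_translate (0, 0, n * L)).integrableOn_comp_preimage
    (measurableEmbedding_translate _), preimage_cell]
  exact hi.congr ((ae_restrict_of_ae (hg.int n)).mono fun p hp => hp.symm)

/-- The integral over all space of a periodic function, weighted by a function of the third variable
supported in three cells, is an integral over the slab. -/
theorem integral_mul_eq {g : ℝ × ℝ × ℝ → ℝ} (hg : PeriodicZ L g)
    (hi : IntegrableOn g (slab L)) {ζ : ℝ → ℝ} (hζ : Continuous ζ) (hL : 0 < L)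
    (hζ0 : ∀ z, L ≤ |z| → ζ z = 0) :
    Integrable (fun p => ζ p.2.2 * g p) ∧ ∫ p, ζ p.2.2 * g p
      = ∫ p in slab L, (ζ (p.2.2 - L) + ζ p.2.2 + ζ (p.2.2 + L)) * g p := by
  obtain ⟨C, hC⟩ : ∃ C, ∀ z, ‖ζ z‖ ≤ C := by
    refine hζ.bounded_above_of_compact_support (HasCompactSupport.intro
      (isCompact_Icc (a := -L) (b := L)) fun z hz => hζ0 z ?_)
    by_contra h
    exact hz (abs_le.1 (not_le.1 h).le)
  have hloc : ∀ n : ℤ, IntegrableOn (fun p => ζ p.2.2 * g p) (cell L n) := fun n =>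
    (hg.integrableOn_cell hi n).bdd_mul (c := C)
      (by exact (hζ.comp (by fun_prop)).aestronglyMeasurable)
      (Eventually.of_forall fun p => hC _)
  have hcell : ∀ n : ℤ, ∫ p in cell L n, ζ p.2.2 * g p
      = ∫ p in slab L, ζ (p.2.2 + n * L) * g p := by
    intro n
    rw [restrict_slab_eq, ← preimage_cell L n,
      ← (measurePreserving_translate (0, 0, n * L)).setIntegral_preimage_emb
      (measurableEmbedding_translate _)]
    refine integral_congr_ae ?_
    filter_upwards [ae_restrict_of_ae (hg.int n)] with p hp
    simp only [hp, Prod.snd_add]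
  have hsub : Function.support (fun p => ζ p.2.2 * g p) ⊆ cell L (-1) ∪ cell L 0 ∪ cell L 1 := by
    intro p hp
    have h1 : |p.2.2| < L := by
      by_contra h
      exact hp (by simp [hζ0 _ (not_lt.1 h)])
    have h2 := abs_lt.1 h1
    by_contra hne
    simp only [cell, Set.mem_union, Set.mem_preimage, Set.mem_Ioc, not_or, not_and_or, not_lt,
      not_le] at hne
    push_cast at hne
    obtain ⟨⟨h3, h4⟩, h5⟩ := hne
    rcases h3 with h3 | h3 <;> rcases h4 with h4 | h4 <;> rcases h5 with h5 | h5 <;> linarith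
  have hd1 : Disjoint (cell L (-1)) (cell L 0) := by
    rw [Set.disjoint_left]
    rintro p ⟨_, h2⟩ ⟨h3, _⟩
    push_cast at h2 h3
    linarith
  have hd2 : Disjoint (cell L (-1) ∪ cell L 0) (cell L 1) := by
    rw [Set.disjoint_left]
    rintro p (⟨_, h2⟩ | ⟨_, h2⟩) ⟨h3, _⟩ <;> push_cast at h2 h3 <;> linarith
  have hU : IntegrableOn (fun p => ζ p.2.2 * g p) (cell L (-1) ∪ cell L 0 ∪ cell L 1) :=
    ((hloc (-1)).union (hloc 0)).union (hloc 1)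
  have hms : MeasurableSet (cell L (-1) ∪ cell L 0 ∪ cell L 1) :=
    ((measurableSet_cell L _).union (measurableSet_cell L _)).union (measurableSet_cell L _)
  refine ⟨(integrableOn_iff_integrable_of_support_subset hsub).1 hU, ?_⟩
  rw [← setIntegral_eq_integral_of_forall_compl_eq_zero
      (s := cell L (-1) ∪ cell L 0 ∪ cell L 1) (fun p hp => by
        by_contra h
        exact hp (hsub h)),
    setIntegral_union hd2 (measurableSet_cell L _) ((hloc (-1)).union (hloc 0)) (hloc 1),
    setIntegral_union hd1 (measurableSet_cell L _) (hloc (-1)) (hloc 0), hcell, hcell, hcell]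
  have hs : ∀ n : ℤ, IntegrableOn (fun p => ζ (p.2.2 + n * L) * g p) (slab L) := fun n =>
    hi.bdd_mul (c := C) (by exact (hζ.comp (by fun_prop)).aestronglyMeasurable)
      (Eventually.of_forall fun p => hC _)
  have hs01 : IntegrableOn (fun p => ζ (p.2.2 + (-1 : ℤ) * L) * g p
      + ζ (p.2.2 + (0 : ℤ) * L) * g p) (slab L) := (hs (-1)).add (hs 0)
  rw [← integral_add (hs (-1)) (hs 0), ← integral_add hs01 (hs 1)]
  congr 1
  funext p
  push_cast
  ring_nf

end PeriodicZ

theorem LocallyL2.of_periodic {L : ℝ} (hL : 0 < L) {u : ℝ × ℝ × ℝ → ℂ} (hu : PeriodicZ L u)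
    (hum : AEStronglyMeasurable u volume) (hi : MemLp u 2 (volume.restrict (slab L))) :
    LocallyL2 u := by
  intro K hK
  rw [memLp_two_iff_integrable_sq_norm hum.restrict]
  have hi2 : IntegrableOn (fun p => ‖u p‖ ^ 2) (slab L) := hi.integrable_norm_pow (by norm_num)
  have hp : PeriodicZ L fun p => ‖u p‖ ^ 2 := hu.comp fun a => ‖a‖ ^ 2
  obtain ⟨M, hM⟩ := hK.exists_bound_of_continuousOn (f := fun p => p.2.2)
    (by fun_prop)
  obtain ⟨N, hN⟩ := exists_nat_gt (M / L)
  have hfin : IntegrableOn (fun p => ‖u p‖ ^ 2)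
      (⋃ n ∈ (Finset.Icc (-(N : ℤ) - 1) (N + 1)), cell L n) := by
    rw [integrableOn_finset_iUnion]
    exact fun n _ => hp.integrableOn_cell hi2 n
  refine hfin.mono_set fun p hpK => ?_
  have h1 : |p.2.2| ≤ M := hM p hpK
  have hNL : M < N * L := by rwa [div_lt_iff₀ hL] at hN
  -- the index of the cell containing `p`
  set m : ℤ := ⌈p.2.2 / L - 1 / 2⌉ with hm
  have hm1 : (m : ℝ) < p.2.2 / L - 1 / 2 + 1 := Int.ceil_lt_add_one _
  have hm2 : p.2.2 / L - 1 / 2 ≤ m := Int.le_ceil _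
  have e : p.2.2 = p.2.2 / L * L := by field_simp
  have hz := abs_le.1 h1
  have hq1 : p.2.2 / L < N := by rw [div_lt_iff₀ hL]; linarith
  have hq2 : -(N : ℝ) < p.2.2 / L := by rw [lt_div_iff₀ hL]; linarith
  simp only [Set.mem_iUnion]
  refine ⟨m, Finset.mem_Icc.2 ⟨?_, ?_⟩, ?_, ?_⟩
  · have : (-(N : ℝ) - 1) < m := by linarith
    exact_mod_cast this.le
  · have : (m : ℝ) < N + 1 := by linarith
    exact_mod_cast this.le
  · change (m : ℝ) * L - L / 2 < p.2.2
    rw [e]; nlinarith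
  · change p.2.2 ≤ (m : ℝ) * L + L / 2
    rw [e]; nlinarith

/-- Weak derivatives of periodic functions are periodic. -/
theorem HasWeakDeriv.periodicZ {L : ℝ} {e : ℝ × ℝ × ℝ} {u u' : ℝ × ℝ × ℝ → ℂ}
    (h : HasWeakDeriv e u u') (hu : PeriodicZ L u) : PeriodicZ L u' := by
  set a : ℝ × ℝ × ℝ := (0, 0, L) with ha
  have hloc : LocallyIntegrable (fun p => u' (p + a)) volume := by
    intro p
    obtain ⟨s, hs, hi⟩ := h.locallyIntegrable_deriv (p + a)
    refine ⟨(fun p => p + a) ⁻¹' s, (by fun_prop : Continuous fun p => p + a).continuousAt hs, ?_⟩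
    exact ((measurePreserving_translate a).integrableOn_comp_preimage
      (measurableEmbedding_translate a)).2 hi
  refine ae_eq_of_integral_contDiff_smul_eq hloc h.locallyIntegrable_deriv fun θ hθ hθc => ?_
  have hθ' : ContDiff ℝ ∞ fun p => θ (p - a) := hθ.comp (contDiff_id.sub contDiff_const)
  have hθc' : HasCompactSupport fun p => θ (p - a) :=
    hθc.comp_homeomorph (Homeomorph.subRight a)
  have e1 : ∫ p, θ p • u' (p + a) = ∫ p, θ (p - a) • u' p := by
    rw [← integral_add_right_eq_self (fun p => θ (p - a) • u' p) a]
    simp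
  have e2 : ∀ p, fderiv ℝ (fun p => θ (p - a)) p e = fderiv ℝ θ (p - a) e := by
    intro p
    rw [fderiv_comp_sub]
  have e3 : ∫ p, fderiv ℝ θ (p - a) e • u p = ∫ p, fderiv ℝ θ p e • u p := by
    rw [← integral_add_right_eq_self (fun p => fderiv ℝ θ (p - a) e • u p) a]
    refine integral_congr_ae ?_
    filter_upwards [hu] with p hp
    rw [← ha] at hp
    simp [hp]
  have h1 := h.integral_eq _ hθ' hθc'
  simp_rw [e2, e3] at h1
  have h2 := h.integral_eq θ hθ hθc
  rw [e1, ← neg_inj, ← h1, h2]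

/-! ### The divergence theorem on the slab -/

/-- A smooth function whose translates by multiples of `L` form a partition of unity. -/
theorem exists_periodic_partition {L : ℝ} (hL : 0 < L) :
    ∃ η : ℝ → ℝ, ContDiff ℝ ∞ η ∧ (∀ z, 0 ≤ η z) ∧ (∀ z, L ≤ |z| → η z = 0) ∧
      ∀ z, |z| < L → η (z - L) + η z + η (z + L) = 1 := by
  refine ⟨fun z => Real.smoothTransition (z / L + 1) - Real.smoothTransition (z / L), ?_, ?_, ?_,
    ?_⟩
  · exact (Real.smoothTransition.contDiff.comp (by fun_prop)).sub
      (Real.smoothTransition.contDiff.comp (by fun_prop))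
  · intro z
    exact sub_nonneg.2 (Real.smoothTransition.monotone (by linarith))
  · intro z hz
    rcases le_abs'.1 hz with h | h
    · have : z / L ≤ -1 := by rw [div_le_iff₀ hL]; linarith
      simp only
      rw [Real.smoothTransition.zero_of_nonpos (by linarith),
        Real.smoothTransition.zero_of_nonpos (by linarith), sub_zero]
    · have : 1 ≤ z / L := by rw [le_div_iff₀ hL]; linarith
      simp only
      rw [Real.smoothTransition.one_of_one_le (by linarith),
        Real.smoothTransition.one_of_one_le (by linarith), sub_self]
  · intro z hz
    obtain ⟨h1, h2⟩ := abs_lt.1 hz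
    have h3 : z / L ≤ 1 := by rw [div_le_iff₀ hL]; linarith
    have h4 : -1 ≤ z / L := by rw [le_div_iff₀ hL]; linarith
    have e1 : (z - L) / L = z / L - 1 := by field_simp
    have e2 : (z + L) / L = z / L + 1 := by field_simp
    simp only [e1, e2]
    rw [Real.smoothTransition.one_of_one_le (x := z / L + 1 + 1) (by linarith),
      Real.smoothTransition.zero_of_nonpos (x := z / L - 1) (by linarith), sub_add_cancel]
    ring

/-- Cutoff functions in the transverse variables, with gradient of order `1 / n`. -/
theorem exists_transverse_cutoff :
    ∃ χ : ℕ → ℝ × ℝ × ℝ → ℝ, (∀ n, ContDiff ℝ ∞ (χ n)) ∧ (∀ n p, |χ n p| ≤ 1) ∧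
      (∀ n p t, χ n (p + (0, 0, t)) = χ n p) ∧
      (∀ n, ∃ R : ℝ, ∀ p, χ n p ≠ 0 → |p.1| ≤ R ∧ |p.2.1| ≤ R) ∧
      (∀ p, Tendsto (fun n => χ n p) atTop (𝓝 1)) ∧
      ∀ e, ∃ C : ℝ, ∀ n p, |fderiv ℝ (χ n) p e| ≤ C * (1 / ((n : ℝ) + 1)) := by
  let Φ : ContDiffBump (0 : ℝ × ℝ) := ⟨1, 2, one_pos, one_lt_two⟩
  let ℓ : ℝ × ℝ × ℝ →L[ℝ] ℝ × ℝ :=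
    (ContinuousLinearMap.fst ℝ ℝ (ℝ × ℝ)).prod
      ((ContinuousLinearMap.fst ℝ ℝ ℝ).comp (ContinuousLinearMap.snd ℝ ℝ (ℝ × ℝ)))
  have hℓ : ∀ p, ℓ p = (p.1, p.2.1) := fun p => rfl
  have hsm : ContDiff ℝ ∞ (Φ : ℝ × ℝ → ℝ) := Φ.contDiff
  have hn : ∀ n : ℕ, (0 : ℝ) < n + 1 := fun n => by positivity
  refine ⟨fun n p => Φ ((1 / ((n : ℝ) + 1)) • ℓ p), fun n => hsm.comp (by fun_prop), ?_, ?_, ?_,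
    ?_, ?_⟩
  · intro n p
    rw [abs_of_nonneg Φ.nonneg]
    exact Φ.le_one
  · intro n p t
    simp [hℓ]
  · intro n
    refine ⟨2 * ((n : ℝ) + 1), fun p hp => ?_⟩
    have h1 : ‖(1 / ((n : ℝ) + 1)) • ℓ p‖ < 2 := by
      by_contra h
      refine hp (Φ.zero_of_le_dist ?_)
      rw [dist_zero_right]
      exact not_lt.1 h
    rw [norm_smul, Real.norm_of_nonneg (one_div_pos.2 (hn n)).le, one_div_mul_eq_div,
      div_lt_iff₀ (hn n)] at h1
    rw [hℓ] at h1
    have h2 := max_lt_iff.1 h1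
    exact ⟨h2.1.le, h2.2.le⟩
  · intro p
    have h1 : Tendsto (fun n : ℕ => (1 / ((n : ℝ) + 1)) • ℓ p) atTop (𝓝 ((0 : ℝ) • ℓ p)) :=
      tendsto_one_div_add_atTop_nhds_zero_nat.smul_const _
    rw [zero_smul] at h1
    have h2 := (Φ.continuous.tendsto 0).comp h1
    rwa [Φ.one_of_mem_closedBall (by simp [Φ])] at h2
  · intro e
    obtain ⟨C, hC⟩ := (hsm.continuous_fderiv (by simp)).bounded_above_of_compact_support
      (Φ.hasCompactSupport.fderiv (𝕜 := ℝ))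
    refine ⟨C * ‖ℓ e‖, fun n p => ?_⟩
    have hd : HasFDerivAt (fun p => Φ ((1 / ((n : ℝ) + 1)) • ℓ p))
        ((fderiv ℝ Φ ((1 / ((n : ℝ) + 1)) • ℓ p)).comp ((1 / ((n : ℝ) + 1)) • ℓ)) p :=
      ((hsm.differentiable (by simp)) _).hasFDerivAt.comp p
        (((1 / ((n : ℝ) + 1)) • ℓ).hasFDerivAt)
    rw [hd.fderiv]
    have h1 := ((fderiv ℝ Φ ((1 / ((n : ℝ) + 1)) • ℓ p)).le_opNorm ((1 / ((n : ℝ) + 1)) • ℓ e))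
    rw [norm_smul, Real.norm_of_nonneg (one_div_pos.2 (hn n)).le] at h1
    refine h1.trans ?_
    calc _ ≤ C * (1 / ((n : ℝ) + 1) * ‖ℓ e‖) := by
          refine mul_le_mul_of_nonneg_right (hC _) ?_
          have := (one_div_pos.2 (hn n)).le
          positivity
      _ = _ := by ring

theorem tendsto_setIntegral_cutoff {L : ℝ} {χ : ℕ → ℝ × ℝ × ℝ → ℝ}
    (hχ : ∀ n, Continuous (χ n)) (hχ1 : ∀ n p, |χ n p| ≤ 1)
    (hχl : ∀ p, Tendsto (fun n => χ n p) atTop (𝓝 1)) {g : ℝ × ℝ × ℝ → ℝ}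
    (hg : IntegrableOn g (slab L)) :
    Tendsto (fun n => ∫ p in slab L, χ n p * g p) atTop (𝓝 (∫ p in slab L, g p)) := by
  refine tendsto_integral_of_dominated_convergence (fun p => ‖g p‖)
    (fun n => (hχ n).aestronglyMeasurable.mul hg.1) hg.norm
    (fun n => Eventually.of_forall fun p => ?_) (Eventually.of_forall fun p => ?_)
  · rw [norm_mul]
    exact mul_le_of_le_one_left (norm_nonneg _) (hχ1 n p)
  · simpa using (hχl p).mul_const (g p)

theorem tendsto_setIntegral_deriv_cutoff {L C : ℝ} {ψ : ℕ → ℝ × ℝ × ℝ → ℝ}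
    (hψ : ∀ n p, |ψ n p| ≤ C * (1 / ((n : ℝ) + 1))) {g : ℝ × ℝ × ℝ → ℝ}
    (hg : IntegrableOn g (slab L)) :
    Tendsto (fun n => ∫ p in slab L, ψ n p * g p) atTop (𝓝 0) := by
  have h0 : Tendsto (fun n : ℕ => C * (1 / ((n : ℝ) + 1)) * ∫ p in slab L, ‖g p‖) atTop (𝓝 0) := by
    simpa using ((tendsto_one_div_add_atTop_nhds_zero_nat (𝕜 := ℝ)).const_mul C).mul_const
      (∫ p in slab L, ‖g p‖)
  refine squeeze_zero_norm (fun n => ?_) h0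
  rw [← integral_const_mul]
  refine norm_integral_le_of_norm_le (hg.norm.const_mul _) (Eventually.of_forall fun p => ?_)
  rw [norm_mul]
  exact mul_le_mul_of_nonneg_right (hψ n p) (norm_nonneg _)

/-- If `∂₁ g₁ + ∂₂ g₂ = -g₀` in the sense of distributions, where the `gᵢ` are periodic, then this
identity may be tested on the slab against smooth periodic functions `b` which need not decay: no
boundary terms appear at the faces of the slab, and none at infinity by integrability. -/
theorem setIntegral_slab_eq {L : ℝ} (hL : 0 < L) {e₁ e₂ : ℝ × ℝ × ℝ} {g₀ g₁ g₂ b : ℝ × ℝ × ℝ → ℝ}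
    (hg₀ : PeriodicZ L g₀) (hg₁ : PeriodicZ L g₁) (hg₂ : PeriodicZ L g₂)
    (hdiv : ∀ θ : ℝ × ℝ × ℝ → ℝ, ContDiff ℝ ∞ θ → HasCompactSupport θ →
      ∫ p, θ p * g₀ p = (∫ p, fderiv ℝ θ p e₁ * g₁ p) + ∫ p, fderiv ℝ θ p e₂ * g₂ p)
    (hb : ContDiff ℝ ∞ b) (hbp : ∀ p, b (p + (0, 0, L)) = b p)
    (h₀ : IntegrableOn (fun p => b p * g₀ p) (slab L))
    (h₁ : IntegrableOn (fun p => b p * g₁ p) (slab L))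
    (h₂ : IntegrableOn (fun p => b p * g₂ p) (slab L))
    (h₁' : IntegrableOn (fun p => fderiv ℝ b p e₁ * g₁ p) (slab L))
    (h₂' : IntegrableOn (fun p => fderiv ℝ b p e₂ * g₂ p) (slab L)) :
    ∫ p in slab L, b p * g₀ p
      = (∫ p in slab L, fderiv ℝ b p e₁ * g₁ p) + ∫ p in slab L, fderiv ℝ b p e₂ * g₂ p := by
  obtain ⟨η, hη, hηnn, hη0, hη1⟩ := exists_periodic_partition hL
  obtain ⟨χ, hχ, hχ1, hχp, hχR, hχl, hχd⟩ := exists_transverse_cutoff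
  have hηd0 : ∀ z, L ≤ |z| → deriv η z = 0 := fun z hz =>
    IsLocalMin.deriv_eq_zero (Eventually.of_forall fun y => by
      simpa only [hη0 z hz] using hηnn y)
  have hslab : ∀ p ∈ slab L, |p.2.2| < L := fun p hp => by
    have := abs_lt.2 hp
    linarith
  have hηd1 : ∀ z, |z| < L → deriv η (z - L) + deriv η z + deriv η (z + L) = 0 := by
    intro z hz
    have hd : ∀ y, HasDerivAt η (deriv η y) y := fun y =>
      ((hη.differentiable (by simp)) y).hasDerivAt
    have h1 := ((((hd (z - L)).comp_sub_const z L).add (hd z)).add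
      ((hd (z + L)).comp_add_const z L))
    have h2 : (((fun x => η (x - L)) + η) + fun x => η (x + L)) =ᶠ[𝓝 z] fun _ => 1 := by
      filter_upwards [(isOpen_lt continuous_abs continuous_const).mem_nhds hz] with y hy
      exact hη1 y hy
    exact h1.unique ((hasDerivAt_const z (1 : ℝ)).congr_of_eventuallyEq h2)
  have hms : MeasurableSet (slab L) := measurable_snd.snd measurableSet_Ioo
  have hηint : ∀ g : ℝ × ℝ × ℝ → ℝ, PeriodicZ L g → IntegrableOn g (slab L) →
      Integrable (fun p => η p.2.2 * g p) ∧ ∫ p, η p.2.2 * g p = ∫ p in slab L, g p := by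
    intro g hg hi
    obtain ⟨h1, h2⟩ := hg.integral_mul_eq hi hη.continuous hL hη0
    refine ⟨h1, h2.trans (setIntegral_congr_fun hms fun p hp => ?_)⟩
    simp only [hη1 _ (hslab p hp), one_mul]
  have hη'int : ∀ g : ℝ × ℝ × ℝ → ℝ, PeriodicZ L g → IntegrableOn g (slab L) →
      Integrable (fun p => deriv η p.2.2 * g p) ∧ ∫ p, deriv η p.2.2 * g p = 0 := by
    intro g hg hi
    obtain ⟨h1, h2⟩ := hg.integral_mul_eq hi (hη.continuous_deriv (by simp)) hL hηd0
    refine ⟨h1, h2.trans ((setIntegral_congr_fun hms fun p hp => ?_).trans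
      (integral_zero _ _))⟩
    simp only [hηd1 _ (hslab p hp), zero_mul]
  have hperd : ∀ (F : ℝ × ℝ × ℝ → ℝ) (e : ℝ × ℝ × ℝ), (∀ p, F (p + (0, 0, L)) = F p) →
      ∀ p, fderiv ℝ F (p + (0, 0, L)) e = fderiv ℝ F p e := by
    intro F e hF p
    rw [← fderiv_comp_add_right]
    simp_rw [hF]
  have hcd : ∀ (F : ℝ × ℝ × ℝ → ℝ) (e : ℝ × ℝ × ℝ), ContDiff ℝ ∞ F →
      Continuous fun p => fderiv ℝ F p e := fun F e hF =>
    (hF.continuous_fderiv (by simp)).clm_apply continuous_const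
  have hbper : ∀ {g : ℝ × ℝ × ℝ → ℝ}, PeriodicZ L g → PeriodicZ L fun p => b p * g p :=
    fun hg => (PeriodicZ.of_forall hbp).comp₂ hg (· * ·)
  have hχb : ∀ n {g : ℝ × ℝ × ℝ → ℝ}, PeriodicZ L g → PeriodicZ L fun p => χ n p * g p :=
    fun n _ hg => (PeriodicZ.of_forall fun p => hχp n p L).comp₂ hg (· * ·)
  have hχi : ∀ n {g : ℝ × ℝ × ℝ → ℝ}, IntegrableOn g (slab L) →
      IntegrableOn (fun p => χ n p * g p) (slab L) := fun n _ hg =>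
    hg.bdd_mul (c := 1) (hχ n).continuous.aestronglyMeasurable
      (Eventually.of_forall fun p => hχ1 n p)
  -- the two derivative terms have the same structure
  have key : ∀ n e (g : ℝ × ℝ × ℝ → ℝ), PeriodicZ L g → IntegrableOn (fun p => b p * g p) (slab L) →
      IntegrableOn (fun p => fderiv ℝ b p e * g p) (slab L) →
      ∫ p, fderiv ℝ (fun p => η p.2.2 * (χ n p * b p)) p e * g p
        = (∫ p in slab L, fderiv ℝ (χ n) p e * (b p * g p))
          + ∫ p in slab L, χ n p * (fderiv ℝ b p e * g p) := by
    intro n e g hg hbg hbg'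
    obtain ⟨C, hC⟩ := hχd e
    have hi1 : IntegrableOn (fun p => fderiv ℝ (χ n) p e * (b p * g p)) (slab L) :=
      hbg.bdd_mul (hcd _ _ (hχ n)).aestronglyMeasurable (Eventually.of_forall fun p => hC n p)
    have hi2 := hχi n hbg'
    have hi3 := (hχi n hbg).const_mul e.2.2
    have hp1 : PeriodicZ L fun p => fderiv ℝ (χ n) p e * (b p * g p) :=
      (PeriodicZ.of_forall (hperd _ e fun p => hχp n p L)).comp₂ (hbper hg) (· * ·)
    have hp2 : PeriodicZ L fun p => χ n p * (fderiv ℝ b p e * g p) :=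
      hχb n ((PeriodicZ.of_forall (hperd _ e hbp)).comp₂ hg (· * ·))
    have hp3 : PeriodicZ L fun p => e.2.2 * (χ n p * (b p * g p)) :=
      (hχb n (hbper hg)).comp (e.2.2 * ·)
    obtain ⟨a1, a1'⟩ := hηint _ hp1 hi1
    obtain ⟨a2, a2'⟩ := hηint _ hp2 hi2
    obtain ⟨a3, a3'⟩ := hη'int _ hp3 hi3
    rw [← a1', ← a2', ← add_zero (_ + _), ← a3', ← integral_add a1 a2]
    have a12 : Integrable fun p : ℝ × ℝ × ℝ => η p.2.2 * (fderiv ℝ (χ n) p e * (b p * g p))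
        + η p.2.2 * (χ n p * (fderiv ℝ b p e * g p)) := a1.add a2
    rw [← integral_add a12 a3]
    congr 1
    funext p
    have hd1 : HasFDerivAt (fun p : ℝ × ℝ × ℝ => η p.2.2)
        ((ContinuousLinearMap.toSpanSingleton ℝ (deriv η p.2.2)).comp
          ((ContinuousLinearMap.snd ℝ ℝ ℝ).comp (ContinuousLinearMap.snd ℝ ℝ (ℝ × ℝ)))) p :=
      (((hη.differentiable (by simp)) p.2.2).hasDerivAt.hasFDerivAt).comp p
        ((ContinuousLinearMap.snd ℝ ℝ ℝ).comp
          (ContinuousLinearMap.snd ℝ ℝ (ℝ × ℝ))).hasFDerivAt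
    have hd2 := (((hχ n).differentiable (by simp)) p).hasFDerivAt
    have hd3 := ((hb.differentiable (by simp)) p).hasFDerivAt
    have hd := hd1.mul (hd2.mul hd3)
    have hd' : fderiv ℝ (fun p : ℝ × ℝ × ℝ => η p.2.2 * (χ n p * b p)) p = _ := hd.fderiv
    rw [hd']
    simp
    ring
  have hsum : ∀ n, ∫ p in slab L, χ n p * (b p * g₀ p)
      = ((∫ p in slab L, fderiv ℝ (χ n) p e₁ * (b p * g₁ p))
          + ∫ p in slab L, χ n p * (fderiv ℝ b p e₁ * g₁ p))
        + ((∫ p in slab L, fderiv ℝ (χ n) p e₂ * (b p * g₂ p))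
          + ∫ p in slab L, χ n p * (fderiv ℝ b p e₂ * g₂ p)) := by
    intro n
    have hθ : ContDiff ℝ ∞ fun p : ℝ × ℝ × ℝ => η p.2.2 * (χ n p * b p) :=
      (hη.comp (by fun_prop)).mul ((hχ n).mul hb)
    have hθc : HasCompactSupport fun p : ℝ × ℝ × ℝ => η p.2.2 * (χ n p * b p) := by
      obtain ⟨R, hR⟩ := hχR n
      refine HasCompactSupport.intro
        ((isCompact_Icc (a := -R) (b := R)).prod
          ((isCompact_Icc (a := -R) (b := R)).prod (isCompact_Icc (a := -L) (b := L))))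
        fun p hp => ?_
      by_contra hne
      have h1 : η p.2.2 ≠ 0 := fun h => hne (by simp [h])
      have h2 : χ n p ≠ 0 := fun h => hne (by simp [h])
      have h3 : |p.2.2| ≤ L := by
        by_contra h
        exact h1 (hη0 _ (not_le.1 h).le)
      obtain ⟨h4, h5⟩ := hR p h2
      exact hp ⟨abs_le.1 h4, abs_le.1 h5, abs_le.1 h3⟩
    have h := hdiv _ hθ hθc
    rw [key n e₁ g₁ hg₁ h₁ h₁', key n e₂ g₂ hg₂ h₂ h₂'] at h
    rw [← h, ← (hηint _ (hχb n (hbper hg₀)) (hχi n h₀)).2]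
    congr 1
    funext p
    ring
  obtain ⟨C₁, hC₁⟩ := hχd e₁
  obtain ⟨C₂, hC₂⟩ := hχd e₂
  have hlim := ((tendsto_setIntegral_deriv_cutoff hC₁ h₁).add
    (tendsto_setIntegral_cutoff (fun n => (hχ n).continuous) hχ1 hχl h₁')).add
    ((tendsto_setIntegral_deriv_cutoff hC₂ h₂).add
    (tendsto_setIntegral_cutoff (fun n => (hχ n).continuous) hχ1 hχl h₂'))
  simp_rw [← hsum, zero_add] at hlim
  exact tendsto_nhds_unique
    (tendsto_setIntegral_cutoff (fun n => (hχ n).continuous) hχ1 hχl h₀) hlim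

/-! ### Completing the squares in the energy -/

theorem measurableSet_slab (L : ℝ) : MeasurableSet (slab L) :=
  measurable_snd.snd measurableSet_Ioo

namespace IsNormalizedState

variable {L : ℝ} {Ψ Ψx Ψy Ψz : ℝ × ℝ × ℝ → ℂ}

theorem periodicZ (h : IsNormalizedState L Ψ Ψx Ψy Ψz) : PeriodicZ L Ψ := by
  filter_upwards [h.periodic] with p hp
  rw [← hp]
  congr 1
  ext <;> simp

theorem locallyL2 (h : IsNormalizedState L Ψ Ψx Ψy Ψz) (hL : 0 < L) :
    LocallyL2 Ψ ∧ LocallyL2 Ψx ∧ LocallyL2 Ψy ∧ LocallyL2 Ψz :=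
  ⟨.of_periodic hL h.periodicZ h.weak_x.locallyIntegrable.aestronglyMeasurable h.memLp,
    .of_periodic hL (h.weak_x.periodicZ h.periodicZ)
      h.weak_x.locallyIntegrable_deriv.aestronglyMeasurable h.memLp_x,
    .of_periodic hL (h.weak_y.periodicZ h.periodicZ)
      h.weak_y.locallyIntegrable_deriv.aestronglyMeasurable h.memLp_y,
    .of_periodic hL (h.weak_z.periodicZ h.periodicZ)
      h.weak_z.locallyIntegrable_deriv.aestronglyMeasurable h.memLp_z⟩

theorem memLp_mul_of_le (h : IsNormalizedState L Ψ Ψx Ψy Ψz) {c : ℝ × ℝ × ℝ → ℝ}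
    (hc : Continuous c) (hle : ∀ p, |c p| ≤ √(p.1 ^ 2 + p.2.1 ^ 2)) :
    MemLp (fun p => (c p : ℂ) * Ψ p) 2 (volume.restrict (slab L)) := by
  refine h.memLp_weight.mono
    ((Complex.continuous_ofReal.comp hc).aestronglyMeasurable.mul h.memLp.1)
    (Eventually.of_forall fun p => ?_)
  simp only [norm_mul, Complex.norm_real, Real.norm_eq_abs, abs_of_nonneg (Real.sqrt_nonneg _)]
  exact mul_le_mul_of_nonneg_right (hle p) (norm_nonneg _)

theorem memLp_fst_mul (h : IsNormalizedState L Ψ Ψx Ψy Ψz) :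
    MemLp (fun p => (p.1 : ℂ) * Ψ p) 2 (volume.restrict (slab L)) :=
  h.memLp_mul_of_le continuous_fst fun _ =>
    Real.abs_le_sqrt (le_add_of_nonneg_right (sq_nonneg _))

theorem memLp_snd_mul (h : IsNormalizedState L Ψ Ψx Ψy Ψz) :
    MemLp (fun p => (p.2.1 : ℂ) * Ψ p) 2 (volume.restrict (slab L)) :=
  h.memLp_mul_of_le (c := fun p => p.2.1) (by fun_prop) fun _ =>
    Real.abs_le_sqrt (le_add_of_nonneg_left (sq_nonneg _))

/-- Integration by parts on the slab for the density `|Ψ|²`. -/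
theorem integral_density (h : IsNormalizedState L Ψ Ψx Ψy Ψz) (hL : 0 < L) {e : ℝ × ℝ × ℝ}
    {u : ℝ × ℝ × ℝ → ℂ} (hu : HasWeakDeriv e Ψ u) (hu2 : MemLp u 2 (volume.restrict (slab L)))
    {b : ℝ × ℝ × ℝ → ℝ}
    (hb : ContDiff ℝ ∞ b) (hbp : ∀ p, b (p + (0, 0, L)) = b p)
    (hbΨ : MemLp (fun p => (b p : ℂ) * Ψ p) 2 (volume.restrict (slab L)))
    (hbd : IntegrableOn (fun p => fderiv ℝ b p e * ‖Ψ p‖ ^ 2) (slab L)) :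
    IntegrableOn (fun p => b p * inner ℝ (Ψ p) (u p)) (slab L) ∧
      ∫ p in slab L, b p * inner ℝ (Ψ p) (u p)
        = -(1 / 2) * ∫ p in slab L, fderiv ℝ b p e * ‖Ψ p‖ ^ 2 := by
  have hpu := hu.periodicZ h.periodicZ
  have huL : LocallyL2 u := .of_periodic hL hpu hu.locallyIntegrable_deriv.aestronglyMeasurable hu2
  have hmul : ∀ (r : ℝ) (z v : ℂ), inner ℝ ((r : ℂ) * z) v = r * inner ℝ z v := fun r z v => by
    rw [← Complex.real_smul, real_inner_smul_left]
  have hi : IntegrableOn (fun p => b p * inner ℝ (Ψ p) (u p)) (slab L) := by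
    have := integrable_inner_of_memLp hbΨ hu2
    simpa only [hmul] using! this
  have hi2 : IntegrableOn (fun p => b p * ‖Ψ p‖ ^ 2) (slab L) := by
    have := integrable_inner_of_memLp hbΨ h.memLp
    simpa only [hmul, real_inner_self_eq_norm_sq] using! this
  refine ⟨hi, ?_⟩
  have key := setIntegral_slab_eq hL (e₁ := e) (e₂ := 0)
    (g₀ := fun p => -(2 * inner ℝ (Ψ p) (u p))) (g₁ := fun p => ‖Ψ p‖ ^ 2) (g₂ := fun _ => 0)
    (b := b) (h.periodicZ.comp₂ hpu fun z v => -(2 * inner ℝ z v))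
    (h.periodicZ.comp fun z => ‖z‖ ^ 2) (.of_forall fun _ => rfl)
    (fun θ hθ hθc => by
      rw [hu.integral_fderiv_mul_norm_sq (h.locallyL2 hL).1 huL hθ hθc, ← integral_neg]
      simp)
    hb hbp (by simpa [mul_left_comm] using! (hi.const_mul 2).neg) hi2 (by simp) hbd (by simp)
  have e1 : ∫ p in slab L, b p * -(2 * inner ℝ (Ψ p) (u p))
      = -(2 * ∫ p in slab L, b p * inner ℝ (Ψ p) (u p)) := by
    rw [← integral_const_mul, ← integral_neg]
    congr 1
    funext p
    ring
  rw [e1] at key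
  simp only [mul_zero, integral_zero, add_zero] at key
  linarith

/-- The vorticity density `⟨iΨ_x, Ψ_y⟩` is a divergence, hence has zero mean. -/
theorem integral_vorticity (h : IsNormalizedState L Ψ Ψx Ψy Ψz) (hL : 0 < L) :
    IntegrableOn (fun p => inner ℝ (Complex.I * Ψx p) (Ψy p)) (slab L) ∧
      ∫ p in slab L, inner ℝ (Complex.I * Ψx p) (Ψy p) = 0 := by
  obtain ⟨hΨ, hΨx, hΨy, -⟩ := h.locallyL2 hL
  have hpx := h.weak_x.periodicZ h.periodicZ
  have hpy := h.weak_y.periodicZ h.periodicZ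
  have hi := integrable_inner_of_memLp (h.memLp_x.const_mul Complex.I) h.memLp_y
  have hix := integrable_inner_of_memLp (h.memLp_x.const_mul Complex.I) h.memLp
  have hiy := integrable_inner_of_memLp (h.memLp_y.const_mul Complex.I) h.memLp
  refine ⟨hi, ?_⟩
  have key := setIntegral_slab_eq hL (e₁ := (1, 0, 0)) (e₂ := (0, 1, 0))
    (g₀ := fun p => 2 * inner ℝ (Complex.I * Ψx p) (Ψy p))
    (g₁ := fun p => inner ℝ (Complex.I * Ψy p) (Ψ p))
    (g₂ := fun p => -inner ℝ (Complex.I * Ψx p) (Ψ p)) (b := fun _ => 1)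
    (hpx.comp₂ hpy fun z v => 2 * inner ℝ (Complex.I * z) v)
    (hpy.comp₂ h.periodicZ fun z v => inner ℝ (Complex.I * z) v)
    (hpx.comp₂ h.periodicZ fun z v => -inner ℝ (Complex.I * z) v)
    (fun θ hθ hθc => by
      rw [integral_jacobian h.weak_x h.weak_y hΨ hΨx hΨy hθ hθc]
      simp only [mul_neg, integral_neg, sub_eq_add_neg])
    contDiff_const (fun _ => rfl) (by simpa using! hi.const_mul 2) (by simpa using! hiy)
    (by simp only [one_mul]; exact hix.neg) (by simp) (by simp)
  simp only [fderiv_fun_const, one_mul, Pi.zero_apply, _root_.zero_apply, zero_mul, integral_zero,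
    add_zero, integral_const_mul] at key
  linarith

end IsNormalizedState

/-- Pointwise completion of the squares. The vector `(X, Y, Z)` stands for the gradient of `Ψ` and
`a` for the logarithmic derivative of the longitudinal ground state. -/
theorem energy_density_eq {ωperp Ω : ℝ} (hω : ωperp ≠ 0) (x y a W : ℝ) (ψ X Y Z : ℂ) :
    (1 / 2) * (‖X - Complex.I * (Ω * (-y) : ℝ) * ψ‖ ^ 2
        + ‖Y - Complex.I * (Ω * x : ℝ) * ψ‖ ^ 2 + ‖Z‖ ^ 2)
      - (1 / 2) * Ω ^ 2 * (x ^ 2 + y ^ 2) * ‖ψ‖ ^ 2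
      + ((1 / 2) * ωperp ^ 2 * (x ^ 2 + y ^ 2) + W) * ‖ψ‖ ^ 2
    = ((1 / 2) * ‖X + ωperp * (x * ψ)‖ ^ 2 + (1 / 2) * ‖Y + ωperp * (y * ψ)‖ ^ 2
        - Ω / ωperp * inner ℝ (Complex.I * (X + ωperp * (x * ψ))) (Y + ωperp * (y * ψ))
        + (1 / 2) * ‖Z - a * ψ‖ ^ 2)
      + (Ω / ωperp * inner ℝ (Complex.I * X) Y - ωperp * (x * inner ℝ ψ X)
        - ωperp * (y * inner ℝ ψ Y)
        + a * inner ℝ ψ Z + (W - (1 / 2) * a ^ 2) * ‖ψ‖ ^ 2) := by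
  obtain ⟨s, rfl⟩ : ∃ s, Ω = s * ωperp := ⟨Ω / ωperp, by field_simp⟩
  rw [mul_div_cancel_right₀ _ hω]
  simp only [Complex.sq_norm, Complex.normSq_apply, Complex.inner, Complex.add_re, Complex.add_im,
    Complex.sub_re, Complex.sub_im, Complex.mul_re, Complex.mul_im, Complex.I_re, Complex.I_im,
    Complex.ofReal_re, Complex.ofReal_im, Complex.conj_re, Complex.conj_im]
  ring

/-- The cross term is absorbed by the squares because the rotation is subcritical: here `s` stands
for `Ω / ω⊥ ≤ 1`. -/
theorem squares_nonneg {s : ℝ} (hs0 : 0 ≤ s) (hs1 : s ≤ 1) (X Y : ℂ) :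
    0 ≤ (1 / 2) * ‖X‖ ^ 2 + (1 / 2) * ‖Y‖ ^ 2 - s * inner ℝ (Complex.I * X) Y := by
  have h1 : inner ℝ (Complex.I * X) Y ≤ ‖X‖ * ‖Y‖ := by
    simpa using real_inner_le_norm (Complex.I * X) Y
  have h2 : s * inner ℝ (Complex.I * X) Y ≤ s * (‖X‖ * ‖Y‖) := mul_le_mul_of_nonneg_left h1 hs0
  have h3 : s * (‖X‖ * ‖Y‖) ≤ ‖X‖ * ‖Y‖ := mul_le_of_le_one_left (by positivity) hs1
  nlinarith [sq_nonneg (‖X‖ - ‖Y‖)]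

/-- The density of the excess of the linear energy over its minimum `λ + ω⊥`. It is a quadratic
expression in `Ψx + ω⊥ x Ψ`, `Ψy + ω⊥ y Ψ` and `Ψz - a Ψ`, positive semi-definite for
`0 ≤ Ω ≤ ω⊥`. -/
noncomputable def squareDensity (ωperp Ω : ℝ) (a : ℝ → ℝ) (Ψ Ψx Ψy Ψz : ℝ × ℝ × ℝ → ℂ)
    (p : ℝ × ℝ × ℝ) : ℝ :=
  (1 / 2) * ‖Ψx p + ωperp * (p.1 * Ψ p)‖ ^ 2 + (1 / 2) * ‖Ψy p + ωperp * (p.2.1 * Ψ p)‖ ^ 2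
    - Ω / ωperp * inner ℝ (Complex.I * (Ψx p + ωperp * (p.1 * Ψ p))) (Ψy p + ωperp * (p.2.1 * Ψ p))
    + (1 / 2) * ‖Ψz p - a p.2.2 * Ψ p‖ ^ 2

theorem squareDensity_nonneg {ωperp Ω : ℝ} (hΩ : 0 ≤ Ω) (hω : Ω < ωperp) (a : ℝ → ℝ)
    (Ψ Ψx Ψy Ψz : ℝ × ℝ × ℝ → ℂ) (p : ℝ × ℝ × ℝ) : 0 ≤ squareDensity ωperp Ω a Ψ Ψx Ψy Ψz p := by
  have hω0 : 0 < ωperp := hΩ.trans_lt hω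
  have := squares_nonneg (div_nonneg hΩ hω0.le) ((div_le_one hω0).2 hω.le)
    (Ψx p + ωperp * (p.1 * Ψ p)) (Ψy p + ωperp * (p.2.1 * Ψ p))
  unfold squareDensity
  positivity

/-- The linear part of the energy of a normalized state is `λ + ω⊥` plus the integral of
`squareDensity`. -/
theorem IsNormalizedState.energy_eq {T : ℝ} {w : ℝ → ℝ} (hw : IsLatticeProfile T w) {N : ℕ}
    (hN : 1 ≤ N) {ε lam ωperp Ω : ℝ} (hω : 0 < ωperp) {f : ℝ → ℝ}
    (hf : IsPositiveSolution T w ε lam f)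
    {Ψ Ψx Ψy Ψz : ℝ × ℝ × ℝ → ℂ} (h : IsNormalizedState (N * T) Ψ Ψx Ψy Ψz) (g : ℝ) :
    energy (N * T) w ε g ωperp Ω Ψ Ψx Ψy Ψz
      = lam + ωperp + (∫ p in slab (N * T), squareDensity ωperp Ω (logDeriv f) Ψ Ψx Ψy Ψz p)
        + g * ∫ p in slab (N * T), ‖Ψ p‖ ^ 4 := by
  have hT := hw.period_pos
  set L : ℝ := N * T with hLdef
  have hL : 0 < L := mul_pos (by exact_mod_cast hN) hT
  set a := logDeriv f with ha
  have hac : ContDiff ℝ ∞ a := hf.contDiff_logDeriv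
  have hap : ∀ z, a (z + T) = a z := hf.logDeriv_periodic
  have hapL : ∀ z, a (z + L) = a z := fun z => (Function.Periodic.nat_mul hap N) z
  have hda : ∀ z, HasDerivAt a (2 * (latticePotential w ε z - lam) - a z ^ 2) z :=
    hf.hasDerivAt_logDeriv
  obtain ⟨A, -, hA⟩ := exists_abs_le_of_periodic hT hac.continuous hap
  obtain ⟨B, -, hB⟩ := exists_abs_le_of_periodic hT (hw.contDiff_potential ε).continuous
    (hw.potential_periodic ε)
  have hΨ2 : IntegrableOn (fun p => ‖Ψ p‖ ^ 2) (slab L) :=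
    h.memLp.integrable_norm_pow (by norm_num)
  have hsq : ∀ {u : ℝ × ℝ × ℝ → ℂ}, MemLp u 2 (volume.restrict (slab L)) →
      Integrable (fun p => ‖u p‖ ^ 2) (volume.restrict (slab L)) :=
    fun hu => hu.integrable_norm_pow (by norm_num)
  have hzbdd : ∀ {c : ℝ → ℝ} {M : ℝ}, Continuous c → (∀ z, |c z| ≤ M) →
      IntegrableOn (fun p => c p.2.2 * ‖Ψ p‖ ^ 2) (slab L) := fun hc hM =>
    hΨ2.bdd_mul (hc.comp (by fun_prop)).aestronglyMeasurable
      (Eventually.of_forall fun p => hM _)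
  have haΨ : MemLp (fun p => (a p.2.2 : ℂ) * Ψ p) 2 (volume.restrict (slab L)) := by
    refine h.memLp.of_le_mul (c := A) ((Complex.continuous_ofReal.comp
      (hac.continuous.comp (by fun_prop))).aestronglyMeasurable.mul h.memLp.1)
      (Eventually.of_forall fun p => ?_)
    rw [norm_mul, Complex.norm_real]
    exact mul_le_mul_of_nonneg_right (hA _) (norm_nonneg _)
  have hfy : ∀ p : ℝ × ℝ × ℝ, fderiv ℝ (fun p : ℝ × ℝ × ℝ => p.2.1) p (0, 1, 0) = 1 := fun p => by
    rw [fderiv.fst (by fun_prop)]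
    simp [fderiv_snd]
  -- integration by parts in the three directions
  obtain ⟨ix, jx⟩ := h.integral_density hL h.weak_x h.memLp_x (b := fun p => p.1) (by fun_prop)
    (fun _ => by simp) h.memLp_fst_mul (by simpa [fderiv_fst] using! hΨ2)
  obtain ⟨iy, jy⟩ := h.integral_density hL h.weak_y h.memLp_y (b := fun p => p.2.1) (by fun_prop)
    (fun _ => by simp) h.memLp_snd_mul (by simpa [hfy] using! hΨ2)
  have hfd : ∀ p : ℝ × ℝ × ℝ, fderiv ℝ (fun p : ℝ × ℝ × ℝ => a p.2.2) p (0, 0, 1)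
      = 2 * (latticePotential w ε p.2.2 - lam) - a p.2.2 ^ 2 := fun p => by
    have h1 : HasFDerivAt (fun p : ℝ × ℝ × ℝ => a p.2.2) _ p :=
      (hda p.2.2).hasFDerivAt.comp p ((ContinuousLinearMap.snd ℝ ℝ ℝ).comp
        (ContinuousLinearMap.snd ℝ ℝ (ℝ × ℝ))).hasFDerivAt
    rw [h1.fderiv]
    simp
  have hWc := (hw.contDiff_potential ε).continuous
  have hcd : Continuous fun z => 2 * (latticePotential w ε z - lam) - a z ^ 2 := by
    have := hac.continuous
    fun_prop
  have hcW : Continuous fun z => latticePotential w ε z - 1 / 2 * a z ^ 2 := by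
    have := hac.continuous
    fun_prop
  obtain ⟨M₁, -, hM₁⟩ := exists_abs_le_of_periodic hT hcd
    fun z => by rw [hap, hw.potential_periodic]
  obtain ⟨M₂, -, hM₂⟩ := exists_abs_le_of_periodic hT hcW
    fun z => by rw [hap, hw.potential_periodic]
  have hi₁ := hzbdd hcd hM₁
  have hi₂ := hzbdd hcW hM₂
  obtain ⟨iz, jz⟩ := h.integral_density hL h.weak_z h.memLp_z (b := fun p => a p.2.2)
    (hac.comp (by fun_prop)) (fun p => by simp [hapL]) haΨ (by simpa only [hfd] using! hi₁)
  obtain ⟨iv, jv⟩ := h.integral_vorticity hL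
  simp only [hfd] at jz
  have hfx : ∀ p : ℝ × ℝ × ℝ, fderiv ℝ (fun p : ℝ × ℝ × ℝ => p.1) p (1, 0, 0) = 1 := fun p => by
    simp [fderiv_fst]
  simp only [hfx, hfy, one_mul, h.normalized, mul_one] at jx jy
  have hX : MemLp (fun p => Ψx p + ωperp * (p.1 * Ψ p)) 2 (volume.restrict (slab L)) :=
    h.memLp_x.add (h.memLp_fst_mul.const_mul _)
  have hY : MemLp (fun p => Ψy p + ωperp * (p.2.1 * Ψ p)) 2 (volume.restrict (slab L)) :=
    h.memLp_y.add (h.memLp_snd_mul.const_mul _)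
  have hZ : MemLp (fun p => Ψz p - a p.2.2 * Ψ p) 2 (volume.restrict (slab L)) :=
    h.memLp_z.sub haΨ
  have hQ : IntegrableOn (squareDensity ωperp Ω a Ψ Ψx Ψy Ψz) (slab L) :=
    ((((hsq hX).const_mul _).add ((hsq hY).const_mul _)).sub
      ((integrable_inner_of_memLp (hX.const_mul Complex.I) hY).const_mul _)).add
      ((hsq hZ).const_mul _)
  have k1 : IntegrableOn (fun p => Ω / ωperp * inner ℝ (Complex.I * Ψx p) (Ψy p)) (slab L) :=
    iv.const_mul _
  have k2 : IntegrableOn (fun p => ωperp * (p.1 * inner ℝ (Ψ p) (Ψx p))) (slab L) :=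
    ix.const_mul _
  have k3 : IntegrableOn (fun p => ωperp * (p.2.1 * inner ℝ (Ψ p) (Ψy p))) (slab L) :=
    iy.const_mul _
  have k12 : IntegrableOn (fun p => Ω / ωperp * inner ℝ (Complex.I * Ψx p) (Ψy p)
      - ωperp * (p.1 * inner ℝ (Ψ p) (Ψx p))) (slab L) := k1.sub k2
  have k123 : IntegrableOn (fun p => Ω / ωperp * inner ℝ (Complex.I * Ψx p) (Ψy p)
      - ωperp * (p.1 * inner ℝ (Ψ p) (Ψx p)) - ωperp * (p.2.1 * inner ℝ (Ψ p) (Ψy p)))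
      (slab L) := k12.sub k3
  have k1234 : IntegrableOn (fun p => Ω / ωperp * inner ℝ (Complex.I * Ψx p) (Ψy p)
      - ωperp * (p.1 * inner ℝ (Ψ p) (Ψx p)) - ωperp * (p.2.1 * inner ℝ (Ψ p) (Ψy p))
      + a p.2.2 * inner ℝ (Ψ p) (Ψz p)) (slab L) := k123.add iz
  have hR : IntegrableOn (fun p => Ω / ωperp * inner ℝ (Complex.I * Ψx p) (Ψy p)
      - ωperp * (p.1 * inner ℝ (Ψ p) (Ψx p)) - ωperp * (p.2.1 * inner ℝ (Ψ p) (Ψy p))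
      + a p.2.2 * inner ℝ (Ψ p) (Ψz p)
      + (latticePotential w ε p.2.2 - 1 / 2 * a p.2.2 ^ 2) * ‖Ψ p‖ ^ 2) (slab L) :=
    k1234.add hi₂
  -- the Riccati equation for `a` turns the potential into the constant `lam`
  have hric : (∫ p in slab L, (latticePotential w ε p.2.2 - 1 / 2 * a p.2.2 ^ 2) * ‖Ψ p‖ ^ 2)
      - 1 / 2 * ∫ p in slab L, (2 * (latticePotential w ε p.2.2 - lam) - a p.2.2 ^ 2) * ‖Ψ p‖ ^ 2
      = lam := by
    rw [← integral_const_mul, ← integral_sub hi₂ (hi₁.const_mul _)]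
    calc _ = ∫ p in slab L, lam * ‖Ψ p‖ ^ 2 := by
          congr 1
          funext p
          ring
      _ = lam := by rw [integral_const_mul, h.normalized, mul_one]
  unfold energy
  congr 1
  have hpt : ∀ p ∈ slab L, _ = squareDensity ωperp Ω a Ψ Ψx Ψy Ψz p + _ := fun p _ =>
    energy_density_eq (Ω := Ω) hω.ne' p.1 p.2.1 (a p.2.2) (latticePotential w ε p.2.2) (Ψ p) (Ψx p)
      (Ψy p) (Ψz p)
  rw [setIntegral_congr_fun (measurableSet_slab L) hpt, integral_add hQ hR]
  rw [integral_add k1234 hi₂, integral_add k123 iz, integral_sub k12 k3, integral_sub k1 k2,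
    integral_const_mul, integral_const_mul, integral_const_mul, jv, jx, jy, jz]
  linarith

/-! ### The product trial state -/

theorem hasWeakDeriv_of_contDiff {F : ℝ × ℝ × ℝ → ℝ} (hF : ContDiff ℝ 1 F) (e : ℝ × ℝ × ℝ) :
    HasWeakDeriv e (fun p => (F p : ℂ)) fun p => (fderiv ℝ F p e : ℂ) := by
  have hF' : Continuous fun p => fderiv ℝ F p e :=
    (hF.continuous_fderiv one_ne_zero).clm_apply continuous_const
  refine ⟨(Complex.continuous_ofReal.comp hF.continuous).locallyIntegrable,
    (Complex.continuous_ofReal.comp hF').locallyIntegrable, fun θ hθ hθc => ?_⟩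
  have hθ' := continuous_fderiv_apply_of_contDiff hθ e
  have h := integral_mul_fderiv_eq_neg_fderiv_mul_of_integrable (𝕜 := ℝ) (μ := volume) (f := θ)
    (g := F) (v := e)
    ((hθ'.mul hF.continuous).integrable_of_hasCompactSupport (hθc.fderiv_apply ℝ e).mul_right)
    ((hθ.continuous.mul hF').integrable_of_hasCompactSupport hθc.mul_right)
    ((hθ.continuous.mul hF.continuous).integrable_of_hasCompactSupport hθc.mul_right)
    (fun p _ => hθ.differentiable (by simp) p) (fun p _ => hF.differentiable one_ne_zero p)
  simp only [Complex.real_smul, ← Complex.ofReal_mul, integral_complex_ofReal,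
    ← Complex.ofReal_neg]
  rw [h, neg_neg]

theorem restrict_slab_eq_prod (L : ℝ) :
    (volume : Measure (ℝ × ℝ × ℝ)).restrict (slab L)
      = (volume : Measure ℝ).prod ((volume : Measure ℝ).prod
          (volume.restrict (Set.Ioo (-(L / 2)) (L / 2)))) := by
  have h : slab L = Set.univ ×ˢ (Set.univ ×ˢ Set.Ioo (-(L / 2)) (L / 2)) := by
    ext p
    simp [slab]
  rw [h, Measure.volume_eq_prod, ← Measure.prod_restrict, Measure.volume_eq_prod,
    ← Measure.prod_restrict, Measure.restrict_univ]

theorem integrableOn_slab_mul {L : ℝ} {q r s : ℝ → ℝ} (hq : Integrable q) (hr : Integrable r)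
    (hs : Continuous s) : IntegrableOn (fun p => q p.1 * (r p.2.1 * s p.2.2)) (slab L) := by
  have hs' : Integrable s (volume.restrict (Set.Ioo (-(L / 2)) (L / 2))) :=
    (hs.integrableOn_Icc (a := -(L / 2)) (b := L / 2)).mono_set Set.Ioo_subset_Icc_self
  rw [IntegrableOn, restrict_slab_eq_prod]
  exact hq.mul_prod (hr.mul_prod hs')

theorem integral_slab_mul {L : ℝ} (hL : 0 < L) (q r s : ℝ → ℝ) :
    ∫ p in slab L, q p.1 * (r p.2.1 * s p.2.2)
      = (∫ x, q x) * ((∫ y, r y) * ∫ z in (-(L / 2))..(L / 2), s z) := by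
  rw [restrict_slab_eq_prod, integral_prod_mul q fun p : ℝ × ℝ => r p.1 * s p.2,
    integral_prod_mul r s, ← integral_Ioc_eq_integral_Ioo,
    intervalIntegral.integral_of_le (by linarith)]

theorem integral_periods {T : ℝ} {s : ℝ → ℝ} (hsc : Continuous s)
    (hs : ∀ z, s (z + T) = s z) (N : ℕ) :
    ∫ z in (-(N * T / 2))..(N * T / 2), s z = N * ∫ z in (-(T / 2))..(T / 2), s z := by
  have hp : Function.Periodic s T := hs
  have h1 := hp.intervalIntegral_add_zsmul_eq (N : ℤ) (-(N * T / 2))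
    fun _ _ => hsc.intervalIntegrable _ _
  have h2 := hp.intervalIntegral_add_eq (-(N * T / 2)) (-(T / 2))
  simp only [zsmul_eq_mul, Int.cast_natCast] at h1
  rw [h2] at h1
  convert h1 using 2 <;> ring_nf

/-- The product of the transverse harmonic oscillator ground state and the longitudinal state `f`,
normalized on `N` periods. -/
noncomputable def productState (N : ℕ) (ωperp : ℝ) (f : ℝ → ℝ) (p : ℝ × ℝ × ℝ) : ℝ :=
  √(ωperp / (Real.pi * N)) *
    (Real.exp (-(ωperp / 2) * p.1 ^ 2) * (Real.exp (-(ωperp / 2) * p.2.1 ^ 2) * f p.2.2))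

theorem productState_pow (N : ℕ) (ωperp : ℝ) (f : ℝ → ℝ) (p : ℝ × ℝ × ℝ) (k : ℕ) :
    productState N ωperp f p ^ k = √(ωperp / (Real.pi * N)) ^ k *
      (Real.exp (-(k * (ωperp / 2)) * p.1 ^ 2) *
        (Real.exp (-(k * (ωperp / 2)) * p.2.1 ^ 2) * f p.2.2 ^ k)) := by
  have h : ∀ t : ℝ, Real.exp (-(ωperp / 2) * t ^ 2) ^ k
      = Real.exp (-(k * (ωperp / 2)) * t ^ 2) := fun t => by
    rw [← Real.exp_nat_mul]
    ring_nf
  rw [productState, mul_pow, mul_pow, mul_pow, h, h]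

section

variable {T : ℝ} {w : ℝ → ℝ} {ε lam ωperp : ℝ} {f : ℝ → ℝ} {N : ℕ}

theorem contDiff_productState (hf : IsPositiveSolution T w ε lam f) :
    ContDiff ℝ ∞ (productState N ωperp f) := by
  have h : ContDiff ℝ ∞ fun p : ℝ × ℝ × ℝ => f p.2.2 := hf.contDiff.comp (by fun_prop)
  have h1 : ContDiff ℝ ∞ fun p : ℝ × ℝ × ℝ => Real.exp (-(ωperp / 2) * p.1 ^ 2) :=
    Real.contDiff_exp.comp (by fun_prop)
  have h2 : ContDiff ℝ ∞ fun p : ℝ × ℝ × ℝ => Real.exp (-(ωperp / 2) * p.2.1 ^ 2) :=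
    Real.contDiff_exp.comp (by fun_prop)
  exact contDiff_const.mul (h1.mul (h2.mul h))

theorem fderiv_productState (hf : IsPositiveSolution T w ε lam f) (p e : ℝ × ℝ × ℝ) :
    fderiv ℝ (productState N ωperp f) p e
      = (-(ωperp * p.1) * e.1 - ωperp * p.2.1 * e.2.1 + logDeriv f p.2.2 * e.2.2)
        * productState N ωperp f p := by
  have hg : ∀ t : ℝ, HasDerivAt (fun t => Real.exp (-(ωperp / 2) * t ^ 2))
      (-(ωperp * t) * Real.exp (-(ωperp / 2) * t ^ 2)) t := fun t => by
    have := ((hasDerivAt_pow 2 t).const_mul (-(ωperp / 2))).exp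
    convert! this using 1
    simp
    ring
  have h1 : HasFDerivAt (fun p : ℝ × ℝ × ℝ => Real.exp (-(ωperp / 2) * p.1 ^ 2)) _ p :=
    (hg p.1).hasFDerivAt.comp p (ContinuousLinearMap.fst ℝ ℝ (ℝ × ℝ)).hasFDerivAt
  have h2 : HasFDerivAt (fun p : ℝ × ℝ × ℝ => Real.exp (-(ωperp / 2) * p.2.1 ^ 2)) _ p :=
    HasFDerivAt.comp (g := fun t => Real.exp (-(ωperp / 2) * t ^ 2))
      (f := fun p : ℝ × ℝ × ℝ => p.2.1) p (hg p.2.1).hasFDerivAt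
        ((ContinuousLinearMap.fst ℝ ℝ ℝ).comp
      (ContinuousLinearMap.snd ℝ ℝ (ℝ × ℝ))).hasFDerivAt
  have h3 : HasFDerivAt (fun p : ℝ × ℝ × ℝ => f p.2.2) _ p :=
    (hf.hasDerivAt p.2.2).hasFDerivAt.comp p ((ContinuousLinearMap.snd ℝ ℝ ℝ).comp
      (ContinuousLinearMap.snd ℝ ℝ (ℝ × ℝ))).hasFDerivAt
  have h4 : HasFDerivAt (productState N ωperp f) _ p :=
    (h1.mul (h2.mul h3)).const_mul (√(ωperp / (Real.pi * N)))
  rw [h4.fderiv]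
  have hne := (hf.pos p.2.2).ne'
  simp [productState, logDeriv_apply]
  field_simp
  ring

theorem memLp_mul_productState (hf : IsPositiveSolution T w ε lam f) (hω : 0 < ωperp)
    {c : ℝ × ℝ × ℝ → ℝ} (hc : Continuous c) {M : ℝ}
    (hM : ∀ p, c p ^ 2 ≤ M * (p.1 ^ 2 + p.2.1 ^ 2 + 1)) (L : ℝ) :
    MemLp (fun p => ((c p * productState N ωperp f p : ℝ) : ℂ)) 2 (volume.restrict (slab L)) := by
  have hcont : Continuous (productState N ωperp f) := (contDiff_productState hf).continuous
  have hF : Continuous fun p => ((c p * productState N ωperp f p : ℝ) : ℂ) := by fun_prop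
  have hfc : Continuous fun z => f z ^ 2 := hf.contDiff.continuous.pow 2
  rw [memLp_two_iff_integrable_sq_norm hF.aestronglyMeasurable]
  have g0 : Integrable fun t : ℝ => Real.exp (-ωperp * t ^ 2) := integrable_exp_neg_mul_sq hω
  have g2 : Integrable fun t : ℝ => t ^ 2 * Real.exp (-ωperp * t ^ 2) := by
    simpa using integrable_rpow_mul_exp_neg_mul_sq hω (s := 2) (by norm_num)
  have hdom := ((((integrableOn_slab_mul (L := L) g2 g0 hfc).add
    (integrableOn_slab_mul (L := L) g0 g2 hfc)).add
    (integrableOn_slab_mul (L := L) g0 g0 hfc)).const_mul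
      (√(ωperp / (Real.pi * N)) ^ 2)).const_mul M
  refine Integrable.mono' hdom (by fun_prop) (Eventually.of_forall fun p => ?_)
  rw [Real.norm_of_nonneg (sq_nonneg _), Complex.norm_real, Real.norm_eq_abs, sq_abs, mul_pow]
  refine (mul_le_mul_of_nonneg_right (hM p) (sq_nonneg _)).trans_eq ?_
  rw [productState_pow]
  have e : -(((2 : ℕ) : ℝ) * (ωperp / 2)) = -ωperp := by push_cast; ring
  simp only [e, Pi.add_apply]
  ring

theorem integral_productState_pow (hN : 1 ≤ N) (hT : 0 < T)
    (hf : IsPositiveSolution T w ε lam f) {k : ℕ} :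
    ∫ p in slab (N * T), productState N ωperp f p ^ k
      = √(ωperp / (Real.pi * N)) ^ k * (√(Real.pi / (k * (ωperp / 2))) ^ 2 *
        (N * ∫ z in (-(T / 2))..(T / 2), f z ^ k)) := by
  have hL : 0 < N * T := mul_pos (by exact_mod_cast hN) hT
  simp_rw [productState_pow, integral_const_mul]
  rw [integral_slab_mul hL (fun x => Real.exp (-(k * (ωperp / 2)) * x ^ 2))
    (fun x => Real.exp (-(k * (ωperp / 2)) * x ^ 2)) (fun z => f z ^ k), integral_gaussian,
    integral_periods (s := fun z => f z ^ k) (hf.contDiff.continuous.pow k)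
      (fun z => by rw [hf.periodic])]
  ring

/-- The product state is admissible; its weak gradient is its classical one. -/
theorem isNormalizedState_productState (hw : IsLatticeProfile T w) (hN : 1 ≤ N) (hω : 0 < ωperp)
    (hf : IsPositiveSolution T w ε lam f)
    (hnorm : ∫ z in (-(T / 2))..(T / 2), f z ^ 2 = 1) :
    IsNormalizedState (N * T) (fun p => (productState N ωperp f p : ℂ))
      (fun p => ((-(ωperp * p.1) * productState N ωperp f p : ℝ) : ℂ))
      (fun p => ((-(ωperp * p.2.1) * productState N ωperp f p : ℝ) : ℂ))
      (fun p => ((logDeriv f p.2.2 * productState N ωperp f p : ℝ) : ℂ)) := by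
  have hT := hw.period_pos
  have hN0 : (0 : ℝ) < N := by exact_mod_cast hN
  have hfd := fun p e => fderiv_productState (N := N) (ωperp := ωperp) hf p e
  have hwd := fun e => hasWeakDeriv_of_contDiff
    ((contDiff_productState (N := N) (ωperp := ωperp) hf).of_le (by simp)) e
  have hac := hf.contDiff_logDeriv.continuous
  obtain ⟨A, -, hA⟩ := exists_abs_le_of_periodic hT hac hf.logDeriv_periodic
  have hfL : ∀ z, f (z + N * T) = f z := fun z =>
    (Function.Periodic.nat_mul (show Function.Periodic f T from hf.periodic) N) z
  refine ⟨Eventually.of_forall fun p => ?_, ?_, ?_, ?_, ?_, ?_, ?_, ?_, ?_, ?_⟩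
  · simp only [productState, hfL]
  · have := hwd (1, 0, 0)
    simpa [hfd] using! this
  · have := hwd (0, 1, 0)
    simpa [hfd] using! this
  · have := hwd (0, 0, 1)
    simpa [hfd] using! this
  · have := memLp_mul_productState (N := N) hf hω (c := fun _ => 1) continuous_const (M := 1)
      (fun p => by nlinarith [sq_nonneg p.1, sq_nonneg p.2.1]) (N * T)
    simpa only [one_mul] using this
  · refine memLp_mul_productState hf hω (c := fun p => -(ωperp * p.1)) (by fun_prop)
      (M := ωperp ^ 2) (fun p => ?_) _
    nlinarith [sq_nonneg (ωperp * p.2.1), sq_nonneg ωperp]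
  · refine memLp_mul_productState hf hω (c := fun p => -(ωperp * p.2.1)) (by fun_prop)
      (M := ωperp ^ 2) (fun p => ?_) _
    nlinarith [sq_nonneg (ωperp * p.1), sq_nonneg ωperp]
  · refine memLp_mul_productState hf hω (c := fun p => logDeriv f p.2.2) (by fun_prop)
      (M := A ^ 2) (fun p => ?_) _
    have := sq_le_sq' (abs_le.1 (hA p.2.2)).1 (abs_le.1 (hA p.2.2)).2
    nlinarith [sq_nonneg (A * p.1), sq_nonneg (A * p.2.1)]
  · have := memLp_mul_productState (N := N) hf hω (c := fun p => √(p.1 ^ 2 + p.2.1 ^ 2))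
      (by fun_prop) (M := 1)
      (fun p => by rw [Real.sq_sqrt (by positivity)]; linarith) (N * T)
    simpa only [Complex.ofReal_mul] using this
  · simp only [Complex.norm_real, Real.norm_eq_abs, sq_abs]
    rw [integral_productState_pow hN hT hf, hnorm, Real.sq_sqrt (by positivity),
      Real.sq_sqrt (by positivity)]
    have := Real.pi_pos.ne'
    push_cast
    field_simp

/-- All the squares vanish for the product state, whose energy is therefore `λ + ω⊥` plus the
interaction energy. -/
theorem energy_productState (hw : IsLatticeProfile T w) (hN : 1 ≤ N) (hω : 0 < ωperp)
    (hf : IsPositiveSolution T w ε lam f)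
    (hnorm : ∫ z in (-(T / 2))..(T / 2), f z ^ 2 = 1) (g Ω : ℝ) :
    energy (N * T) w ε g ωperp Ω (fun p => (productState N ωperp f p : ℂ))
      (fun p => ((-(ωperp * p.1) * productState N ωperp f p : ℝ) : ℂ))
      (fun p => ((-(ωperp * p.2.1) * productState N ωperp f p : ℝ) : ℂ))
      (fun p => ((logDeriv f p.2.2 * productState N ωperp f p : ℝ) : ℂ))
      = lam + ωperp + g * ωperp / (2 * N * Real.pi) * ∫ z in (-(T / 2))..(T / 2), f z ^ 4 := by
  have hN0 : (0 : ℝ) < N := by exact_mod_cast hN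
  rw [(isNormalizedState_productState hw hN hω hf hnorm).energy_eq hw hN hω hf]
  have h0 : ∀ p, squareDensity ωperp Ω (logDeriv f) (fun p => (productState N ωperp f p : ℂ))
      (fun p => ((-(ωperp * p.1) * productState N ωperp f p : ℝ) : ℂ))
      (fun p => ((-(ωperp * p.2.1) * productState N ωperp f p : ℝ) : ℂ))
      (fun p => ((logDeriv f p.2.2 * productState N ωperp f p : ℝ) : ℂ)) p = 0 := fun p => by
    have e1 : ∀ t : ℝ, ((-(ωperp * t) * productState N ωperp f p : ℝ) : ℂ)
        + ωperp * (t * productState N ωperp f p) = 0 := fun t => by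
      push_cast
      ring
    simp only [squareDensity, e1]
    simp
  have h4 : ∀ p, ‖(productState N ωperp f p : ℂ)‖ ^ 4 = productState N ωperp f p ^ 4 := fun p => by
    rw [Complex.norm_real, Real.norm_eq_abs, (by decide : Even 4).pow_abs]
  simp only [h0, h4, integral_zero, add_zero]
  rw [integral_productState_pow hN hw.period_pos hf, Real.sq_sqrt (by positivity),
    show √(ωperp / (Real.pi * N)) ^ 4 = (√(ωperp / (Real.pi * N)) ^ 2) ^ 2 by ring,
    Real.sq_sqrt (by positivity)]
  have := Real.pi_pos.ne'
  push_cast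
  field_simp
  ring

end

/-! ### The universal bounds -/

theorem le_groundEnergy {T : ℝ} {w : ℝ → ℝ} (hw : IsLatticeProfile T w) {N : ℕ} (hN : 1 ≤ N)
    (ε : ℝ) {g ωperp Ω : ℝ} (hg : 0 ≤ g) (hΩ : 0 ≤ Ω) (hω : Ω < ωperp) :
    lambdaOne T w ε + ωperp ≤ groundEnergy T w N ε g ωperp Ω := by
  obtain ⟨-, f, hf, hnorm⟩ := exists_positive_groundState hw ε
  have hω0 := hΩ.trans_lt hω
  refine le_csInf ⟨_, _, _, _, _, isNormalizedState_productState hw hN hω0 hf hnorm, rfl⟩ ?_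
  rintro _ ⟨Ψ, Ψx, Ψy, Ψz, h, rfl⟩
  rw [h.energy_eq hw hN hω0 hf, add_assoc]
  exact le_add_of_nonneg_right (add_nonneg
    (integral_nonneg fun p => squareDensity_nonneg hΩ hω _ _ _ _ _ p)
    (mul_nonneg hg (integral_nonneg fun p => by positivity)))

theorem groundEnergy_le {T : ℝ} {w : ℝ → ℝ} (hw : IsLatticeProfile T w) {N : ℕ} (hN : 1 ≤ N)
    {ε g ωperp Ω : ℝ} (hg : 0 ≤ g) (hΩ : 0 ≤ Ω) (hω : Ω < ωperp) {f : ℝ → ℝ}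
    (hf : IsPositiveSolution T w ε (lambdaOne T w ε) f)
    (hnorm : ∫ z in (-(T / 2))..(T / 2), f z ^ 2 = 1) :
    groundEnergy T w N ε g ωperp Ω ≤ lambdaOne T w ε + ωperp
      + g * ωperp / (2 * N * Real.pi) * ∫ z in (-(T / 2))..(T / 2), f z ^ 4 := by
  have hω0 := hΩ.trans_lt hω
  rw [← energy_productState hw hN hω0 hf hnorm g Ω]
  refine csInf_le ⟨lambdaOne T w ε + ωperp, ?_⟩
    ⟨_, _, _, _, isNormalizedState_productState hw hN hω0 hf hnorm, rfl⟩
  rintro _ ⟨Ψ, Ψx, Ψy, Ψz, h, rfl⟩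
  rw [h.energy_eq hw hN hω0 hf, add_assoc]
  exact le_add_of_nonneg_right (add_nonneg
    (integral_nonneg fun p => squareDensity_nonneg hΩ hω _ _ _ _ _ p)
    (mul_nonneg hg (integral_nonneg fun p => by positivity)))

theorem interactionEnergy_eq {T : ℝ} {w : ℝ → ℝ} (hw : IsLatticeProfile T w) {ε : ℝ} {f : ℝ → ℝ}
    (hf : IsPositiveSolution T w ε (lambdaOne T w ε) f)
    (hnorm : ∫ z in (-(T / 2))..(T / 2), f z ^ 2 = 1) {φ : ℝ → ℂ} (hφ : IsGroundState T w ε φ)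
    (N : ℕ) (g ωperp : ℝ) :
    interactionEnergy T N g ωperp φ
      = g * ωperp / (2 * N * Real.pi) * ∫ z in (-(T / 2))..(T / 2), f z ^ 4 := by
  simp only [interactionEnergy, hφ.norm_eq hw hf hnorm]

/-! ### Size of the interaction energy and the quasi-linear regime -/

section

variable {T : ℝ} {w : ℝ → ℝ} {f : ℝ → ℝ → ℝ} {g ωperp : ℝ → ℝ}

theorem isEquivalent_interaction (hw : IsLatticeProfile T w)
    (hf : ∀ ε, 0 < ε → IsPositiveSolution T w ε (lambdaOne T w ε) (f ε))
    (hnorm : ∀ ε, 0 < ε → ∫ z in (-(T / 2))..(T / 2), f ε z ^ 2 = 1) (N : ℕ) :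
    (fun ε => g ε * ωperp ε / (2 * N * Real.pi) * ∫ z in (-(T / 2))..(T / 2), f ε z ^ 4)
      ~[𝓝[>] (0 : ℝ)] fun ε =>
        (∫ y, ((√(Real.pi / kappa w))⁻¹ * Real.exp (-kappa w * y ^ 2)) ^ 2) / (2 * Real.pi)
          * (g ε * ωperp ε / N) * ε ^ (-(1 / 2) : ℝ) := by
  have hc := integral_gaussian_density_sq_pos hw.kappa_pos
  have h1 := (isEquivalent_const_iff_tendsto hc.ne').2 (tendsto_integral_pow_four hw hf hnorm)
  have h2 := (IsEquivalent.refl (u := fun ε => g ε * ωperp ε / (2 * N * Real.pi)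
    * ε ^ (-(1 / 2) : ℝ)) (l := 𝓝[>] (0 : ℝ))).mul h1
  refine (h2.congr_left ?_).congr_right ?_
  · filter_upwards [self_mem_nhdsWithin] with ε hε
    have hε0 : (0 : ℝ) < ε := hε
    have hs : ε ^ (-(1 / 2) : ℝ) * √ε = 1 := by
      rw [Real.sqrt_eq_rpow, ← Real.rpow_add hε0]
      norm_num
    simp only [Pi.mul_apply]
    rw [mul_assoc, ← mul_assoc (ε ^ (-(1 / 2) : ℝ)), hs, one_mul]
  · refine Eventually.of_forall fun ε => ?_
    simp only [Pi.mul_apply, Function.const_apply]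
    field_simp

theorem eventually_le_lambdaOne (hw : IsLatticeProfile T w) :
    ∀ᶠ ε in 𝓝[>] (0 : ℝ), kappa w / 4 * ε⁻¹ ≤ lambdaOne T w ε := by
  obtain ⟨C, hC, h⟩ := exists_semiclassicalBounds hw
  have hκ := hw.kappa_pos
  have hT := hw.period_pos
  filter_upwards [Ioc_mem_nhdsGT one_pos, Ioc_mem_nhdsGT (show 0 < (T / 2) ^ 2 by positivity),
    Ioc_mem_nhdsGT (show 0 < kappa w / (4 * C) by positivity)] with ε h1 h2 h3
  obtain ⟨-, f, hf, hnorm⟩ := exists_positive_groundState hw ε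
  have hlow := (h ε h1.1 h1.2 h2.2 _ f hf hnorm).lower
  have hε := h1.1
  have h4 : C ≤ kappa w / 4 * ε⁻¹ := by
    have := h3.2
    rw [le_div_iff₀ (by positivity)] at this
    rw [← div_eq_mul_inv, le_div_iff₀ hε]
    linarith
  have h5 : kappa w / (2 * ε) = kappa w / 4 * ε⁻¹ + kappa w / 4 * ε⁻¹ := by
    field_simp
    norm_num
  linarith

/-- In either quasi-linear regime the interaction energy is of lower order than the linear energy:
in the first it is small compared with the transverse energy `ω⊥`, in the second compared with the
longitudinal energy, which is of order `1 / ε`. -/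
theorem isLittleO_of_quasiLinear (hw : IsLatticeProfile T w) (hω : ∀ ε, 0 < ε → 0 < ωperp ε)
    (hql : g =o[𝓝[>] (0 : ℝ)] (fun ε => ε ^ (1 / 2 : ℝ)) ∨
      (fun ε => g ε * ωperp ε * ε ^ (1 / 2 : ℝ)) =o[𝓝[>] (0 : ℝ)] (fun _ => (1 : ℝ))) :
    (fun ε => g ε * ωperp ε * ε ^ (-(1 / 2) : ℝ)) =o[𝓝[>] (0 : ℝ)]
      fun ε => lambdaOne T w ε + ωperp ε := by
  have hκ := hw.kappa_pos
  rcases hql with h | h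
  · have h1 : ωperp =O[𝓝[>] (0 : ℝ)] fun ε => lambdaOne T w ε + ωperp ε := by
      refine IsBigO.of_bound 1 ?_
      filter_upwards [eventually_le_lambdaOne hw, self_mem_nhdsWithin] with ε h1 hε
      have hε0 : (0 : ℝ) < ε := hε
      have hl : 0 < lambdaOne T w ε := lt_of_lt_of_le (by positivity) h1
      have := hω ε hε0
      rw [one_mul, Real.norm_of_nonneg this.le, Real.norm_of_nonneg (by positivity)]
      linarith
    have h2 := (h.mul_isBigO h1).mul_isBigO
      (isBigO_refl (fun ε : ℝ => ε ^ (-(1 / 2) : ℝ)) (𝓝[>] (0 : ℝ)))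
    refine h2.congr' EventuallyEq.rfl ?_
    filter_upwards [self_mem_nhdsWithin] with ε hε
    have hε0 : (0 : ℝ) < ε := hε
    rw [mul_right_comm, ← Real.rpow_add hε0]
    norm_num
  · have h1 : (fun ε : ℝ => ε⁻¹) =O[𝓝[>] (0 : ℝ)] fun ε => lambdaOne T w ε + ωperp ε := by
      refine IsBigO.of_bound (4 / kappa w) ?_
      filter_upwards [eventually_le_lambdaOne hw, self_mem_nhdsWithin] with ε h1 hε
      have hε0 : (0 : ℝ) < ε := hε
      have hl : 0 < lambdaOne T w ε := lt_of_lt_of_le (by positivity) h1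
      have := hω ε hε0
      rw [Real.norm_of_nonneg (by positivity), Real.norm_of_nonneg (by positivity)]
      calc ε⁻¹ = 4 / kappa w * (kappa w / 4 * ε⁻¹) := by field_simp
        _ ≤ 4 / kappa w * (lambdaOne T w ε + ωperp ε) := by
          gcongr
          linarith
    have h2 := h.mul_isBigO h1
    refine (h2.congr' ?_ EventuallyEq.rfl).trans_eventuallyEq
      (Eventually.of_forall fun ε => one_mul _)
    filter_upwards [self_mem_nhdsWithin] with ε hε
    have hε0 : (0 : ℝ) < ε := hε
    rw [mul_assoc, ← Real.rpow_neg_one ε, ← Real.rpow_add hε0]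
    norm_num

theorem isEquivalent_groundEnergy (hw : IsLatticeProfile T w) {N : ℕ} (hN : 1 ≤ N) {Ω : ℝ → ℝ}
    (hpar : ∀ ε, 0 < ε → 0 ≤ g ε ∧ 0 ≤ Ω ε ∧ Ω ε < ωperp ε)
    (hql : g =o[𝓝[>] (0 : ℝ)] (fun ε => ε ^ (1 / 2 : ℝ)) ∨
      (fun ε => g ε * ωperp ε * ε ^ (1 / 2 : ℝ)) =o[𝓝[>] (0 : ℝ)] (fun _ => (1 : ℝ))) :
    (fun ε => groundEnergy T w N ε (g ε) (ωperp ε) (Ω ε)) ~[𝓝[>] (0 : ℝ)]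
      fun ε => lambdaOne T w ε + ωperp ε := by
  choose f hf hnorm using fun ε => (exists_positive_groundState hw ε).2
  have hlo := isLittleO_of_quasiLinear hw
    (fun ε hε => (hpar ε hε).2.1.trans_lt (hpar ε hε).2.2) hql
  have hI := (isEquivalent_interaction (g := g) (ωperp := ωperp) hw (fun ε _ => hf ε)
    (fun ε _ => hnorm ε) N).isBigO
  set c := ∫ y, ((√(Real.pi / kappa w))⁻¹ * Real.exp (-kappa w * y ^ 2)) ^ 2
  have hI' := hI.trans_isLittleO ((hlo.const_mul_left (c / (2 * Real.pi) / N)).congr_left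
    fun ε => by ring)
  -- the universal bounds enclose the difference between `0` and the interaction energy
  refine IsBigO.trans_isLittleO (IsBigO.of_bound 1 ?_) hI'
  filter_upwards [self_mem_nhdsWithin] with ε hε
  obtain ⟨hg, hΩ, hω⟩ := hpar ε hε
  have h1 := le_groundEnergy hw hN ε hg hΩ hω
  have h2 := groundEnergy_le hw hN hg hΩ hω (hf ε) (hnorm ε)
  simp only [Pi.sub_apply, one_mul]
  rw [Real.norm_of_nonneg (sub_nonneg.2 h1)]
  exact (sub_le_iff_le_add'.2 h2).trans (le_abs_self _)

end

end OpticalLattice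

theorem mainTheorem7 (T : ℝ) (w : ℝ → ℝ) (hw : IsLatticeProfile T w) :
    -- the lowest eigenvalue and the ground state of the longitudinal problem exist
    (∀ ε : ℝ, 0 < ε →
      IsLeast (periodicEigenvalues T w ε) (lambdaOne T w ε) ∧ ∃ φ₁, IsGroundState T w ε φ₁) ∧
    -- universal bounds
    (∀ N : ℕ, 1 ≤ N → ∀ ε g ωperp Ω : ℝ, 0 < ε → 0 ≤ g → 0 ≤ Ω → Ω < ωperp →
      lambdaOne T w ε + ωperp ≤ groundEnergy T w N ε g ωperp Ω ∧
      ∀ φ₁, IsGroundState T w ε φ₁ →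
        groundEnergy T w N ε g ωperp Ω
          ≤ lambdaOne T w ε + ωperp + interactionEnergy T N g ωperp φ₁) ∧
    -- size of the interaction energy, with a constant depending on `w` (and `T`) only
    (∃ c₄ : ℝ, 0 < c₄ ∧
      ∀ N : ℕ, 1 ≤ N → ∀ g ωperp : ℝ → ℝ, (∀ ε, 0 < ε → 0 ≤ g ε ∧ 0 < ωperp ε) →
        ∀ φ₁ : ℝ → ℝ → ℂ, (∀ ε, 0 < ε → IsGroundState T w ε (φ₁ ε)) →
          (fun ε => interactionEnergy T N (g ε) (ωperp ε) (φ₁ ε)) ~[𝓝[>] (0 : ℝ)]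
            (fun ε => c₄ / (2 * Real.pi) * (g ε * ωperp ε / N) * ε ^ (-(1 / 2) : ℝ))) ∧
    -- quasi-linear regime
    (∀ N : ℕ, 1 ≤ N → ∀ g ωperp Ω : ℝ → ℝ,
      (∀ ε, 0 < ε → 0 ≤ g ε ∧ 0 ≤ Ω ε ∧ Ω ε < ωperp ε) →
      (g =o[𝓝[>] (0 : ℝ)] (fun ε => ε ^ (1 / 2 : ℝ)) ∨
        (fun ε => g ε * ωperp ε * ε ^ (1 / 2 : ℝ)) =o[𝓝[>] (0 : ℝ)] (fun _ => (1 : ℝ))) →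
      (fun ε => groundEnergy T w N ε (g ε) (ωperp ε) (Ω ε)) ~[𝓝[>] (0 : ℝ)]
        (fun ε => lambdaOne T w ε + ωperp ε)) := by
  choose f hf hnorm using fun ε => (exists_positive_groundState hw ε).2
  refine ⟨fun ε _ => ⟨(exists_positive_groundState hw ε).1, _, (hf ε).isGroundState (hnorm ε)⟩,
    fun N hN ε g ωperp Ω _ hg hΩ hω => ⟨le_groundEnergy hw hN ε hg hΩ hω, fun φ₁ hφ₁ => ?_⟩,
    ⟨_, integral_gaussian_density_sq_pos hw.kappa_pos, fun N _ g ωperp _ φ₁ hφ₁ => ?_⟩,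
    fun N hN g ωperp Ω hpar hql => isEquivalent_groundEnergy hw hN hpar hql⟩
  · rw [interactionEnergy_eq hw (hf ε) (hnorm ε) hφ₁]
    exact groundEnergy_le hw hN hg hΩ hω (hf ε) (hnorm ε)
  · refine (isEquivalent_interaction hw (fun ε _ => hf ε) (fun ε _ => hnorm ε) N).congr_left ?_
    filter_upwards [self_mem_nhdsWithin] with ε hε
    exact (interactionEnergy_eq hw (hf ε) (hnorm ε) (hφ₁ ε hε) N (g ε) (ωperp ε)).symm
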